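/- Let $(X,J)$ be a (smooth, finite-dimensional) almost complex manifold without boundary and let $g$ be any Riemannian metric on $X$, with distance function $d_g$, balls $B^g_\delta(x)$ and diameters $\mathrm{diam}_g$. For $R>0$ let the cylinder $[-R,R]\times S^1$ carry the complex structure for which $z=t+\mathfrak i\theta\mapsto(t,e^{\mathfrak i\theta})$ is a local complex coordinate. A map $u:[-R,R]\times S^1\to X$ is $J$-holomorphic if it is smooth (up to the boundary) and $\mathrm{d}u\circ\mathfrak i=J\circ\mathrm{d}u$. For $[a,b]\subset[-R,R]$ write $$E_g\big(u;[a,b]\times S^1\big)=\frac12\int_a^b\!\int_{-\pi}^{\pi}\big(|\partial_tu|_g^2+|\partial_\theta u|_g^2\big)\,\mathrm d\theta\,\mathrm dt,\qquad E_g(u)=E_g\big(u;[-R,R]\times S^1\big).$$ (For $T>R$ the set $[-R+T,R-T]\times S^1$ is empty; its energy and diameter are $0$.) (1) There exist continuous functions $\delta_{J,g},\hbar_{J,g},C_{J,g}:X\to\mathbb R^+$ with the following property. If $R>0$ and $u:[-R,R]\times S^1\to X$ is a $J$-holomorphic map such that $\mathrm{Im}\,u\subset B^g_{\delta_{J,g}(u(0,1))}(u(0,1))$,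 then $$E_g\big(u;[-R+T,R-T]\times S^1\big)\le C_{J,g}(u(0,1))\,e^{-T}E_g(u)\qquad\forall\,T\ge0.$$ If in addition $E_g(u)<\hbar_{J,g}(u(0,1))$, then $$\mathrm{diam}_g\big(u([-R+T,R-T]\times S^1)\big)\le C_{J,g}(u(0,1))\,e^{-T/2}\sqrt{E_g(u)}\qquad\forall\,T\ge1.$$ (2) If $X$ is compact, there exist constants $\hbar_{J,g},C_{J,g}\in\mathbb R^+$ with the following property. If $R>0$ and $u:[-R,R]\times S^1\to X$ is a $J$-holomorphic map with $E_g(u)<\hbar_{J,g}$, then $$E_g\big(u;[-R+T,R-T]\times S^1\big)\le C_{J,g}\,e^{-T}E_g(u)\quad\forall\,T\ge1,\qquad \mathrm{diam}_g\big(u([-R+T,R-T]\times S^1)\big)\le C_{J,g}\,e^{-T/2}\sqrt{E_g(u)}\quad\forall\,T\ge2.$$ -/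

import Mathlib

open Bundle
open scoped Manifold ContDiff

/-- A smooth almost complex structure on a manifold `X` modelled on `E`: a smooth section `J` of
`End(TX)` with `J ∘ J = -id`. -/
structure AlmostComplexStructure (E : Type*) [NormedAddCommGroup E] [NormedSpace ℝ E]
    (X : Type*) [TopologicalSpace X] [ChartedSpace E X] [IsManifold 𝓘(ℝ, E) ∞ X] where
  /-- The endomorphism of each tangent space. -/
  toEnd (x : X) : TangentSpace 𝓘(ℝ, E) x →L[ℝ] TangentSpace 𝓘(ℝ, E) x
  sq_eq_neg (x : X) (v : TangentSpace 𝓘(ℝ, E) x) : toEnd x (toEnd x v) = -v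
  smooth : ContMDiff 𝓘(ℝ, E) (𝓘(ℝ, E).prod 𝓘(ℝ, E →L[ℝ] E)) ∞
    (fun x ↦ Bundle.TotalSpace.mk' (E →L[ℝ] E)
      (E := fun y ↦ TangentSpace 𝓘(ℝ, E) y →L[ℝ] TangentSpace 𝓘(ℝ, E) y) x (toEnd x))

/-- The cylinder `[a, b] × S¹`, inside `ℝ × S¹`. -/
def cylinder (a b : ℝ) : Set (ℝ × Circle) := Set.Icc a b ×ˢ Set.univ

/-- The complex coordinate `z = t + iθ ↦ (t, e^{iθ})` on `ℝ × S¹`; the complex structure of the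
cylinder is multiplication by `i` in this coordinate. -/
noncomputable def cylinderCoord (z : ℂ) : ℝ × Circle := (z.re, Circle.exp z.im)

/-- The differential at `z`, in the coordinate `cylinderCoord`, of a map `u` from the cylinder
`[-R, R] × S¹`, as a real-linear map `ℂ → T_{u(z)}X`. The derivative is taken within the closed
strip which covers the cylinder, so it is one-sided on the boundary and the values of `u` outside
of the cylinder play no role. -/
noncomputable def cylinderDeriv (E : Type*) [NormedAddCommGroup E] [NormedSpace ℝ E]
    {X : Type*} [TopologicalSpace X] [ChartedSpace E X] (R : ℝ) (u : ℝ × Circle → X) (z : ℂ) :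
    ℂ →L[ℝ] TangentSpace 𝓘(ℝ, E) (u (cylinderCoord z)) :=
  mfderivWithin 𝓘(ℝ, ℂ) 𝓘(ℝ, E) (fun w : ℂ ↦ u (cylinderCoord w))
    (cylinderCoord ⁻¹' cylinder (-R) R) z

/-- `u` restricts to a `J`-holomorphic map `[-R, R] × S¹ → X`: it is smooth there (up to the
boundary) and `du ∘ i = J ∘ du`. -/
structure IsJHolomorphicCylinder {E : Type*} [NormedAddCommGroup E] [NormedSpace ℝ E]
    {X : Type*} [TopologicalSpace X] [ChartedSpace E X] [IsManifold 𝓘(ℝ, E) ∞ X]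
    (J : AlmostComplexStructure E X) (R : ℝ) (u : ℝ × Circle → X) : Prop where
  smooth : ContMDiffOn (𝓘(ℝ, ℝ).prod (𝓡 1)) 𝓘(ℝ, E) ∞ u (cylinder (-R) R)
  map_I_mul (z : ℂ) (hz : cylinderCoord z ∈ cylinder (-R) R) (v : ℂ) :
    cylinderDeriv E R u z (Complex.I * v) =
      J.toEnd (u (cylinderCoord z)) (cylinderDeriv E R u z v)

/-- The energy `E_g(u; U) = ½ ∫_U (|∂u/∂t|² + |∂u/∂θ|²) dt dθ` over a subset `U` of the cylinder
`[-R, R] × S¹` of a map `u` on that cylinder, with norms taken in the Riemannian metric of `X`.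
The angle `θ` runs over `(-π, π]`. -/
noncomputable def cylinderEnergy (E : Type*) [NormedAddCommGroup E] [NormedSpace ℝ E]
    {X : Type*} [TopologicalSpace X] [ChartedSpace E X] [IsManifold 𝓘(ℝ, E) ∞ X]
    [RiemannianBundle (fun x : X ↦ TangentSpace 𝓘(ℝ, E) x)]
    (R : ℝ) (u : ℝ × Circle → X) (U : Set (ℝ × Circle)) : ENNReal :=
  2⁻¹ * ∫⁻ z in {z : ℂ | z.im ∈ Set.Ioc (-Real.pi) Real.pi ∧ cylinderCoord z ∈ U},
    (‖cylinderDeriv E R u z 1‖ₑ ^ 2 + ‖cylinderDeriv E R u z Complex.I‖ₑ ^ 2)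

/-!
Away from the ends of a long cylinder, a `J`-holomorphic map of small energy is exponentially small.
A map `u` from the cylinder is lifted to the `2πi`-periodic map `z ↦ u (cylinderCoord z)` on the
strip `|re z| < R`, and `J` is compared with the multiplication by `i` of a complex vector space in
a chart adapted to `J` at one point (`HasAdaptedChart`), whose quality is measured by one number
`K`.

*Energy.* Suppose that the image lies in one adapted chart. The symplectic area of the cylinder over
`[-b, b]` is comparable to its energy `e(b)`. By Stokes' theorem it is the difference of the actions
of the two boundary loops, and the action of a loop is at most `2π / 4` times the square of the `L²`
norm of its velocity, as a closed curve of length `L` lies in a ball of radius `L / 4`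
(`abs_integral_bilin_loop_le`). Hence `e ≤ e'` (`isoperimetric_strip`), and `e(b)` decays like `exp
(-(R - b))` (`lintegral_strip_decay`, `stripEnergy_decay`).

*Gradient.* In an adapted chart, with the complex structure frozen at a point, the map satisfies the
Cauchy–Riemann equation up to an error linear in the distance to that point, which gives a mean
value inequality for its derivative (`norm_fderiv_one_le_ball_average`). Heinz' maximum argument
turns this into a bound for the gradient by the square root of the energy, as soon as the energy on
a disc of radius `1 / 2` is small (`IsJHolomorphicOn.enorm_sq_le_of_lintegral_lt`).

*Diameter.* The energy decay and the gradient bound show that the gradient is exponentially small in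
the distance to the ends, and integration gives the bound for the diameter (`edist_zero_le_exp`).

*Compact targets.* Here one `K` works at all points. If the energy is small, then the image of the
cylinder, apart from its ends, automatically lies in one adapted chart: this propagates from the
centre in steps of length `1 / 2`, because the diameter bound does not depend on the length of the
cylinder (`edist_zero_le_of_stripEnergy`). In the noncompact case the constants depend continuously
on the centre of the image since `K` can be chosen continuously
(`exists_continuous_hasAdaptedChart`).
-/

section

open MeasureTheory hiding cylinder
open Set

set_option linter.unusedSectionVars false

/-! ### Isoperimetric inequality for loops -/

section Loops

variable {F : Type*} [NormedAddCommGroup F] [NormedSpace ℝ F] [CompleteSpace F]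

/-- A closed curve of length `L` lies in a ball of radius `L / 4`, centred at the midpoint of two
points of the curve which cut it into arcs of equal length. -/
theorem exists_norm_sub_le_quarter_length {γ γ' : ℝ → F} {a b : ℝ} (hab : a ≤ b)
    (hγ : ∀ x, HasDerivAt γ (γ' x) x) (hc : Continuous γ') (hper : γ b = γ a) :
    ∃ p, ∀ x ∈ Icc a b, ‖γ x - p‖ ≤ (∫ x in a..b, ‖γ' x‖) / 4 := by
  have hI : ∀ s t, IntervalIntegrable (fun x ↦ ‖γ' x‖) volume s t :=
    fun s t ↦ hc.norm.intervalIntegrable s t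
  set ℓ : ℝ → ℝ := fun s ↦ ∫ x in a..s, ‖γ' x‖ with hℓ
  have hlen : ∀ s t, s ≤ t → ‖γ t - γ s‖ ≤ ∫ x in s..t, ‖γ' x‖ := by
    intro s t hst
    rw [← intervalIntegral.integral_eq_sub_of_hasDerivAt (fun x _ ↦ hγ x)
      (hc.intervalIntegrable s t)]
    exact intervalIntegral.norm_integral_le_integral_norm hst
  have hcont : Continuous ℓ := intervalIntegral.continuous_primitive hI a
  have h0 : 0 ≤ ℓ b := intervalIntegral.integral_nonneg hab fun x _ ↦ norm_nonneg _
  obtain ⟨c, hcab, hcl⟩ : ℓ b / 2 ∈ ℓ '' Icc a b := by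
    apply intermediate_value_Icc hab hcont.continuousOn
    constructor
    · simp only [hℓ, intervalIntegral.integral_same]; simpa using by linarith
    · linarith
  have hadd : ∀ s t u, (∫ x in s..t, ‖γ' x‖) + ∫ x in t..u, ‖γ' x‖ = ∫ x in s..u, ‖γ' x‖ :=
    fun s t u ↦ intervalIntegral.integral_add_adjacent_intervals (hI s t) (hI t u)
  refine ⟨(2⁻¹ : ℝ) • (γ a + γ c), fun x hx ↦ ?_⟩
  have key : ‖γ x - γ a‖ + ‖γ x - γ c‖ ≤ ℓ b / 2 := by
    rcases le_total x c with h | h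
    · have h1 := hlen a x hx.1
      have h2 := hlen x c h
      rw [norm_sub_rev] at h2
      have h3 := hadd a x c
      simp only [hℓ] at hcl ⊢
      linarith
    · have h1 := hlen c x h
      have h2 := hlen x b hx.2
      rw [hper, norm_sub_rev] at h2
      have h3 := hadd c x b
      have h4 := hadd a c b
      simp only [hℓ] at hcl ⊢
      linarith
  have : γ x - (2⁻¹ : ℝ) • (γ a + γ c) = (2⁻¹ : ℝ) • ((γ x - γ a) + (γ x - γ c)) := by
    module
  rw [this, norm_smul, Real.norm_of_nonneg (by norm_num)]
  have := norm_add_le (γ x - γ a) (γ x - γ c)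
  simp only [hℓ] at key
  linarith

/-- The Cauchy–Schwarz inequality, from the nonnegative integral of `((b - a) ‖g‖ - ∫ ‖g‖) ^ 2`. -/
theorem sq_integral_norm_le {F : Type*} [NormedAddCommGroup F] {g : ℝ → F}
    {a b : ℝ} (hab : a ≤ b) (hc : Continuous g) :
    (∫ x in a..b, ‖g x‖) ^ 2 ≤ (b - a) * ∫ x in a..b, ‖g x‖ ^ 2 := by
  set m := ∫ x in a..b, ‖g x‖ with hm
  have h1 : 0 ≤ ∫ x in a..b, ((b - a) * ‖g x‖ - m) ^ 2 :=
    intervalIntegral.integral_nonneg hab fun x _ ↦ sq_nonneg _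
  have h2 : ∫ x in a..b, ((b - a) * ‖g x‖ - m) ^ 2
      = (b - a) ^ 2 * (∫ x in a..b, ‖g x‖ ^ 2) - 2 * (b - a) * m * m + (b - a) * m ^ 2 := by
    have : ∀ x, ((b - a) * ‖g x‖ - m) ^ 2
        = (b - a) ^ 2 * ‖g x‖ ^ 2 - 2 * (b - a) * m * ‖g x‖ + m ^ 2 := fun x ↦ by ring
    simp only [this]
    have hcn := hc.norm
    rw [intervalIntegral.integral_add, intervalIntegral.integral_sub,
      intervalIntegral.integral_const_mul, intervalIntegral.integral_const_mul,
      intervalIntegral.integral_const, smul_eq_mul]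
    all_goals exact Continuous.intervalIntegrable (by fun_prop) _ _
  rcases hab.eq_or_lt with rfl | hlt
  · simp [hm]
  have hpos : 0 < b - a := sub_pos.2 hlt
  rw [h2] at h1
  have : 0 ≤ (b - a) * ((b - a) * (∫ x in a..b, ‖g x‖ ^ 2) - m ^ 2) := by nlinarith
  have := nonneg_of_mul_nonneg_right this hpos
  linarith

/-- The isoperimetric inequality, for the action `∫ B(γ, γ')` of a loop with respect to a bilinear
form of norm at most `1`: for a loop, the action does not change when `γ` is translated, so `γ` may
be replaced by `γ - p` with `‖γ - p‖` at most a quarter of the length. -/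
theorem abs_integral_bilin_loop_le (B : F →L[ℝ] F →L[ℝ] ℝ)
    (hB : ∀ x y, |B x y| ≤ ‖x‖ * ‖y‖) {γ γ' : ℝ → F} {a b : ℝ} (hab : a ≤ b)
    (hγ : ∀ x, HasDerivAt γ (γ' x) x) (hc : Continuous γ') (hper : γ b = γ a) :
    |∫ x in a..b, B (γ x) (γ' x)| ≤ (b - a) / 4 * ∫ x in a..b, ‖γ' x‖ ^ 2 := by
  obtain ⟨p, hp⟩ := exists_norm_sub_le_quarter_length hab hγ hc hper
  have hγc : Continuous γ := continuous_iff_continuousAt.2 fun x ↦ (hγ x).continuousAt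
  have h0 : ∫ x in a..b, B p (γ' x) = 0 := by
    rw [ContinuousLinearMap.intervalIntegral_comp_comm _ (hc.intervalIntegrable a b),
      intervalIntegral.integral_eq_sub_of_hasDerivAt (fun x _ ↦ hγ x)
      (hc.intervalIntegrable a b), hper, sub_self, map_zero]
  have h1 : ∫ x in a..b, B (γ x) (γ' x) = ∫ x in a..b, B (γ x - p) (γ' x) := by
    rw [← sub_zero (∫ x in a..b, B (γ x) (γ' x)), ← h0, ← intervalIntegral.integral_sub]
    · simp
    all_goals exact Continuous.intervalIntegrable (by fun_prop) _ _
  rw [h1, ← Real.norm_eq_abs]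
  set L := ∫ x in a..b, ‖γ' x‖ with hL
  calc ‖∫ x in a..b, B (γ x - p) (γ' x)‖ ≤ ∫ x in a..b, ‖B (γ x - p) (γ' x)‖ :=
        intervalIntegral.norm_integral_le_integral_norm hab
    _ ≤ ∫ x in a..b, L / 4 * ‖γ' x‖ := by
        apply intervalIntegral.integral_mono_on hab
        · exact Continuous.intervalIntegrable (by fun_prop) _ _
        · exact Continuous.intervalIntegrable (by fun_prop) _ _
        · intro x hx
          exact (hB _ _).trans (mul_le_mul_of_nonneg_right (hp x hx) (norm_nonneg _))
    _ = L ^ 2 / 4 := by rw [intervalIntegral.integral_const_mul]; ring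
    _ ≤ _ := by
        have := sq_integral_norm_le hab hc
        linarith

end Loops

/-! ### Energy decay for almost holomorphic maps of a strip to a complex inner product space -/

section Decay

variable {F : Type*} [NormedAddCommGroup F] [InnerProductSpace ℂ F]

/-- The standard symplectic form `(x, y) ↦ ⟪i x, y⟫_ℝ` of a complex inner product space, as a
bounded real-bilinear form. -/
noncomputable def standardSymplectic (F : Type*) [NormedAddCommGroup F] [InnerProductSpace ℂ F] :
    F →L[ℝ] F →L[ℝ] ℝ :=
  letI : InnerProductSpace ℝ F := InnerProductSpace.complexToReal
  (innerSL ℝ (E := F)).comp (Complex.I • ContinuousLinearMap.id ℝ F)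

theorem standardSymplectic_apply (x y : F) :
    standardSymplectic F x y = (inner ℂ (Complex.I • x) y).re := by
  rfl

theorem standardSymplectic_antisymm (x y : F) :
    standardSymplectic F x y = - standardSymplectic F y x := by
  rw [standardSymplectic_apply, standardSymplectic_apply, inner_smul_left, inner_smul_left,
    ← inner_conj_symm x y]
  simp [← Complex.conj_im (inner ℂ y x), -Complex.conj_im, -inner_conj_symm]

theorem abs_standardSymplectic_le (x y : F) : |standardSymplectic F x y| ≤ ‖x‖ * ‖y‖ := by
  rw [standardSymplectic_apply]
  refine (Complex.abs_re_le_norm _).trans ((norm_inner_le_norm _ _).trans ?_)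
  simp [norm_smul]

theorem standardSymplectic_apply_I_smul (x : F) :
    standardSymplectic F x (Complex.I • x) = ‖x‖ ^ 2 := by
  rw [standardSymplectic_apply, inner_smul_left, inner_smul_right, inner_self_eq_norm_sq_to_K]
  rw [← mul_assoc]
  simp [← Complex.ofReal_pow]

theorem fderiv_add_period {G : Type*} [NormedAddCommGroup G] [NormedSpace ℝ G] {w : ℂ → G} {p : ℂ}
    (h : ∀ z, w (z + p) = w z) (z : ℂ) : fderiv ℝ w (z + p) = fderiv ℝ w z := by
  rw [← fderiv_comp_add_right]
  simp only [h]

variable {R : ℝ} {w : ℂ → F}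

theorem isOpen_strip (R : ℝ) : IsOpen {z : ℂ | |z.re| < R} :=
  isOpen_lt (by fun_prop) (by fun_prop)

theorem contDiffAt_of_strip (hw : ContDiffOn ℝ ∞ w {z : ℂ | |z.re| < R}) {z : ℂ}
    (hz : |z.re| < R) : ContDiffAt ℝ ∞ w z :=
  hw.contDiffAt ((isOpen_strip R).mem_nhds hz)

theorem contDiffOn_fderiv_strip (hw : ContDiffOn ℝ ∞ w {z : ℂ | |z.re| < R}) :
    ContDiffOn ℝ ∞ (fderiv ℝ w) {z : ℂ | |z.re| < R} :=
  hw.fderiv_of_isOpen (isOpen_strip R) le_rfl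

/-- Stokes' theorem for the pull-back of the symplectic form by `w` and its primitive, the action,
on the rectangle `[s, t] × [-π, π]`. The contributions of the two horizontal sides cancel because
`w` is periodic. -/
theorem integral_standardSymplectic_strip
    (hw : ContDiffOn ℝ ∞ w {z : ℂ | |z.re| < R})
    (hper : ∀ z, w (z + 2 * Real.pi * Complex.I) = w z) {s t : ℝ} (hs : |s| < R) (ht : |t| < R) :
    (∫ x in s..t, ∫ y in (-Real.pi)..Real.pi, 2 * standardSymplectic F
        (fderiv ℝ w (x + y * Complex.I) 1) (fderiv ℝ w (x + y * Complex.I) Complex.I)) =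
      (∫ y in (-Real.pi)..Real.pi, standardSymplectic F
        (w (t + y * Complex.I)) (fderiv ℝ w (t + y * Complex.I) Complex.I)) -
      ∫ y in (-Real.pi)..Real.pi, standardSymplectic F
        (w (s + y * Complex.I)) (fderiv ℝ w (s + y * Complex.I) Complex.I) := by
  set e : (ℝ × ℝ) →L[ℝ] ℂ := (Complex.equivRealProdCLM.symm : (ℝ × ℝ) →L[ℝ] ℂ) with he
  have he' : ∀ x y : ℝ, (x : ℂ) + y * Complex.I = e (x, y) := fun x y ↦
    (Complex.mk_eq_add_mul_I x y).symm
  have he₁ : e (1, 0) = 1 := rfl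
  have he₂ : e (0, 1) = Complex.I := rfl
  have hre : ∀ p : ℝ × ℝ, (e p).re = p.1 := fun p ↦ rfl
  set D := fderiv ℝ w with hD
  have hDc := contDiffOn_fderiv_strip hw
  set B := standardSymplectic F with hB
  have hfd : ∀ p : ℝ × ℝ, |p.1| < R → HasFDerivAt w (D (e p)) (e p) := fun p hp ↦
    ((contDiffAt_of_strip hw hp).differentiableAt (by simp)).hasFDerivAt
  have hfd2 : ∀ p : ℝ × ℝ, |p.1| < R → ∀ v, HasFDerivAt (fun z ↦ D z v)
      ((ContinuousLinearMap.apply ℝ F v).comp (fderiv ℝ D (e p))) (e p) := fun p hp v ↦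
    (ContinuousLinearMap.apply ℝ F v).hasFDerivAt.comp _
    (((hDc.contDiffAt ((isOpen_strip R).mem_nhds hp)).differentiableAt (by simp)).hasFDerivAt)
  have hfv : ∀ p : ℝ × ℝ, |p.1| < R → ∀ v, HasFDerivAt (fun p ↦ B (w (e p)) (D (e p) v))
      ((B.precompR ℂ (w (e p)) ((ContinuousLinearMap.apply ℝ F v).comp (fderiv ℝ D (e p))) +
        B.precompL ℂ (D (e p)) (D (e p) v)).comp e) p := fun p hp v ↦
    (B.hasFDerivAt_of_bilinear (hfd p hp) (hfd2 p hp v)).comp p e.hasFDerivAt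
  have hsymm : ∀ p : ℝ × ℝ, |p.1| < R →
      fderiv ℝ D (e p) 1 Complex.I = fderiv ℝ D (e p) Complex.I 1 := fun p hp ↦
    (contDiffAt_of_strip hw hp).isSymmSndFDerivAt
      (by simp only [minSmoothness_of_isRCLikeNormedField]; exact WithTop.coe_le_coe.2 le_top)
      1 Complex.I
  have hdiv : ∀ p : ℝ × ℝ, |p.1| < R →
      ((B.precompR ℂ (w (e p)) ((ContinuousLinearMap.apply ℝ F Complex.I).comp (fderiv ℝ D (e p))) +
        B.precompL ℂ (D (e p)) (D (e p) Complex.I)).comp e) (1, 0) +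
      (-((B.precompR ℂ (w (e p)) ((ContinuousLinearMap.apply ℝ F 1).comp (fderiv ℝ D (e p))) +
        B.precompL ℂ (D (e p)) (D (e p) 1)).comp e)) (0, 1) =
      2 * B (D (e p) 1) (D (e p) Complex.I) := by
    intro p hp
    simp only [ContinuousLinearMap.comp_apply, add_apply, neg_apply, he₁, he₂,
      ContinuousLinearMap.precompR_apply,
      ContinuousLinearMap.precompL_apply, ContinuousLinearMap.compL_apply,
      ContinuousLinearMap.apply_apply, hsymm p hp]
    rw [hB, standardSymplectic_antisymm (D (e p) Complex.I)]
    ring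
  have hmem : ∀ p ∈ uIcc s t ×ˢ uIcc (-Real.pi) Real.pi, |p.1| < R := by
    rintro p ⟨hp, -⟩
    rw [abs_lt] at *
    rcases le_total s t with h | h
    · rw [uIcc_of_le h] at hp; exact ⟨by linarith [hp.1], by linarith [hp.2]⟩
    · rw [uIcc_of_ge h] at hp; exact ⟨by linarith [hp.1], by linarith [hp.2]⟩
  have hmem' : ∀ p ∈ Ioo (min s t) (max s t) ×ˢ
      Ioo (min (-Real.pi) Real.pi) (max (-Real.pi) Real.pi), |p.1| < R := fun p hp ↦
    hmem p ⟨Ioo_subset_Icc_self hp.1, Ioo_subset_Icc_self hp.2⟩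
  have key := integral2_divergence_prod_of_hasFDerivAt
    (fun p ↦ B (w (e p)) (D (e p) Complex.I)) (fun p ↦ -B (w (e p)) (D (e p) 1)) _ _
    s (-Real.pi) t Real.pi
    (fun p hp ↦ (hfv p (hmem p hp) _).continuousAt.continuousWithinAt)
    (fun p hp ↦ (hfv p (hmem p hp) _).neg.continuousAt.continuousWithinAt)
    (fun p hp ↦ hfv p (hmem' p hp) Complex.I)
    (fun p hp ↦ (hfv p (hmem' p hp) 1).neg) ?_
  · have h1 : (∫ x in s..t, -B (w (e (x, Real.pi))) (D (e (x, Real.pi)) 1))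
        = ∫ x in s..t, -B (w (e (x, -Real.pi))) (D (e (x, -Real.pi)) 1) := by
      congr 1
      ext x
      have : e (x, Real.pi) = e (x, -Real.pi) + 2 * Real.pi * Complex.I := by
        rw [← he', ← he']; push_cast; ring
      rw [this, hper, hD, fderiv_add_period hper]
    rw [h1, sub_self, zero_add] at key
    simp only [he'] at *
    rw [← key]
    apply intervalIntegral.integral_congr
    intro x hx
    apply intervalIntegral.integral_congr
    intro y hy
    exact (hdiv (x, y) (hmem _ ⟨hx, hy⟩)).symm
  · have hc : ContinuousOn (fun p ↦ 2 * B (D (e p) 1) (D (e p) Complex.I))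
        (uIcc s t ×ˢ uIcc (-Real.pi) Real.pi) := by
      have : ∀ v, ContinuousOn (fun p ↦ D (e p) v) (uIcc s t ×ˢ uIcc (-Real.pi) Real.pi) :=
        fun v p hp ↦ ((hfd2 p (hmem p hp) v).continuousAt.comp
          e.continuous.continuousAt).continuousWithinAt
      exact continuousOn_const.mul
        ((B.continuous.comp_continuousOn (this 1)).clm_apply (this Complex.I))
    refine (hc.integrableOn_compact (isCompact_uIcc.prod isCompact_uIcc)).congr_fun
      (fun p hp ↦ (hdiv p (hmem p hp)).symm) (measurableSet_uIcc.prod measurableSet_uIcc)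

/-- The energy of `∂w/∂t` on the circle `re z = t`, that is, `∫ ‖∂w/∂t‖ ^ 2 dθ` for `θ` from `-π` to
`π`. -/
noncomputable def sliceEnergy (w : ℂ → F) (t : ℝ) : ℝ :=
  ∫ y in (-Real.pi)..Real.pi, ‖fderiv ℝ w (t + y * Complex.I) 1‖ ^ 2

theorem continuousOn_sliceEnergy (hw : ContDiffOn ℝ ∞ w {z : ℂ | |z.re| < R}) :
    ContinuousOn (sliceEnergy w) {t | |t| < R} := by
  rw [continuousOn_iff_continuous_domRestrict]
  have := intervalIntegral.continuous_parametric_intervalIntegral_of_continuous' (μ := volume)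
    (f := fun (t : {t : ℝ | |t| < R}) (y : ℝ) ↦
    ‖fderiv ℝ w ((t : ℝ) + y * Complex.I) 1‖ ^ 2) ?_ (-Real.pi) Real.pi
  · exact this
  · have h : Continuous (fun p : {t : ℝ | |t| < R} × ℝ ↦
        fderiv ℝ w (((p.1 : ℝ) : ℂ) + p.2 * Complex.I)) := by
      refine (contDiffOn_fderiv_strip hw).continuousOn.comp_continuous (by fun_prop) ?_
      rintro ⟨⟨t, ht⟩, y⟩
      simpa using ht
    exact ((h.clm_apply continuous_const).norm.pow 2)

theorem sliceEnergy_nonneg (w : ℂ → F) (t : ℝ) : 0 ≤ sliceEnergy w t :=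
  intervalIntegral.integral_nonneg (by linarith [Real.pi_pos]) fun _ _ ↦ sq_nonneg _

theorem intervalIntegrable_sliceEnergy (hw : ContDiffOn ℝ ∞ w {z : ℂ | |z.re| < R}) {s t : ℝ}
    (hs : |s| < R) (ht : |t| < R) : IntervalIntegrable (sliceEnergy w) volume s t := by
  apply ContinuousOn.intervalIntegrable
  apply (continuousOn_sliceEnergy hw).mono
  intro x hx
  rcases mem_uIcc.1 hx with h | h
  · exact (abs_le_max_abs_abs h.1 h.2).trans_lt (max_lt hs ht)
  · exact (abs_le_max_abs_abs h.1 h.2).trans_lt (max_lt ht hs)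

/-- The energy of an almost holomorphic map `w` of the cylinder over `[-a, a]` is bounded by its
energy on the two boundary circles: the symplectic area is comparable to the energy, it equals the
difference of the actions of the boundary loops by Stokes' theorem, and these are controlled by the
isoperimetric inequality. The numerical constants leave room for an error of `1 / 20` in the
Cauchy–Riemann equation. -/
theorem isoperimetric_strip [CompleteSpace F] (hw : ContDiffOn ℝ ∞ w {z : ℂ | |z.re| < R})
    (hper : ∀ z, w (z + 2 * Real.pi * Complex.I) = w z)
    (hhol : ∀ z : ℂ, |z.re| < R →
      ‖fderiv ℝ w z Complex.I - Complex.I • fderiv ℝ w z 1‖ ≤ ‖fderiv ℝ w z 1‖ / 20)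
    {a : ℝ} (h0 : 0 ≤ a) (ha : a < R) :
    ∫ x in (-a)..a, sliceEnergy w x ≤ sliceEnergy w a + sliceEnergy w (-a) := by
  have haR : |a| < R := by rwa [abs_of_nonneg h0]
  have haR' : |-a| < R := by rwa [abs_neg]
  have hre : ∀ x y : ℝ, ((x : ℂ) + y * Complex.I).re = x := by simp
  have hslice : ∀ t : ℝ, |t| < R → ∀ v, Continuous fun y : ℝ ↦
      fderiv ℝ w (t + y * Complex.I) v := fun t ht v ↦
    ((contDiffOn_fderiv_strip hw).continuousOn.comp_continuous (by fun_prop)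
      (fun y ↦ by simpa using ht)).clm_apply continuous_const
  have hwslice : ∀ t : ℝ, |t| < R → Continuous fun y : ℝ ↦ w (t + y * Complex.I) := fun t ht ↦
    hw.continuousOn.comp_continuous (by fun_prop) (fun y ↦ by simpa using ht)
  -- the isoperimetric constant is `2π / 4`, and `2π / 4 * (21 / 20) ^ 2 ≤ 9 / 5`
  have hact : ∀ t : ℝ, |t| < R → |∫ y in (-Real.pi)..Real.pi, standardSymplectic F
      (w (t + y * Complex.I)) (fderiv ℝ w (t + y * Complex.I) Complex.I)| ≤
      9 / 5 * sliceEnergy w t := by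
    intro t ht
    have h1 := abs_integral_bilin_loop_le (standardSymplectic F) abs_standardSymplectic_le
      (γ := fun y : ℝ ↦ w (t + y * Complex.I))
      (γ' := fun y : ℝ ↦ fderiv ℝ w (t + y * Complex.I) Complex.I) (a := -Real.pi) (b := Real.pi)
      (by linarith [Real.pi_pos]) ?_ (hslice t ht _) ?_
    · have h2 : ∫ y in (-Real.pi)..Real.pi, ‖fderiv ℝ w (t + y * Complex.I) Complex.I‖ ^ 2 ≤
          ∫ y in (-Real.pi)..Real.pi, (441 / 400) * ‖fderiv ℝ w (t + y * Complex.I) 1‖ ^ 2 := by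
        apply intervalIntegral.integral_mono_on (by linarith [Real.pi_pos])
        · exact ((hslice t ht _).norm.pow 2).intervalIntegrable _ _
        · exact (((hslice t ht _).norm.pow 2).const_mul _).intervalIntegrable _ _
        · intro y _
          have h3 := hhol (t + y * Complex.I) (by rwa [hre])
          have h4 := norm_sub_norm_le (fderiv ℝ w (t + y * Complex.I) Complex.I)
            (Complex.I • fderiv ℝ w (t + y * Complex.I) 1)
          rw [norm_smul, Complex.norm_I, one_mul] at h4
          have h5 := norm_nonneg (fderiv ℝ w (t + y * Complex.I) Complex.I)
          nlinarith
      rw [intervalIntegral.integral_const_mul] at h2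
      change _ ≤ 441 / 400 * sliceEnergy w t at h2
      have h3 := sliceEnergy_nonneg w t
      have h4 := Real.pi_lt_d2
      have h5 := Real.pi_pos
      refine h1.trans ?_
      calc (Real.pi - -Real.pi) / 4 *
            ∫ y in (-Real.pi)..Real.pi, ‖fderiv ℝ w (t + y * Complex.I) Complex.I‖ ^ 2
          ≤ (Real.pi - -Real.pi) / 4 * (441 / 400 * sliceEnergy w t) := by gcongr; linarith
        _ ≤ 9 / 5 * sliceEnergy w t := by nlinarith
    · intro y
      have h1 : HasFDerivAt w (fderiv ℝ w (t + y * Complex.I)) (t + y * Complex.I) :=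
        ((contDiffAt_of_strip hw (by rwa [hre])).differentiableAt (by simp)).hasFDerivAt
      have h2 : HasDerivAt (fun y : ℝ ↦ (t : ℂ) + y * Complex.I) Complex.I y := by
        simpa using ((Complex.ofRealCLM.hasDerivAt (x := y)).mul_const Complex.I).const_add (t : ℂ)
      exact h1.comp_hasDerivAt y h2
    · have := hper (t + (-Real.pi : ℝ) * Complex.I)
      rw [← this]
      congr 1
      push_cast
      ring
  have hstokes := integral_standardSymplectic_strip hw hper haR' haR
  -- twice the symplectic area density is at least `2 * (1 - 1 / 20) * ‖∂w/∂t‖ ^ 2`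
  have hlow : ∫ x in (-a)..a, (19 / 10) * sliceEnergy w x ≤
      ∫ x in (-a)..a, ∫ y in (-Real.pi)..Real.pi, 2 * standardSymplectic F
        (fderiv ℝ w (x + y * Complex.I) 1) (fderiv ℝ w (x + y * Complex.I) Complex.I) := by
    have hmem : ∀ x ∈ Icc (-a) a, |x| < R := fun x hx ↦ (abs_le.2 hx).trans_lt ha
    apply intervalIntegral.integral_mono_on (by linarith)
    · exact (intervalIntegrable_sliceEnergy hw haR' haR).const_mul _
    · apply ContinuousOn.intervalIntegrable
      rw [uIcc_of_le (by linarith), continuousOn_iff_continuous_domRestrict]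
      have := intervalIntegral.continuous_parametric_intervalIntegral_of_continuous' (μ := volume)
        (f := fun (t : Icc (-a) a) (y : ℝ) ↦ 2 * standardSymplectic F
        (fderiv ℝ w (((t : ℝ) : ℂ) + y * Complex.I) 1)
        (fderiv ℝ w (((t : ℝ) : ℂ) + y * Complex.I) Complex.I)) ?_ (-Real.pi) Real.pi
      · exact this
      · have h : Continuous (fun p : Icc (-a) a × ℝ ↦
            fderiv ℝ w (((p.1 : ℝ) : ℂ) + p.2 * Complex.I)) := by
          refine (contDiffOn_fderiv_strip hw).continuousOn.comp_continuous (by fun_prop) ?_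
          rintro ⟨⟨t, ht⟩, y⟩
          simpa using hmem t ht
        exact continuous_const.mul (((standardSymplectic F).continuous.comp
          (h.clm_apply continuous_const)).clm_apply (h.clm_apply continuous_const))
    · intro x hx
      rw [sliceEnergy, ← intervalIntegral.integral_const_mul]
      have hx' := hmem x hx
      apply intervalIntegral.integral_mono_on (by linarith [Real.pi_pos])
      · exact (((hslice x hx' _).norm.pow 2).const_mul _).intervalIntegrable _ _
      · exact (continuous_const.mul (((standardSymplectic F).continuous.comp
          (hslice x hx' _)).clm_apply (hslice x hx' _))).intervalIntegrable _ _
      · intro y _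
        have h3 := hhol (x + y * Complex.I) (by rwa [hre])
        set p := fderiv ℝ w (x + y * Complex.I) 1
        set q := fderiv ℝ w (x + y * Complex.I) Complex.I
        have h4 : standardSymplectic F p q = ‖p‖ ^ 2 +
            standardSymplectic F p (q - Complex.I • p) := by
          rw [map_sub, standardSymplectic_apply_I_smul]; ring
        have h5 := neg_le_of_abs_le (abs_standardSymplectic_le p (q - Complex.I • p))
        have h6 := mul_le_mul_of_nonneg_left h3 (norm_nonneg p)
        nlinarith
  rw [intervalIntegral.integral_const_mul, hstokes] at hlow
  have h1 := le_of_abs_le (hact a haR)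
  have h2 := neg_le_of_abs_le (hact (-a) haR')
  have h3 := sliceEnergy_nonneg w a
  have h4 := sliceEnergy_nonneg w (-a)
  linarith

/-- By `isoperimetric_strip`, the energy `e(x)` of the cylinder over `[-x, x]` satisfies `e ≤ e'`,
so `exp (-x) * e(x)` is monotone. -/
theorem integral_sliceEnergy_decay [CompleteSpace F]
    (hw : ContDiffOn ℝ ∞ w {z : ℂ | |z.re| < R})
    (hper : ∀ z, w (z + 2 * Real.pi * Complex.I) = w z)
    (hhol : ∀ z : ℂ, |z.re| < R →
      ‖fderiv ℝ w z Complex.I - Complex.I • fderiv ℝ w z 1‖ ≤ ‖fderiv ℝ w z 1‖ / 20)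
    {a b : ℝ} (h0 : 0 ≤ b) (hba : b ≤ a) (ha : a < R) :
    ∫ x in (-b)..b, sliceEnergy w x ≤
      Real.exp (-(a - b)) * ∫ x in (-a)..a, sliceEnergy w x := by
  have hR : 0 < R := by linarith
  have h0R : |(0 : ℝ)| < R := by simpa
  have hΦ : ∀ x, |x| < R → HasDerivAt (fun x ↦ ∫ y in (-x)..x, sliceEnergy w y)
      (sliceEnergy w x + sliceEnergy w (-x)) x := by
    intro x hx
    have hx' : |-x| < R := by rwa [abs_neg]
    have hopen : IsOpen {t : ℝ | |t| < R} := isOpen_lt (by fun_prop) (by fun_prop)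
    have hd : ∀ y, |y| < R → HasDerivAt (fun y ↦ ∫ s in (0 : ℝ)..y, sliceEnergy w s)
        (sliceEnergy w y) y := fun y hy ↦
      intervalIntegral.integral_hasDerivAt_right (intervalIntegrable_sliceEnergy hw h0R hy)
        ((continuousOn_sliceEnergy hw).stronglyMeasurableAtFilter hopen _ hy)
        ((continuousOn_sliceEnergy hw).continuousAt (hopen.mem_nhds hy))
    have h1 := (hd x hx).sub ((hd (-x) hx').comp x (hasDerivAt_neg x))
    rw [show sliceEnergy w x + sliceEnergy w (-x) =
      sliceEnergy w x - sliceEnergy w (-x) * (-1) by ring]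
    apply h1.congr_of_eventuallyEq
    filter_upwards [hopen.mem_nhds hx] with y hy
    have hy' : |-y| < R := by rw [abs_neg]; exact hy
    simp only [Pi.sub_apply, Function.comp_apply]
    rw [intervalIntegral.integral_interval_sub_left (intervalIntegrable_sliceEnergy hw h0R hy)
      (intervalIntegrable_sliceEnergy hw h0R hy')]
  have hder : ∀ x, |x| < R → HasDerivAt
      (fun x ↦ Real.exp (-x) * ∫ y in (-x)..x, sliceEnergy w y)
      (Real.exp (-x) * (-1) * (∫ y in (-x)..x, sliceEnergy w y) +
        Real.exp (-x) * (sliceEnergy w x + sliceEnergy w (-x))) x := fun x hx ↦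
    (hasDerivAt_neg x).exp.mul (hΦ x hx)
  have hmem : ∀ x ∈ Icc b a, |x| < R := fun x hx ↦ by
    rw [abs_of_nonneg (h0.trans hx.1)]; exact hx.2.trans_lt ha
  have hmono : MonotoneOn (fun x ↦ Real.exp (-x) * ∫ y in (-x)..x, sliceEnergy w y)
      (Icc b a) := by
    apply monotoneOn_of_deriv_nonneg (convex_Icc b a)
    · exact fun x hx ↦ (hder x (hmem x hx)).continuousAt.continuousWithinAt
    · exact fun x hx ↦
        (hder x (hmem x (interior_subset hx))).differentiableAt.differentiableWithinAt
    · intro x hx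
      have hx' := interior_subset hx
      rw [(hder x (hmem x hx')).deriv]
      have := isoperimetric_strip hw hper hhol (h0.trans hx'.1) (hx'.2.trans_lt ha)
      have := mul_le_mul_of_nonneg_left this (Real.exp_pos (-x)).le
      linarith
  have := hmono (left_mem_Icc.2 hba) (right_mem_Icc.2 hba) hba
  simp only at this
  calc ∫ x in (-b)..b, sliceEnergy w x
      = Real.exp b * (Real.exp (-b) * ∫ x in (-b)..b, sliceEnergy w x) := by
        rw [← mul_assoc, ← Real.exp_add]; simp
    _ ≤ Real.exp b * (Real.exp (-a) * ∫ x in (-a)..a, sliceEnergy w x) := by gcongr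
    _ = _ := by rw [← mul_assoc, ← Real.exp_add]; ring_nf

theorem lintegral_reProdIm_ofReal {g : ℂ → ℝ} {a b c d : ℝ} (hab : a ≤ b) (hcd : c ≤ d)
    (hg : ContinuousOn g (Icc a b ×ℂ Icc c d)) (h0 : ∀ z, 0 ≤ g z) :
    ∫⁻ z in Icc a b ×ℂ Ioc c d, ENNReal.ofReal (g z) =
      ENNReal.ofReal (∫ x in a..b, ∫ y in c..d, g (x + y * Complex.I)) := by
  have hcont : ContinuousOn (fun p : ℝ × ℝ ↦ g (Complex.measurableEquivRealProd.symm p))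
      (Icc a b ×ˢ Icc c d) := by
    refine hg.comp (Complex.equivRealProdCLM.symm.continuous.continuousOn) ?_
    rintro ⟨x, y⟩ h
    exact h
  have hint : IntegrableOn (fun p : ℝ × ℝ ↦ g (Complex.measurableEquivRealProd.symm p))
      (Ioc a b ×ˢ Ioc c d) :=
    (hcont.integrableOn_compact (isCompact_Icc.prod isCompact_Icc)).mono_set
      (prod_mono Ioc_subset_Icc_self Ioc_subset_Icc_self)
  have h1 : ∫⁻ z in Icc a b ×ℂ Ioc c d, ENNReal.ofReal (g z) =
      ∫⁻ p in Ioc a b ×ˢ Ioc c d, ENNReal.ofReal (g (Complex.measurableEquivRealProd.symm p)) := by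
    rw [← Complex.volume_preserving_equiv_real_prod.symm.setLIntegral_comp_preimage_emb
      Complex.measurableEquivRealProd.symm.measurableEmbedding]
    have : Complex.measurableEquivRealProd.symm ⁻¹' (Icc a b ×ℂ Ioc c d) =
        Icc a b ×ˢ Ioc c d := rfl
    rw [this]
    apply setLIntegral_congr
    exact Measure.set_prod_ae_eq Ioc_ae_eq_Icc.symm (ae_eq_refl _)
  rw [h1, ← ofReal_integral_eq_lintegral_ofReal hint (ae_of_all _ fun _ ↦ h0 _),
    Measure.volume_eq_prod, setIntegral_prod _ hint, intervalIntegral.integral_of_le hab]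
  congr 1
  apply setIntegral_congr_fun measurableSet_Ioc
  intro x _
  simp only
  rw [intervalIntegral.integral_of_le hcd]
  apply setIntegral_congr_fun measurableSet_Ioc
  intro y _
  simp only
  congr 1
  exact Complex.mk_eq_add_mul_I x y

theorem lintegral_strip_eq (hw : ContDiffOn ℝ ∞ w {z : ℂ | |z.re| < R}) {a : ℝ} (h0 : 0 ≤ a)
    (ha : a < R) :
    ∫⁻ z in Icc (-a) a ×ℂ Ioc (-Real.pi) Real.pi, ‖fderiv ℝ w z 1‖ₑ ^ 2 =
      ENNReal.ofReal (∫ x in (-a)..a, sliceEnergy w x) := by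
  have := lintegral_reProdIm_ofReal (g := fun z ↦ ‖fderiv ℝ w z 1‖ ^ 2) (a := -a) (b := a)
    (c := -Real.pi) (d := Real.pi) (by linarith) (by linarith [Real.pi_pos]) ?_
    (fun z ↦ sq_nonneg _)
  · unfold sliceEnergy
    rw [← this]
    congr 1 with z
    rw [ENNReal.ofReal_pow (norm_nonneg _), ofReal_norm]
  · apply ContinuousOn.pow
    apply ContinuousOn.norm
    apply ContinuousOn.clm_apply _ continuousOn_const
    apply (contDiffOn_fderiv_strip hw).continuousOn.mono
    intro z hz
    exact (abs_le.2 hz.1).trans_lt ha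

/-- `integral_sliceEnergy_decay` in terms of the lower Lebesgue integral. -/
theorem lintegral_strip_decay [CompleteSpace F]
    (hw : ContDiffOn ℝ ∞ w {z : ℂ | |z.re| < R})
    (hper : ∀ z, w (z + 2 * Real.pi * Complex.I) = w z)
    (hhol : ∀ z : ℂ, |z.re| < R →
      ‖fderiv ℝ w z Complex.I - Complex.I • fderiv ℝ w z 1‖ ≤ ‖fderiv ℝ w z 1‖ / 20)
    {a b : ℝ} (h0 : 0 ≤ b) (hba : b ≤ a) (ha : a < R) :
    ∫⁻ z in Icc (-b) b ×ℂ Ioc (-Real.pi) Real.pi, ‖fderiv ℝ w z 1‖ₑ ^ 2 ≤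
      ENNReal.ofReal (Real.exp (-(a - b))) *
        ∫⁻ z in Icc (-a) a ×ℂ Ioc (-Real.pi) Real.pi, ‖fderiv ℝ w z 1‖ₑ ^ 2 := by
  rw [lintegral_strip_eq hw h0 (by linarith), lintegral_strip_eq hw (by linarith) ha,
    ← ENNReal.ofReal_mul (Real.exp_pos _).le]
  exact ENNReal.ofReal_le_ofReal (integral_sliceEnergy_decay hw hper hhol h0 hba ha)

end Decay

/-! ### Mean value inequality for the derivative of an almost holomorphic map -/

section MeanValue

variable {F : Type*} [NormedAddCommGroup F] [NormedSpace ℂ F] [CompleteSpace F]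

/-- The defect of complex linearity of a real-linear map at `c` is determined by its defect at `1`.
-/
theorem I_smul_map_sub_map_mul_I (L : ℂ →L[ℝ] F) (c : ℂ) :
    Complex.I • L c - L (c * Complex.I) =
      -((starRingEnd ℂ) c • (L Complex.I - Complex.I • L 1)) := by
  have h1 : L c = (c.re : ℂ) • L 1 + (c.im : ℂ) • L Complex.I := by
    conv_lhs => rw [show c = c.re • (1 : ℂ) + c.im • Complex.I by
      simp [Complex.re_add_im]]
    rw [map_add, map_smul, map_smul, Complex.coe_smul, Complex.coe_smul]
  have h2 : L (c * Complex.I) = (c.re : ℂ) • L Complex.I - (c.im : ℂ) • L 1 := by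
    conv_lhs => rw [show c * Complex.I = c.re • Complex.I - c.im • (1 : ℂ) by
      apply Complex.ext <;> simp]
    rw [map_sub, map_smul, map_smul, Complex.coe_smul, Complex.coe_smul]
  have h3 : (starRingEnd ℂ) c = (c.re : ℂ) - c.im * Complex.I := by
    apply Complex.ext <;> simp
  rw [h1, h2, h3]
  generalize L 1 = a
  generalize L Complex.I = b
  match_scalars
  · linear_combination (c.im : ℂ) * Complex.I_mul_I
  · ring

variable {f : ℂ → F} {z₀ : ℂ} {r M : ℝ}

/-- Mean value inequality on a circle of radius `exp s` about `z₀`. In the logarithmic coordinate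
`ζ` with `z = z₀ + exp ζ`, the periodic function `h ζ = (f z - f z₀) / (z - z₀)` has circle averages
whose limit at `re ζ = -∞` is the derivative at `z₀`, and whose variation is controlled by `∂h/∂ζ̄`
through Green's formula. Integration by parts along the circle replaces `f z - f z₀` by the
derivative of `f`. -/
theorem norm_fderiv_one_le_circle_average (hf : ContDiffOn ℝ 1 f (Metric.ball z₀ r))
    (hM : 0 ≤ M) (hD : ∀ z ∈ Metric.ball z₀ r,
      ‖fderiv ℝ f z Complex.I - Complex.I • fderiv ℝ f z 1‖ ≤ M * ‖z - z₀‖)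
    {s : ℝ} (hs : Real.exp s < r) :
    2 * Real.pi * ‖fderiv ℝ f z₀ 1‖ ≤
      (∫ y in (-Real.pi)..Real.pi, ‖fderiv ℝ f (z₀ + Complex.exp (s + y * Complex.I))‖) +
        2 * Real.pi * (M * Real.exp s) := by
  have hπ := Real.pi_pos
  have hr : 0 < r := (Real.exp_pos s).trans hs
  have hball : ∀ ζ : ℂ, ζ.re ≤ s → z₀ + Complex.exp ζ ∈ Metric.ball z₀ r := by
    intro ζ hζ
    rw [mem_ball_iff_norm, add_sub_cancel_left, Complex.norm_exp]
    exact (Real.exp_le_exp.2 hζ).trans_lt hs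
  have hfd : ∀ z ∈ Metric.ball z₀ r, HasFDerivAt f (fderiv ℝ f z) z := fun z hz ↦
    ((hf.contDiffAt (Metric.isOpen_ball.mem_nhds hz)).differentiableAt (by simp)).hasFDerivAt
  have hDc : ContinuousOn (fderiv ℝ f) (Metric.ball z₀ r) :=
    hf.continuousOn_fderiv_of_isOpen Metric.isOpen_ball le_rfl
  set D := fderiv ℝ f with hDdef
  set h : ℂ → F := fun ζ ↦ Complex.exp (-ζ) • (f (z₀ + Complex.exp ζ) - f z₀) with hh
  set h' : ℂ → ℂ →L[ℝ] F := fun ζ ↦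
    Complex.exp (-ζ) • ((D (z₀ + Complex.exp ζ)).comp
      ((Complex.exp ζ • (1 : ℂ →L[ℂ] ℂ)).restrictScalars ℝ)) +
    (((Complex.exp (-ζ) • (-1 : ℂ →L[ℂ] ℂ)).restrictScalars ℝ).smulRight
      (f (z₀ + Complex.exp ζ) - f z₀)) with hh'
  have hh'v : ∀ ζ v, h' ζ v = Complex.exp (-ζ) • D (z₀ + Complex.exp ζ) (Complex.exp ζ * v) -
      (v * Complex.exp (-ζ)) • (f (z₀ + Complex.exp ζ) - f z₀) := by
    intro ζ v
    simp only [hh', add_apply, ContinuousLinearMap.smulRight_apply,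
      ContinuousLinearMap.coe_restrictScalars', smul_apply, neg_apply,
      one_apply_eq_self, ContinuousLinearMap.comp_apply, smul_eq_mul, mul_neg,
      neg_smul, ← sub_eq_add_neg, mul_comm v]
  have hder : ∀ ζ : ℂ, ζ.re ≤ s → HasFDerivAt h (h' ζ) ζ := by
    intro ζ hζ
    have h1 : HasFDerivAt (fun ζ ↦ z₀ + Complex.exp ζ)
        ((Complex.exp ζ • (1 : ℂ →L[ℂ] ℂ)).restrictScalars ℝ) ζ := by
      have := ((Complex.hasDerivAt_exp ζ).const_add z₀).complexToReal_fderiv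
      convert this using 1
      ext; simp
    have h2 : HasFDerivAt (fun ζ ↦ Complex.exp (-ζ))
        ((Complex.exp (-ζ) • (-1 : ℂ →L[ℂ] ℂ)).restrictScalars ℝ) ζ := by
      have := ((hasDerivAt_neg ζ).cexp).complexToReal_fderiv
      convert this using 1
      ext; simp
    exact h2.smul (((hfd _ (hball ζ hζ)).comp ζ h1).sub_const _)
  have hcr : ∀ ζ : ℂ, ζ.re ≤ s →
      ‖Complex.I • h' ζ 1 - h' ζ Complex.I‖ ≤ M * Real.exp ζ.re := by
    intro ζ hζ
    have h1 : Complex.I • h' ζ 1 - h' ζ Complex.I = Complex.exp (-ζ) •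
        (Complex.I • D (z₀ + Complex.exp ζ) (Complex.exp ζ) -
          D (z₀ + Complex.exp ζ) (Complex.exp ζ * Complex.I)) := by
      rw [hh'v, hh'v]
      simp only [smul_sub, smul_smul, mul_one, one_mul, mul_comm Complex.I]
      abel
    rw [h1, I_smul_map_sub_map_mul_I, norm_smul, norm_neg, norm_smul, RCLike.norm_conj,
      ← mul_assoc, ← norm_mul, ← Complex.exp_add]
    have := hD _ (hball ζ hζ)
    rw [add_sub_cancel_left, Complex.norm_exp] at this
    simpa using this
  have hperiodic : ∀ ζ : ℂ, h (ζ + 2 * Real.pi * Complex.I) = h ζ := by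
    intro ζ
    simp only [hh, Complex.exp_add, Complex.exp_two_pi_mul_I, Complex.exp_neg, mul_one]
  have hcont : ∀ ζ : ℂ, ζ.re ≤ s → ContinuousAt h ζ := fun ζ hζ ↦ (hder ζ hζ).continuousAt
  have hDcs : ContinuousOn (fun ζ ↦ D (z₀ + Complex.exp ζ)) {ζ : ℂ | ζ.re ≤ s} :=
    hDc.comp (by fun_prop) (fun ζ hζ ↦ hball ζ hζ)
  have hfcs : ContinuousOn (fun ζ ↦ f (z₀ + Complex.exp ζ)) {ζ : ℂ | ζ.re ≤ s} :=
    hf.continuousOn.comp (by fun_prop) (fun ζ hζ ↦ hball ζ hζ)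
  have hh'c : ∀ v, ContinuousOn (fun ζ ↦ h' ζ v) {ζ : ℂ | ζ.re ≤ s} := by
    intro v
    simp only [hh'v]
    have h1 : ContinuousOn (fun ζ ↦ D (z₀ + Complex.exp ζ) (Complex.exp ζ * v))
        {ζ : ℂ | ζ.re ≤ s} := hDcs.clm_apply (by fun_prop)
    exact (ContinuousOn.smul (by fun_prop) h1).sub
      (ContinuousOn.smul (by fun_prop) (hfcs.sub continuousOn_const))
  set m : ℝ → F := fun t ↦ ∫ y in (-Real.pi)..Real.pi, h (t + y * Complex.I) with hm
  -- Green's formula on a rectangle, whose horizontal sides cancel by periodicity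
  have hrect : ∀ t ≤ s, ‖m s - m t‖ ≤ 2 * Real.pi * (M * Real.exp s) := by
    intro t hts
    have hsub : (uIcc t s ×ℂ uIcc (-Real.pi) Real.pi) ⊆ {ζ : ℂ | ζ.re ≤ s} := by
      intro ζ hζ
      have := hζ.1
      rw [mem_preimage, uIcc_of_le hts] at this
      exact this.2
    have key := Complex.integral_boundary_rect_of_hasFDerivAt_real_off_countable h h'
      (t + (-Real.pi : ℝ) * Complex.I) (s + (Real.pi : ℝ) * Complex.I) ∅ countable_empty
      (fun ζ hζ ↦ (hcont ζ (hsub (by simpa using hζ))).continuousWithinAt)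
      (fun ζ hζ ↦ hder ζ (by
        have := hζ.1.1
        simp only [mem_preimage] at this
        simpa [hts] using this.2.le)) (by
        apply ContinuousOn.integrableOn_compact
        · exact (isCompact_uIcc.reProdIm isCompact_uIcc)
        · refine ContinuousOn.mono ?_ (fun ζ hζ ↦ hsub (by simpa using hζ))
          exact ((hh'c 1).const_smul _).sub (hh'c _))
    have hh0 : (∫ x : ℝ in t..s, h (x + (-Real.pi : ℝ) * Complex.I)) =
        ∫ x : ℝ in t..s, h (x + (Real.pi : ℝ) * Complex.I) := by
      congr 1
      ext x
      rw [← hperiodic]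
      congr 1
      push_cast
      ring
    simp only [Complex.add_re, Complex.ofReal_re, Complex.mul_re, Complex.I_re, mul_zero,
      Complex.ofReal_im, Complex.I_im, mul_one, sub_self, add_zero, Complex.add_im,
      Complex.mul_im, zero_add, hh0] at key
    rw [← smul_sub] at key
    have h1 : ‖m s - m t‖ = ‖Complex.I • (m s - m t)‖ := by
      rw [norm_smul, Complex.norm_I, one_mul]
    rw [h1, key]
    calc _ ≤ ∫ x in t..s, 2 * Real.pi * (M * Real.exp x) := by
          apply intervalIntegral.norm_integral_le_of_norm_le hts
          · apply ae_of_all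
            intro x hx
            have h2 := intervalIntegral.norm_integral_le_of_norm_le_const
              (a := -Real.pi) (b := Real.pi) (C := M * Real.exp x)
              (f := fun y : ℝ ↦ Complex.I • h' (x + y * Complex.I) 1 -
                h' (x + y * Complex.I) Complex.I) (fun y _ ↦ by
                  have := hcr (x + y * Complex.I) (by simpa using hx.2)
                  simpa using this)
            refine h2.trans_eq ?_
            rw [abs_of_pos (by linarith)]; ring
          · exact Continuous.intervalIntegrable (by fun_prop) _ _
      _ = 2 * Real.pi * (M * (Real.exp s - Real.exp t)) := by
          rw [intervalIntegral.integral_const_mul, intervalIntegral.integral_const_mul,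
            integral_exp]
      _ ≤ _ := by
          gcongr
          linarith [Real.exp_pos t]
  -- at the centre the Cauchy–Riemann error vanishes
  have hlin : ∀ c : ℂ, D z₀ c = c • D z₀ 1 := by
    intro c
    have h0 := hD z₀ (Metric.mem_ball_self hr)
    rw [sub_self, norm_zero, mul_zero] at h0
    have h1 := sub_eq_zero.1 (norm_le_zero_iff.1 h0)
    conv_lhs => rw [show c = c.re • (1 : ℂ) + c.im • Complex.I by simp [Complex.re_add_im]]
    rw [map_add, map_smul, map_smul, h1]
    conv_rhs => rw [show c = (c.re : ℂ) + c.im * Complex.I from (Complex.re_add_im c).symm]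
    rw [add_smul, mul_smul, Complex.coe_smul, Complex.coe_smul]
  have hlim : ∀ ε > 0, ∃ t ≤ s, ‖m t - (2 * Real.pi) • D z₀ 1‖ ≤ 2 * Real.pi * ε := by
    intro ε hε
    have h1 := (hasFDerivAt_iff_isLittleO_nhds_zero.1 (hfd z₀ (Metric.mem_ball_self hr))).def hε
    obtain ⟨δ, hδ, hδε⟩ := Metric.eventually_nhds_iff.1 h1
    refine ⟨min s (Real.log (δ / 2)), min_le_left _ _, ?_⟩
    set t := min s (Real.log (δ / 2)) with ht
    have htδ : Real.exp t < δ := by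
      have : Real.exp t ≤ δ / 2 := by
        rw [← Real.exp_log (half_pos hδ)]
        exact Real.exp_le_exp.2 (min_le_right _ _)
      linarith
    have h2 : ∀ y : ℝ, ‖h (t + y * Complex.I) - D z₀ 1‖ ≤ ε := by
      intro y
      set ζ : ℂ := t + y * Complex.I with hζ
      have hre : ζ.re = t := by simp [hζ]
      have h3 := @hδε (Complex.exp ζ) (by rw [dist_zero_right, Complex.norm_exp, hre]; exact htδ)
      have h4 : h ζ - D z₀ 1 = Complex.exp (-ζ) •
          (f (z₀ + Complex.exp ζ) - f z₀ - D z₀ (Complex.exp ζ)) := by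
        rw [hlin (Complex.exp ζ), smul_sub, smul_smul, ← Complex.exp_add]
        simp [hh]
      rw [h4, norm_smul]
      calc _ ≤ ‖Complex.exp (-ζ)‖ * (ε * ‖Complex.exp ζ‖) := by gcongr
        _ = ε * (‖Complex.exp (-ζ) * Complex.exp ζ‖) := by rw [norm_mul]; ring
        _ = ε := by rw [← Complex.exp_add]; simp
    have h5 : m t - (2 * Real.pi) • D z₀ 1 =
        ∫ y in (-Real.pi)..Real.pi, (h (t + y * Complex.I) - D z₀ 1) := by
      rw [intervalIntegral.integral_sub, intervalIntegral.integral_const]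
      · congr 2; ring
      · apply Continuous.intervalIntegrable
        rw [continuous_iff_continuousAt]
        intro y
        exact ContinuousAt.comp (f := fun y : ℝ ↦ (t : ℂ) + y * Complex.I)
          (hcont _ (by simp [ht])) (by fun_prop)
      · exact intervalIntegrable_const
    rw [h5]
    refine (intervalIntegral.norm_integral_le_of_norm_le_const (fun y _ ↦ h2 y)).trans_eq ?_
    rw [abs_of_pos (by linarith)]; ring
  -- integration by parts along the circle
  have hms : ‖m s‖ ≤ ∫ y in (-Real.pi)..Real.pi, ‖D (z₀ + Complex.exp (s + y * Complex.I))‖ := by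
    have hre : ∀ y : ℝ, ((s : ℂ) + y * Complex.I).re ≤ s := by simp
    have hcd : Continuous fun y : ℝ ↦ D (z₀ + Complex.exp (s + y * Complex.I)) :=
      hDcs.comp_continuous (by fun_prop) hre
    have h1 : ∀ y : ℝ, HasDerivAt (fun y : ℝ ↦ h (s + y * Complex.I))
        (h' (s + y * Complex.I) Complex.I) y := by
      intro y
      have h2 : HasDerivAt (fun y : ℝ ↦ (s : ℂ) + y * Complex.I) Complex.I y := by
        simpa using ((Complex.ofRealCLM.hasDerivAt (x := y)).mul_const Complex.I).const_add (s : ℂ)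
      exact (hder _ (hre y)).comp_hasDerivAt y h2
    have h3 : Continuous fun y : ℝ ↦ h' (s + y * Complex.I) Complex.I :=
      (hh'c _).comp_continuous (by fun_prop) hre
    have h4 := intervalIntegral.integral_eq_sub_of_hasDerivAt (fun y _ ↦ h1 y)
      (h3.intervalIntegrable (-Real.pi) Real.pi)
    have h5 : h (s + (Real.pi : ℝ) * Complex.I) = h (s + (-Real.pi : ℝ) * Complex.I) := by
      rw [← hperiodic (s + (-Real.pi : ℝ) * Complex.I)]
      congr 1
      push_cast
      ring
    rw [h5, sub_self] at h4
    have h6 : Complex.I • m s = ∫ y in (-Real.pi)..Real.pi,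
        Complex.exp (-(s + y * Complex.I)) • D (z₀ + Complex.exp (s + y * Complex.I))
          (Complex.exp (s + y * Complex.I) * Complex.I) := by
      rw [← add_zero (Complex.I • m s), ← h4, hm, ← intervalIntegral.integral_smul,
        ← intervalIntegral.integral_add]
      · congr 1
        ext y
        rw [hh'v, mul_smul]
        simp only [hh]
        abel
      · apply Continuous.intervalIntegrable
        apply Continuous.const_smul
        exact continuous_iff_continuousAt.2 fun y ↦ (h1 y).continuousAt
      · exact h3.intervalIntegrable _ _
    have h7 : ‖m s‖ = ‖Complex.I • m s‖ := by rw [norm_smul, Complex.norm_I, one_mul]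
    rw [h7, h6]
    apply intervalIntegral.norm_integral_le_of_norm_le (by linarith)
    · apply ae_of_all
      intro y _
      rw [norm_smul]
      calc _ ≤ ‖Complex.exp (-(s + y * Complex.I))‖ *
            (‖D (z₀ + Complex.exp (s + y * Complex.I))‖ *
              ‖Complex.exp (s + y * Complex.I) * Complex.I‖) := by
            gcongr
            exact ContinuousLinearMap.le_opNorm _ _
        _ = ‖D (z₀ + Complex.exp (s + y * Complex.I))‖ *
            ‖Complex.exp (-(s + y * Complex.I)) * Complex.exp (s + y * Complex.I)‖ := by
            rw [norm_mul, norm_mul, Complex.norm_I]; ring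
        _ = _ := by rw [← Complex.exp_add]; simp
    · exact hcd.norm.intervalIntegrable _ _
  apply le_of_forall_pos_le_add
  intro ε hε
  obtain ⟨t, hts, ht⟩ := hlim (ε / (2 * Real.pi)) (by positivity)
  have h1 := hrect t hts
  have h2 : ‖(2 * Real.pi) • D z₀ 1‖ = 2 * Real.pi * ‖D z₀ 1‖ := by
    rw [norm_smul, Real.norm_of_nonneg (by positivity)]
  have h3 : 2 * Real.pi * (ε / (2 * Real.pi)) = ε := by field_simp
  have h4 : ‖(2 * Real.pi) • D z₀ 1‖ ≤
      ‖m t - (2 * Real.pi) • D z₀ 1‖ + ‖m s - m t‖ + ‖m s‖ := by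
    calc _ = ‖-(m t - (2 * Real.pi) • D z₀ 1) - (m s - m t) + m s‖ := by congr 1; abel
      _ ≤ _ := by
        refine (norm_add_le _ _).trans ?_
        gcongr
        refine (norm_sub_le _ _).trans ?_
        rw [norm_neg]
  linarith

/-- The mean value inequality on a disc, from the one on circles by integration in polar
coordinates. -/
theorem norm_fderiv_one_le_ball_average (hr : 0 < r) (hf : ContDiffOn ℝ 1 f (Metric.ball z₀ r))
    (hM : 0 ≤ M) (hD : ∀ z ∈ Metric.ball z₀ r,
      ‖fderiv ℝ f z Complex.I - Complex.I • fderiv ℝ f z 1‖ ≤ M * ‖z - z₀‖) :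
    ENNReal.ofReal (Real.pi * r ^ 2 * (‖fderiv ℝ f z₀ 1‖ - M * r)) ≤
      ∫⁻ z in Metric.ball z₀ r, ‖fderiv ℝ f z‖ₑ := by
  have hπ := Real.pi_pos
  set K := 2 * Real.pi * (‖fderiv ℝ f z₀ 1‖ - M * r) with hK
  have hmeas : Measurable fun z ↦ ‖fderiv ℝ f z‖ₑ := (measurable_fderiv ℝ f).enorm
  have hDc : ContinuousOn (fderiv ℝ f) (Metric.ball z₀ r) :=
    hf.continuousOn_fderiv_of_isOpen Metric.isOpen_ball le_rfl
  set G : ℂ → ENNReal := (Metric.ball 0 r).indicator fun z ↦ ‖fderiv ℝ f (z₀ + z)‖ₑ with hG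
  have hGm : Measurable G :=
    (hmeas.comp (measurable_const_add z₀)).indicator measurableSet_ball
  have h1 : ∫⁻ z in Metric.ball z₀ r, ‖fderiv ℝ f z‖ₑ = ∫⁻ z, G z := by
    rw [← lintegral_indicator measurableSet_ball, ← lintegral_add_left_eq_self _ z₀]
    congr 1
    ext z
    simp only [hG, indicator]
    simp
  have hcirc : ∀ ρ ∈ Ioo 0 r, ENNReal.ofReal K ≤
      ∫⁻ θ in Ioo (-Real.pi) Real.pi, G (Complex.polarCoord.symm (ρ, θ)) := by
    intro ρ hρ
    have h2 := norm_fderiv_one_le_circle_average hf hM hD (s := Real.log ρ)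
      (by rw [Real.exp_log hρ.1]; exact hρ.2)
    rw [Real.exp_log hρ.1] at h2
    have hpol : ∀ θ : ℝ, Complex.polarCoord.symm (ρ, θ) =
        Complex.exp (Real.log ρ + θ * Complex.I) := by
      intro θ
      rw [Complex.exp_add, ← Complex.ofReal_exp, Real.exp_log hρ.1, Complex.exp_mul_I]
      simp [Complex.polarCoord_symm_apply]
    have hmem : ∀ θ : ℝ, ‖Complex.exp (Real.log ρ + θ * Complex.I)‖ < r := by
      intro θ
      rw [Complex.norm_exp]
      simp [Real.exp_log hρ.1, hρ.2]
    have hGe : ∀ θ : ℝ, G (Complex.polarCoord.symm (ρ, θ)) =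
        ENNReal.ofReal ‖fderiv ℝ f (z₀ + Complex.exp (Real.log ρ + θ * Complex.I))‖ := by
      intro θ
      rw [hpol, ofReal_norm]
      simp only [hG]
      rw [indicator_of_mem]
      simpa using hmem θ
    simp only [hGe]
    have hc : Continuous fun θ : ℝ ↦
        ‖fderiv ℝ f (z₀ + Complex.exp (Real.log ρ + θ * Complex.I))‖ :=
      (hDc.comp_continuous (by fun_prop) (fun θ ↦ by
        rw [mem_ball_iff_norm, add_sub_cancel_left]; exact hmem θ)).norm
    rw [restrict_Ioo_eq_restrict_Ioc, ← ofReal_integral_eq_lintegral_ofReal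
      (hc.integrableOn_Ioc) (ae_of_all _ fun _ ↦ norm_nonneg _),
      ← intervalIntegral.integral_of_le (by linarith)]
    apply ENNReal.ofReal_le_ofReal
    have h3 : M * ρ ≤ M * r := mul_le_mul_of_nonneg_left hρ.2.le hM
    rw [hK]
    nlinarith
  have h2 : ENNReal.ofReal (Real.pi * r ^ 2 * (‖fderiv ℝ f z₀ 1‖ - M * r)) =
      ∫⁻ ρ in Ioo 0 r, ENNReal.ofReal ρ * ENNReal.ofReal K := by
    have hid : IntegrableOn (fun x : ℝ ↦ x) (Ioc 0 r) := continuous_id.integrableOn_Ioc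
    rw [lintegral_mul_const _ (by fun_prop), restrict_Ioo_eq_restrict_Ioc,
      ← ofReal_integral_eq_lintegral_ofReal (f := fun x : ℝ ↦ x) hid
      ((ae_restrict_iff' measurableSet_Ioc).2 (ae_of_all _ fun x hx ↦ hx.1.le)),
      ← intervalIntegral.integral_of_le hr.le]
    rw [integral_id, ← ENNReal.ofReal_mul (by have := sq_nonneg r; linarith)]
    congr 1
    rw [hK]
    ring
  rw [h1, h2, ← Complex.lintegral_comp_polarCoord_symm]
  have h3 : polarCoord.target = Ioi (0 : ℝ) ×ˢ Ioo (-Real.pi) Real.pi := rfl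
  have hpm : Measurable fun p : ℝ × ℝ ↦ Complex.polarCoord.symm p := by
    have : (fun p : ℝ × ℝ ↦ (Complex.polarCoord.symm p : ℂ)) =
        fun p ↦ p.1 * (Real.cos p.2 + Real.sin p.2 * Complex.I) := by
      ext p; exact Complex.polarCoord_symm_apply p
    rw [this]
    fun_prop
  have hprod : Measurable fun p : ℝ × ℝ ↦
      ENNReal.ofReal p.1 • G (Complex.polarCoord.symm p) :=
    (ENNReal.measurable_ofReal.comp measurable_fst).mul (hGm.comp hpm)
  rw [h3, Measure.volume_eq_prod, ← Measure.prod_restrict, lintegral_prod _ hprod.aemeasurable]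
  calc _ ≤ ∫⁻ ρ in Ioo 0 r, ∫⁻ θ in Ioo (-Real.pi) Real.pi,
        ENNReal.ofReal ρ * G (Complex.polarCoord.symm (ρ, θ)) := by
        apply setLIntegral_mono' measurableSet_Ioo
        intro ρ hρ
        have hm : Measurable fun θ : ℝ ↦ G (Complex.polarCoord.symm (ρ, θ)) :=
          hGm.comp (hpm.comp (by fun_prop : Measurable fun θ : ℝ ↦ (ρ, θ)))
        rw [lintegral_const_mul _ hm]
        gcongr
        exact hcirc ρ hρ
    _ ≤ _ := by
        simp only [smul_eq_mul]
        exact lintegral_mono_set fun x hx ↦ hx.1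

end MeanValue

/-! ### Differentials and lengths for maps from the plane to a Riemannian manifold -/

section Geometry

variable {E : Type*} [NormedAddCommGroup E] [NormedSpace ℝ E]
  {X : Type*} [EMetricSpace X] [ChartedSpace E X] [IsManifold 𝓘(ℝ, E) ∞ X]
  [RiemannianBundle (fun x : X ↦ TangentSpace 𝓘(ℝ, E) x)]
  [IsContMDiffRiemannianBundle 𝓘(ℝ, E) ∞ E (fun x : X ↦ TangentSpace 𝓘(ℝ, E) x)]
  [IsRiemannianManifold 𝓘(ℝ, E) X]

/-- The differential of a map `U` from the plane at `z`, as a real-linear map on `ℂ`. The tangent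
space of `ℂ` at `z` is identified with `ℂ`, so that the norm of `planarDeriv E U z v` only involves
the Riemannian metric on the target. -/
noncomputable def planarDeriv (E : Type*) [NormedAddCommGroup E] [NormedSpace ℝ E]
    {X : Type*} [TopologicalSpace X] [ChartedSpace E X] (U : ℂ → X) (z : ℂ) :
    ℂ →L[ℝ] TangentSpace 𝓘(ℝ, E) (U z) :=
  (mfderiv 𝓘(ℝ, ℂ) 𝓘(ℝ, E) U z).comp
    ((NormedSpace.fromTangentSpace (𝕜 := ℝ) z).symm : ℂ →L[ℝ] TangentSpace 𝓘(ℝ, ℂ) z)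

/-- The differential at `y` of a map `φ` from a manifold to a normed space, with values in that
space rather than in its tangent space at `φ y`. -/
noncomputable def vectorDeriv {E : Type*} [NormedAddCommGroup E] [NormedSpace ℝ E]
    {X : Type*} [TopologicalSpace X] [ChartedSpace E X] {F : Type*} [NormedAddCommGroup F]
    [NormedSpace ℝ F] (φ : X → F) (y : X) : TangentSpace 𝓘(ℝ, E) y →L[ℝ] F :=
  (NormedSpace.fromTangentSpace (𝕜 := ℝ) (φ y) : TangentSpace 𝓘(ℝ, F) (φ y) →L[ℝ] F).comp
    (mfderiv 𝓘(ℝ, E) 𝓘(ℝ, F) φ y)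

/-- `U` is a `J`-holomorphic map on the open subset `Ω` of the plane: it is smooth on `Ω` and `dU ∘
i = J ∘ dU` there. The values of `U` outside of `Ω` play no role. -/
structure IsJHolomorphicOn (J : AlmostComplexStructure E X) (Ω : Set ℂ) (U : ℂ → X) : Prop where
  isOpen : IsOpen Ω
  smooth : ContMDiffOn 𝓘(ℝ, ℂ) 𝓘(ℝ, E) ∞ U Ω
  map_I_mul (z : ℂ) (hz : z ∈ Ω) (v : ℂ) :
    planarDeriv E U z (Complex.I * v) = J.toEnd (U z) (planarDeriv E U z v)

variable {J : AlmostComplexStructure E X} {Ω : Set ℂ} {U : ℂ → X}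

theorem IsJHolomorphicOn.mono {Ω' : Set ℂ} (h : IsJHolomorphicOn J Ω U) (hΩ : IsOpen Ω')
    (hsub : Ω' ⊆ Ω) : IsJHolomorphicOn J Ω' U :=
  ⟨hΩ, h.smooth.mono hsub, fun z hz ↦ h.map_I_mul z (hsub hz)⟩

theorem IsJHolomorphicOn.contMDiffAt (h : IsJHolomorphicOn J Ω U) {z : ℂ} (hz : z ∈ Ω) :
    ContMDiffAt 𝓘(ℝ, ℂ) 𝓘(ℝ, E) ∞ U z :=
  h.smooth.contMDiffAt (h.isOpen.mem_nhds hz)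

theorem fderiv_comp_eq {F : Type*} [NormedAddCommGroup F] [NormedSpace ℝ F] {φ : X → F} {z : ℂ}
    (hφ : ContMDiffAt 𝓘(ℝ, E) 𝓘(ℝ, F) ∞ φ (U z)) (hU : ContMDiffAt 𝓘(ℝ, ℂ) 𝓘(ℝ, E) ∞ U z)
    (v : ℂ) :
    fderiv ℝ (φ ∘ U) z v = vectorDeriv φ (U z) (planarDeriv E U z v) := by
  rw [← mfderiv_eq_fderiv, mfderiv_comp z (hφ.mdifferentiableAt (by simp))
    (hU.mdifferentiableAt (by simp))]
  rfl

theorem contDiffAt_comp {F : Type*} [NormedAddCommGroup F] [NormedSpace ℝ F] {φ : X → F} {z : ℂ}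
    (hφ : ContMDiffAt 𝓘(ℝ, E) 𝓘(ℝ, F) ∞ φ (U z)) (hU : ContMDiffAt 𝓘(ℝ, ℂ) 𝓘(ℝ, E) ∞ U z) :
    ContDiffAt ℝ ∞ (φ ∘ U) z :=
  (hφ.comp z hU).contDiffAt

theorem isContinuousRiemannianBundle_tangentSpace :
    IsContinuousRiemannianBundle E (fun x : X ↦ TangentSpace 𝓘(ℝ, E) x) := by
  obtain ⟨g, hg, h⟩ := IsContMDiffRiemannianBundle.exists_contMDiff (IB := 𝓘(ℝ, E)) (n := ∞)
    (F := E) (E := fun x : X ↦ TangentSpace 𝓘(ℝ, E) x)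
  exact ⟨g, hg.continuous, h⟩

theorem continuousOn_norm_planarDeriv (hΩ : IsOpen Ω) (hU : ContMDiffOn 𝓘(ℝ, ℂ) 𝓘(ℝ, E) ∞ U Ω)
    (v : ℂ) : ContinuousOn (fun z ↦ ‖planarDeriv E U z v‖) Ω := by
  have : IsContinuousRiemannianBundle E (fun x : X ↦ TangentSpace 𝓘(ℝ, E) x) :=
    isContinuousRiemannianBundle_tangentSpace
  have h1 : ContinuousOn (fun z ↦ tangentMapWithin 𝓘(ℝ, ℂ) 𝓘(ℝ, E) U Ω
      (⟨z, (NormedSpace.fromTangentSpace (𝕜 := ℝ) z).symm v⟩ : TangentBundle 𝓘(ℝ, ℂ) ℂ)) Ω := by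
    apply (hU.continuousOn_tangentMapWithin (by simp) hΩ.uniqueMDiffOn).comp
    · apply Continuous.continuousOn
      have := (tangentBundleModelSpaceHomeomorph 𝓘(ℝ, ℂ)).symm.continuous.comp
        (by fun_prop : Continuous fun z : ℂ ↦ (⟨z, v⟩ : ModelProd ℂ ℂ))
      exact this
    · intro z hz
      exact hz
  have h2 : ContinuousOn (fun z ↦ (⟨U z, planarDeriv E U z v⟩ : TangentBundle 𝓘(ℝ, E) X)) Ω := by
    apply h1.congr
    intro z hz
    simp only [tangentMapWithin, mfderivWithin_of_isOpen hΩ hz]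
    rfl
  have h3 := ContinuousOn.inner_bundle (F := E) h2 h2
  have h4 := Real.continuous_sqrt.comp_continuousOn h3
  apply h4.congr
  intro z _
  exact norm_eq_sqrt_real_inner _

/-- The Riemannian distance between the images of two points is at most the length of the image of
the segment which joins them. -/
theorem edist_le_lintegral_segment (hΩ : IsOpen Ω) (hU : ContMDiffOn 𝓘(ℝ, ℂ) 𝓘(ℝ, E) ∞ U Ω)
    {z z' : ℂ} (hseg : segment ℝ z z' ⊆ Ω) :
    edist (U z) (U z') ≤ ∫⁻ τ in Icc (0 : ℝ) 1, ‖planarDeriv E U (z + τ • (z' - z)) (z' - z)‖ₑ := by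
  have hmem : ∀ τ ∈ Icc (0 : ℝ) 1, z + τ • (z' - z) ∈ Ω := by
    intro τ hτ
    apply hseg
    rw [segment_eq_image']
    exact ⟨τ, hτ, rfl⟩
  have hd : ∀ τ : ℝ, HasDerivAt (fun τ : ℝ ↦ z + τ • (z' - z)) (z' - z) τ := fun τ ↦ by
    simpa using ((hasDerivAt_id τ).smul_const (z' - z)).const_add z
  have hline : ContDiff ℝ ∞ fun τ : ℝ ↦ z + τ • (z' - z) := by fun_prop
  have hγ : ∀ τ ∈ Icc (0 : ℝ) 1, ContMDiffAt 𝓘(ℝ, ℝ) 𝓘(ℝ, E) ∞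
      (U ∘ fun τ : ℝ ↦ z + τ • (z' - z)) τ := fun τ hτ ↦
    (hU.contMDiffAt (hΩ.mem_nhds (hmem τ hτ))).comp τ hline.contDiffAt.contMDiffAt
  rw [IsRiemannianManifold.out (I := 𝓘(ℝ, E))]
  refine (Manifold.riemannianEDist_le_pathELength (γ := U ∘ fun τ : ℝ ↦ z + τ • (z' - z))
    (a := 0) (b := 1) ?_ (by simp) (by simp) zero_le_one).trans ?_
  · exact fun τ hτ ↦ ((hγ τ hτ).of_le (by simp)).contMDiffWithinAt
  · rw [Manifold.pathELength_eq_lintegral_mfderiv_Icc]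
    apply le_of_eq
    apply setLIntegral_congr_fun measurableSet_Icc
    intro τ hτ
    simp only
    congr 1
    rw [mfderiv_comp τ ((hU.contMDiffAt (hΩ.mem_nhds (hmem τ hτ))).mdifferentiableAt (by simp))
      (hline.contDiffAt.contMDiffAt.mdifferentiableAt (by simp)), mfderiv_eq_fderiv]
    have : fderiv ℝ (fun τ : ℝ ↦ z + τ • (z' - z)) τ 1 = z' - z := by
      rw [fderiv_apply_one_eq_deriv, (hd τ).deriv]
    exact congrArg (planarDeriv E U (z + τ • (z' - z))) this

theorem edist_le_of_norm_planarDeriv_le (hΩ : IsOpen Ω)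
    (hU : ContMDiffOn 𝓘(ℝ, ℂ) 𝓘(ℝ, E) ∞ U Ω) {z z' : ℂ} (hseg : segment ℝ z z' ⊆ Ω) {C : ℝ}
    (hC : ∀ ζ ∈ segment ℝ z z', ∀ v : ℂ, ‖planarDeriv E U ζ v‖ ≤ C * ‖v‖) :
    edist (U z) (U z') ≤ ENNReal.ofReal (C * ‖z' - z‖) := by
  refine (edist_le_lintegral_segment hΩ hU hseg).trans ?_
  calc _ ≤ ∫⁻ τ in Icc (0 : ℝ) 1, ENNReal.ofReal (C * ‖z' - z‖) := by
        apply setLIntegral_mono' measurableSet_Icc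
        intro τ hτ
        rw [← ofReal_norm]
        apply ENNReal.ofReal_le_ofReal
        apply hC
        rw [segment_eq_image']
        exact ⟨τ, hτ, rfl⟩
    _ = _ := by simp

end Geometry

/-! ### Adapted charts and the gradient bound -/

section Gradient

variable {E : Type*} [NormedAddCommGroup E] [NormedSpace ℝ E]
  {X : Type*} [EMetricSpace X] [ChartedSpace E X] [IsManifold 𝓘(ℝ, E) ∞ X]
  [RiemannianBundle (fun x : X ↦ TangentSpace 𝓘(ℝ, E) x)]
  [IsContMDiffRiemannianBundle 𝓘(ℝ, E) ∞ E (fun x : X ↦ TangentSpace 𝓘(ℝ, E) x)]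
  [IsRiemannianManifold 𝓘(ℝ, E) X]

/-- `φ` is a chart on the ball of radius `1 / K` about `x`, with values in a complex inner product
space, which distorts norms by a factor of at most `K`. It carries `J` to a family `j` of complex
structures on `F`, indexed by the points of `X`, which is Lipschitz with constant `K` in the
coordinates and within `1 / 20` of multiplication by `i`. Only the local behaviour of `φ` enters:
injectivity is not part of the definition. A single parameter `K` bounds all of the geometry, and
the condition gets weaker as `K` increases. -/
structure IsAdaptedChart (J : AlmostComplexStructure E X) (K : ℝ) (x : X) {F : Type*}
    [NormedAddCommGroup F] [InnerProductSpace ℂ F] (φ : X → F) (j : X → F →L[ℝ] F) : Prop where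
  one_le : 1 ≤ K
  smooth : ∀ y ∈ Metric.eball x (ENNReal.ofReal K⁻¹), ContMDiffAt 𝓘(ℝ, E) 𝓘(ℝ, F) ∞ φ y
  norm_vectorDeriv_le : ∀ y ∈ Metric.eball x (ENNReal.ofReal K⁻¹),
    ∀ v : TangentSpace 𝓘(ℝ, E) y, ‖vectorDeriv φ y v‖ ≤ K * ‖v‖
  norm_le : ∀ y ∈ Metric.eball x (ENNReal.ofReal K⁻¹),
    ∀ v : TangentSpace 𝓘(ℝ, E) y, ‖v‖ ≤ K * ‖vectorDeriv φ y v‖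
  map_toEnd : ∀ y ∈ Metric.eball x (ENNReal.ofReal K⁻¹),
    ∀ v : TangentSpace 𝓘(ℝ, E) y, vectorDeriv φ y (J.toEnd y v) = j y (vectorDeriv φ y v)
  sq_eq_neg : ∀ y ∈ Metric.eball x (ENNReal.ofReal K⁻¹), ∀ v, j y (j y v) = -v
  norm_sub_I_le : ∀ y ∈ Metric.eball x (ENNReal.ofReal K⁻¹),
    ∀ v, ‖j y v - Complex.I • v‖ ≤ ‖v‖ / 20
  norm_sub_le : ∀ y ∈ Metric.eball x (ENNReal.ofReal K⁻¹),
    ∀ y' ∈ Metric.eball x (ENNReal.ofReal K⁻¹), ∀ v, ‖j y v - j y' v‖ ≤ K * ‖φ y - φ y'‖ * ‖v‖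

/-- There is a chart about `x` adapted to `J` with constant `K`, with values in some `ℂᵏ` with its
Euclidean norm. -/
def HasAdaptedChart (J : AlmostComplexStructure E X) (K : ℝ) (x : X) : Prop :=
  ∃ (k : ℕ) (φ : X → EuclideanSpace ℂ (Fin k))
    (j : X → EuclideanSpace ℂ (Fin k) →L[ℝ] EuclideanSpace ℂ (Fin k)), IsAdaptedChart J K x φ j

variable {J : AlmostComplexStructure E X} {Ω : Set ℂ} {U : ℂ → X} {K : ℝ} {x : X}
  {F : Type*} [NormedAddCommGroup F] [InnerProductSpace ℂ F] {φ : X → F} {j : X → F →L[ℝ] F}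

theorem IsAdaptedChart.mono (h : IsAdaptedChart J K x φ j) {K' : ℝ} {x' : X} (hK : K ≤ K')
    (hsub : Metric.eball x' (ENNReal.ofReal K'⁻¹) ⊆ Metric.eball x (ENNReal.ofReal K⁻¹)) :
    IsAdaptedChart J K' x' φ j where
  one_le := h.one_le.trans hK
  smooth y hy := h.smooth y (hsub hy)
  norm_vectorDeriv_le y hy v := (h.norm_vectorDeriv_le y (hsub hy) v).trans (by gcongr)
  norm_le y hy v := (h.norm_le y (hsub hy) v).trans (by gcongr)
  map_toEnd y hy v := h.map_toEnd y (hsub hy) v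
  sq_eq_neg y hy v := h.sq_eq_neg y (hsub hy) v
  norm_sub_I_le y hy v := h.norm_sub_I_le y (hsub hy) v
  norm_sub_le y hy y' hy' v := (h.norm_sub_le y (hsub hy) y' (hsub hy') v).trans (by gcongr)

theorem HasAdaptedChart.one_le (h : HasAdaptedChart J K x) : 1 ≤ K := by
  obtain ⟨k, φ, j, h⟩ := h
  exact h.one_le

theorem HasAdaptedChart.mono (h : HasAdaptedChart J K x) {K' : ℝ} (hK : K ≤ K') :
    HasAdaptedChart J K' x := by
  have h1 := h.one_le
  obtain ⟨k, φ, j, h⟩ := h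
  refine ⟨k, φ, j, h.mono hK (Metric.eball_subset_eball ?_)⟩
  gcongr

/-- A chart about `x` serves for nearby points as well, at the price of doubling the constant. -/
theorem HasAdaptedChart.of_mem_eball (h : HasAdaptedChart J K x) {y : X}
    (hy : y ∈ Metric.eball x (ENNReal.ofReal (2 * K)⁻¹)) : HasAdaptedChart J (2 * K) y := by
  have h1 := h.one_le
  obtain ⟨k, φ, j, h⟩ := h
  refine ⟨k, φ, j, h.mono (by linarith) fun z hz ↦ ?_⟩
  rw [Metric.mem_eball] at *
  calc edist z x ≤ edist z y + edist y x := edist_triangle _ _ _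
    _ < ENNReal.ofReal (2 * K)⁻¹ + ENNReal.ofReal (2 * K)⁻¹ := ENNReal.add_lt_add hz hy
    _ = ENNReal.ofReal K⁻¹ := by
      rw [← ENNReal.ofReal_add (by positivity) (by positivity)]
      congr 1
      field_simp
      norm_num

theorem IsAdaptedChart.mem_self (h : IsAdaptedChart J K x φ j) :
    x ∈ Metric.eball x (ENNReal.ofReal K⁻¹) := by
  have := h.one_le
  exact Metric.mem_eball_self (by simp; linarith)

theorem IsAdaptedChart.norm_j_le (h : IsAdaptedChart J K x φ j) {y : X}
    (hy : y ∈ Metric.eball x (ENNReal.ofReal K⁻¹)) (v : F) : ‖j y v‖ ≤ 21 / 20 * ‖v‖ := by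
  have h1 := h.norm_sub_I_le y hy v
  have h2 := norm_sub_norm_le (j y v) (Complex.I • v)
  rw [norm_smul, Complex.norm_I, one_mul] at h2
  linarith

theorem HasAdaptedChart.norm_toEnd_le (h : HasAdaptedChart J K x)
    (v : TangentSpace 𝓘(ℝ, E) x) : ‖J.toEnd x v‖ ≤ 2 * K ^ 2 * ‖v‖ := by
  obtain ⟨k, φ, j, h⟩ := h
  have h0 := h.one_le
  have h1 := h.norm_le x h.mem_self (J.toEnd x v)
  rw [h.map_toEnd x h.mem_self] at h1
  have h2 := h.norm_j_le h.mem_self (vectorDeriv φ x v)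
  have h3 := h.norm_vectorDeriv_le x h.mem_self v
  calc ‖J.toEnd x v‖ ≤ K * ‖j x (vectorDeriv φ x v)‖ := h1
    _ ≤ K * (21 / 20 * (K * ‖v‖)) := by
      gcongr
      exact h2.trans (by gcongr)
    _ ≤ 2 * K ^ 2 * ‖v‖ := by
      have : 0 ≤ K ^ 2 * ‖v‖ := by positivity
      nlinarith

/-- The differential of a `J`-holomorphic map is controlled by its value on one vector. -/
theorem IsJHolomorphicOn.norm_planarDeriv_le (hU : IsJHolomorphicOn J Ω U) {z : ℂ} (hz : z ∈ Ω)
    (hK : HasAdaptedChart J K (U z)) (v : ℂ) :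
    ‖planarDeriv E U z v‖ ≤ 3 * K ^ 2 * ‖planarDeriv E U z 1‖ * ‖v‖ := by
  have h0 := hK.one_le
  have h1 : planarDeriv E U z v = v.re • planarDeriv E U z 1 +
      v.im • J.toEnd (U z) (planarDeriv E U z 1) := by
    rw [← hU.map_I_mul z hz, ← map_smul, ← map_smul, ← map_add]
    congr 1
    apply Complex.ext <;> simp
  rw [h1]
  have h2 := hK.norm_toEnd_le (planarDeriv E U z 1)
  set d := ‖planarDeriv E U z 1‖ with hd
  have hd0 : 0 ≤ d := norm_nonneg _
  calc _ ≤ |v.re| * d + |v.im| * ‖J.toEnd (U z) (planarDeriv E U z 1)‖ := by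
        refine (norm_add_le _ _).trans ?_
        rw [norm_smul, norm_smul, Real.norm_eq_abs, Real.norm_eq_abs]
    _ ≤ ‖v‖ * d + ‖v‖ * (2 * K ^ 2 * d) := by
        gcongr
        · exact Complex.abs_re_le_norm v
        · exact Complex.abs_im_le_norm v
    _ = (1 + 2 * K ^ 2) * (d * ‖v‖) := by ring
    _ ≤ (3 * K ^ 2) * (d * ‖v‖) := by
        gcongr
        nlinarith
    _ = _ := by ring

/-- If `j₀` is close to multiplication by `i`, then the projection `(1 - i j₀) / 2` onto the
`i`-linear part is close to the identity. -/
theorem norm_half_sub_I_smul {j₀ : F →L[ℝ] F} (hj : ∀ v, ‖j₀ v - Complex.I • v‖ ≤ ‖v‖ / 20)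
    (v : F) : ‖v - (2⁻¹ : ℝ) • (v - Complex.I • j₀ v)‖ ≤ ‖v‖ / 40 := by
  have : v - (2⁻¹ : ℝ) • (v - Complex.I • j₀ v) =
      (2⁻¹ : ℝ) • (Complex.I • (j₀ v - Complex.I • v)) := by
    rw [smul_sub Complex.I, smul_smul, Complex.I_mul_I]
    module
  rw [this, norm_smul, norm_smul, Complex.norm_I]
  have := hj v
  norm_num
  linarith

theorem sq_lintegral_le_measure_mul {s : Set ℂ} {f : ℂ → ENNReal}
    (hf : AEMeasurable f (volume.restrict s)) :
    (∫⁻ z in s, f z) ^ 2 ≤ volume s * ∫⁻ z in s, f z ^ 2 := by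
  have h := ENNReal.lintegral_mul_le_Lp_mul_Lq (volume.restrict s) Real.HolderConjugate.two_two
    (f := fun _ ↦ 1) (g := f) aemeasurable_const hf
  simp only [Pi.mul_apply, one_mul, ENNReal.one_rpow, lintegral_const, Measure.restrict_apply,
    MeasurableSet.univ, univ_inter] at h
  calc _ ≤ (volume s ^ (1 / 2 : ℝ) * (∫⁻ z in s, f z ^ (2 : ℝ)) ^ (1 / 2 : ℝ)) ^ 2 := by gcongr
    _ = _ := by
      rw [mul_pow, ← ENNReal.rpow_natCast, ← ENNReal.rpow_natCast, ← ENNReal.rpow_mul,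
        ← ENNReal.rpow_mul]
      simp

/-- The mean value inequality for a `J`-holomorphic map on a disc where its gradient is at most
twice the gradient at the centre, and where the product of the radius and the gradient is small. In
an adapted chart, freezing the complex structure at the centre turns the map into a solution of the
Cauchy–Riemann equation up to an error which is linear in the distance to the centre. -/
theorem IsJHolomorphicOn.sq_mul_sq_le_of_norm_le [CompleteSpace F] {z₀ : ℂ} {r : ℝ} (hr : 0 < r)
    (hU : IsJHolomorphicOn J (Metric.ball z₀ r) U)
    (hK : ∀ z ∈ Metric.ball z₀ r, HasAdaptedChart J K (U z))
    (hφ : IsAdaptedChart J K (U z₀) φ j)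
    (hd : ∀ z ∈ Metric.ball z₀ r, ‖planarDeriv E U z 1‖ ≤ 2 * ‖planarDeriv E U z₀ 1‖)
    (hrd : r * ‖planarDeriv E U z₀ 1‖ ≤ 1 / (96 * K ^ 6)) :
    ENNReal.ofReal (r ^ 2 * ‖planarDeriv E U z₀ 1‖ ^ 2) ≤
      ENNReal.ofReal (576 * K ^ 8) * ∫⁻ z in Metric.ball z₀ r, ‖planarDeriv E U z 1‖ₑ ^ 2 := by
  have hK1 := hφ.one_le
  have hK0 : 0 < K := by linarith
  set A := ‖planarDeriv E U z₀ 1‖ with hA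
  have hA0 : 0 ≤ A := norm_nonneg _
  have hz₀ : z₀ ∈ Metric.ball z₀ r := Metric.mem_ball_self hr
  have hseg : ∀ z ∈ Metric.ball z₀ r, segment ℝ z₀ z ⊆ Metric.ball z₀ r := fun z hz ↦
    (convex_ball z₀ r).segment_subset hz₀ hz
  have hdv : ∀ z ∈ Metric.ball z₀ r, ∀ v, ‖planarDeriv E U z v‖ ≤ 6 * K ^ 2 * A * ‖v‖ := by
    intro z hz v
    refine (hU.norm_planarDeriv_le hz (hK z hz) v).trans ?_
    have := hd z hz
    calc _ ≤ 3 * K ^ 2 * (2 * A) * ‖v‖ := by gcongr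
      _ = _ := by ring
  have hArK : 6 * K ^ 2 * A * r ≤ K⁻¹ / 16 := by
    calc 6 * K ^ 2 * A * r = 6 * K ^ 2 * (r * A) := by ring
      _ ≤ 6 * K ^ 2 * (1 / (96 * K ^ 6)) := by gcongr
      _ = 1 / (16 * K ^ 4) := by field_simp; norm_num
      _ ≤ 1 / (16 * K) := by
        gcongr
        exact le_self_pow₀ hK1 (by norm_num)
      _ = _ := by field_simp
  have hmem : ∀ z ∈ Metric.ball z₀ r, U z ∈ Metric.eball (U z₀) (ENNReal.ofReal K⁻¹) := by
    intro z hz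
    rw [Metric.mem_eball, edist_comm]
    refine (edist_le_of_norm_planarDeriv_le Metric.isOpen_ball hU.smooth (hseg z hz)
      (fun ζ hζ ↦ hdv ζ (hseg z hz hζ))).trans_lt ?_
    rw [ENNReal.ofReal_lt_ofReal_iff (by positivity)]
    have h1 : ‖z - z₀‖ ≤ r := (mem_ball_iff_norm.1 hz).le
    calc 6 * K ^ 2 * A * ‖z - z₀‖ ≤ 6 * K ^ 2 * A * r := by gcongr
      _ ≤ K⁻¹ / 16 := hArK
      _ < K⁻¹ := by
        have : 0 < K⁻¹ := by positivity
        linarith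
  set w : ℂ → F := φ ∘ U with hw
  have hwc : ∀ z ∈ Metric.ball z₀ r, ContDiffAt ℝ ∞ w z := fun z hz ↦
    contDiffAt_comp (hφ.smooth _ (hmem z hz)) (hU.contMDiffAt hz)
  have hwd : ∀ z ∈ Metric.ball z₀ r, ∀ v, fderiv ℝ w z v =
      vectorDeriv φ (U z) (planarDeriv E U z v) := fun z hz v ↦
    fderiv_comp_eq (hφ.smooth _ (hmem z hz)) (hU.contMDiffAt hz) v
  have hwd' : ∀ z ∈ Metric.ball z₀ r, ‖fderiv ℝ w z‖ ≤ 3 * K ^ 3 * ‖planarDeriv E U z 1‖ := by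
    intro z hz
    apply ContinuousLinearMap.opNorm_le_bound _ (by positivity)
    intro v
    rw [hwd z hz]
    calc _ ≤ K * ‖planarDeriv E U z v‖ := hφ.norm_vectorDeriv_le _ (hmem z hz) _
      _ ≤ K * (3 * K ^ 2 * ‖planarDeriv E U z 1‖ * ‖v‖) := by
        gcongr
        exact hU.norm_planarDeriv_le hz (hK z hz) v
      _ = _ := by ring
  have hwlip : ∀ z ∈ Metric.ball z₀ r, ‖w z - w z₀‖ ≤ 6 * K ^ 3 * A * ‖z - z₀‖ := by
    intro z hz
    apply (convex_ball z₀ r).norm_image_sub_le_of_norm_fderiv_le (𝕜 := ℝ)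
      (fun z hz ↦ (hwc z hz).differentiableAt (by simp)) _ hz₀ hz
    intro ζ hζ
    refine (hwd' ζ hζ).trans ?_
    have := hd ζ hζ
    calc _ ≤ 3 * K ^ 3 * (2 * A) := by gcongr
      _ = _ := by ring
  have hwy : ∀ z ∈ Metric.ball z₀ r, fderiv ℝ w z Complex.I = j (U z) (fderiv ℝ w z 1) := by
    intro z hz
    rw [hwd z hz, hwd z hz, ← hφ.map_toEnd _ (hmem z hz), ← hU.map_I_mul z hz, mul_one]
  set j₀ := j (U z₀) with hj₀
  have hj₀I := hφ.norm_sub_I_le _ (hmem z₀ hz₀)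
  have hj₀sq := hφ.sq_eq_neg _ (hmem z₀ hz₀)
  -- the projection onto the `i`-linear part intertwines `j₀` and `i`
  set P : F →L[ℝ] F := (2⁻¹ : ℝ) • (ContinuousLinearMap.id ℝ F - Complex.I • j₀) with hP
  have hPv : ∀ v, P v = (2⁻¹ : ℝ) • (v - Complex.I • j₀ v) := fun v ↦ rfl
  have hPj : ∀ v, P (j₀ v) = Complex.I • P v := by
    intro v
    have h1 : P (j₀ v) = (2⁻¹ : ℝ) • (j₀ v - Complex.I • j₀ (j₀ v)) := hPv _
    rw [h1, hPv, hj₀, hj₀sq v, smul_comm Complex.I (2⁻¹ : ℝ), smul_sub Complex.I,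
      smul_smul Complex.I, Complex.I_mul_I]
    module
  have hPn : ∀ v, ‖v - P v‖ ≤ ‖v‖ / 40 := fun v ↦ norm_half_sub_I_smul hj₀I v
  have hPle : ∀ v, ‖P v‖ ≤ 2 * ‖v‖ := by
    intro v
    have h1 := hPn v
    have h2 := norm_sub_norm_le (P v) v
    rw [norm_sub_rev] at h2
    have h3 := norm_nonneg v
    linarith
  have hPge : ∀ v, ‖v‖ ≤ 2 * ‖P v‖ := by
    intro v
    have h1 := hPn v
    have h2 := norm_sub_norm_le v (P v)
    have h3 := norm_nonneg v
    linarith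
  set f : ℂ → F := fun z ↦ P (w z) with hf
  have hfd : ∀ z ∈ Metric.ball z₀ r, fderiv ℝ f z = P.comp (fderiv ℝ w z) := fun z hz ↦
    (P.hasFDerivAt.comp z ((hwc z hz).differentiableAt (by simp)).hasFDerivAt).fderiv
  have hfc : ContDiffOn ℝ 1 f (Metric.ball z₀ r) := fun z hz ↦
    ((P.contDiff.contDiffAt.comp z (hwc z hz)).of_le (by simp)).contDiffWithinAt
  have hfD : ∀ z ∈ Metric.ball z₀ r, ‖fderiv ℝ f z Complex.I - Complex.I • fderiv ℝ f z 1‖ ≤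
      24 * K ^ 5 * A ^ 2 * ‖z - z₀‖ := by
    intro z hz
    rw [hfd z hz, ContinuousLinearMap.comp_apply, ContinuousLinearMap.comp_apply, hwy z hz,
      ← hPj, ← map_sub]
    have h1 := hφ.norm_sub_le _ (hmem z hz) _ (hmem z₀ hz₀) (fderiv ℝ w z 1)
    have h2 : ‖fderiv ℝ w z 1‖ ≤ K * (2 * A) := by
      rw [hwd z hz]
      refine (hφ.norm_vectorDeriv_le _ (hmem z hz) _).trans ?_
      gcongr
      exact hd z hz
    calc _ ≤ 2 * ‖j (U z) (fderiv ℝ w z 1) - j₀ (fderiv ℝ w z 1)‖ := hPle _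
      _ ≤ 2 * (K * ‖w z - w z₀‖ * ‖fderiv ℝ w z 1‖) := by gcongr; exact h1
      _ ≤ 2 * (K * (6 * K ^ 3 * A * ‖z - z₀‖) * (K * (2 * A))) := by
        gcongr
        exact hwlip z hz
      _ = _ := by ring
  have hmv := norm_fderiv_one_le_ball_average hr hfc (by positivity) hfD
  have hlow : r ^ 2 * A / (2 * K) ≤
      Real.pi * r ^ 2 * (‖fderiv ℝ f z₀ 1‖ - 24 * K ^ 5 * A ^ 2 * r) := by
    have h1 : A ≤ 2 * K * ‖fderiv ℝ f z₀ 1‖ := by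
      rw [hfd z₀ hz₀, ContinuousLinearMap.comp_apply]
      calc A ≤ K * ‖fderiv ℝ w z₀ 1‖ := by
            rw [hwd z₀ hz₀]; exact hφ.norm_le _ (hmem z₀ hz₀) _
        _ ≤ K * (2 * ‖P (fderiv ℝ w z₀ 1)‖) := by gcongr; exact hPge _
        _ = _ := by ring
    have h2 : 24 * K ^ 5 * A ^ 2 * r ≤ A / (4 * K) := by
      calc 24 * K ^ 5 * A ^ 2 * r = 24 * K ^ 5 * A * (r * A) := by ring
        _ ≤ 24 * K ^ 5 * A * (1 / (96 * K ^ 6)) := by gcongr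
        _ = _ := by field_simp; ring
    have h3 : A / (2 * K) ≤ ‖fderiv ℝ f z₀ 1‖ := by
      rw [div_le_iff₀ (by positivity)]; linarith
    have h4 : A / (4 * K) ≤ ‖fderiv ℝ f z₀ 1‖ - 24 * K ^ 5 * A ^ 2 * r := by
      have : A / (2 * K) = A / (4 * K) + A / (4 * K) := by field_simp; ring
      linarith
    calc r ^ 2 * A / (2 * K) = 2 * r ^ 2 * (A / (4 * K)) := by field_simp; norm_num
      _ ≤ Real.pi * r ^ 2 * (A / (4 * K)) := by
        gcongr
        exact Real.two_le_pi
      _ ≤ _ := by gcongr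
  have hdm : AEMeasurable (fun z ↦ ‖planarDeriv E U z 1‖ₑ)
      (volume.restrict (Metric.ball z₀ r)) := by
    have h1 := (continuousOn_norm_planarDeriv Metric.isOpen_ball hU.smooth 1).aemeasurable
      (μ := volume)
      measurableSet_ball
    have h2 := h1.ennreal_ofReal
    simpa only [ofReal_norm] using h2
  have hup : ∫⁻ z in Metric.ball z₀ r, ‖fderiv ℝ f z‖ₑ ≤
      ENNReal.ofReal (6 * K ^ 3) * ∫⁻ z in Metric.ball z₀ r, ‖planarDeriv E U z 1‖ₑ := by
    rw [← lintegral_const_mul'' _ hdm]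
    apply setLIntegral_mono' measurableSet_ball
    intro z hz
    rw [← ofReal_norm, ← ofReal_norm, ← ENNReal.ofReal_mul (by positivity)]
    apply ENNReal.ofReal_le_ofReal
    rw [hfd z hz]
    apply ContinuousLinearMap.opNorm_le_bound _ (by positivity)
    intro v
    calc _ ≤ 2 * ‖fderiv ℝ w z v‖ := hPle _
      _ ≤ 2 * (3 * K ^ 3 * ‖planarDeriv E U z 1‖ * ‖v‖) := by
        gcongr
        exact (ContinuousLinearMap.le_opNorm _ _).trans (by gcongr; exact hwd' z hz)
      _ = _ := by ring
  have hcs := sq_lintegral_le_measure_mul hdm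
  have h1 : ENNReal.ofReal (r ^ 2 * A / (2 * K)) ≤
      ENNReal.ofReal (6 * K ^ 3) * ∫⁻ z in Metric.ball z₀ r, ‖planarDeriv E U z 1‖ₑ :=
    (ENNReal.ofReal_le_ofReal hlow).trans (hmv.trans hup)
  have h2 : ENNReal.ofReal (r ^ 2 * A / (2 * K)) ^ 2 ≤ ENNReal.ofReal (6 * K ^ 3) ^ 2 *
      (ENNReal.ofReal (4 * r ^ 2) * ∫⁻ z in Metric.ball z₀ r, ‖planarDeriv E U z 1‖ₑ ^ 2) := by
    calc _ ≤ (ENNReal.ofReal (6 * K ^ 3) *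
          ∫⁻ z in Metric.ball z₀ r, ‖planarDeriv E U z 1‖ₑ) ^ 2 := by gcongr
      _ ≤ _ := by
        rw [mul_pow]
        gcongr
        refine hcs.trans ?_
        gcongr
        rw [Complex.volume_ball, ← ENNReal.ofReal_pow hr.le, mul_comm,
          ENNReal.ofReal_mul (by norm_num)]
        gcongr
        rw [← ENNReal.ofReal_coe_nnreal]
        exact ENNReal.ofReal_le_ofReal (by simpa using Real.pi_le_four)
  -- divide by the factor `r ^ 2`
  have h3 : ENNReal.ofReal (r ^ 2 * A ^ 2) =
      ENNReal.ofReal (4 * K ^ 2 / r ^ 2) * ENNReal.ofReal (r ^ 2 * A / (2 * K)) ^ 2 := by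
    rw [← ENNReal.ofReal_pow (by positivity), ← ENNReal.ofReal_mul (by positivity)]
    congr 1
    field_simp
    norm_num
  calc _ ≤ ENNReal.ofReal (4 * K ^ 2 / r ^ 2) * (ENNReal.ofReal (6 * K ^ 3) ^ 2 *
        (ENNReal.ofReal (4 * r ^ 2) * ∫⁻ z in Metric.ball z₀ r, ‖planarDeriv E U z 1‖ₑ ^ 2)) := by
        rw [h3]; gcongr
    _ = _ := by
        rw [← mul_assoc, ← mul_assoc, ← ENNReal.ofReal_pow (by positivity),
          ← ENNReal.ofReal_mul (by positivity), ← ENNReal.ofReal_mul (by positivity)]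
        congr 2
        field_simp
        norm_num

/-- The gradient bound: if the energy on a disc of radius `1 / 2` is small, then the gradient at the
centre is controlled by the energy. This is Heinz' argument: at a point `p` where the product of the
gradient and the distance to the boundary circle is maximal, the gradient is at most doubled on a
disc of half that distance, and the mean value inequality applies to this disc. The disc cannot be
too large for it, since the mean value inequality on a smaller disc would contradict the smallness
of the energy. -/
theorem IsJHolomorphicOn.enorm_sq_le_of_lintegral_lt {z₀ : ℂ}
    (hU : IsJHolomorphicOn J Ω U) (hsub : Metric.closedBall z₀ (1 / 2) ⊆ Ω)
    (hK : ∀ z ∈ Ω, HasAdaptedChart J K (U z))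
    (hE : ∫⁻ z in Metric.closedBall z₀ (1 / 2), ‖planarDeriv E U z 1‖ₑ ^ 2 <
      ENNReal.ofReal ((1 / (96 * K ^ 6)) ^ 2 / (576 * K ^ 8))) :
    ‖planarDeriv E U z₀ 1‖ₑ ^ 2 ≤
      ENNReal.ofReal (9216 * K ^ 8) *
        ∫⁻ z in Metric.closedBall z₀ (1 / 2), ‖planarDeriv E U z 1‖ₑ ^ 2 := by
  have hK1 : 1 ≤ K := (hK z₀ (hsub (Metric.mem_closedBall_self (by norm_num)))).one_le
  have hK0 : 0 < K := by linarith
  set d : ℂ → ℝ := fun z ↦ ‖planarDeriv E U z 1‖ with hd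
  have hd0 : ∀ z, 0 ≤ d z := fun z ↦ norm_nonneg _
  have hcont : ContinuousOn (fun z ↦ (1 / 2 - ‖z - z₀‖) * d z) (Metric.closedBall z₀ (1 / 2)) :=
    ContinuousOn.mul (by fun_prop)
      ((continuousOn_norm_planarDeriv hU.isOpen hU.smooth 1).mono hsub)
  -- the maximum point of Heinz' argument; `σ` below is half its distance to the boundary circle
  obtain ⟨p, hp, hmax⟩ := (isCompact_closedBall z₀ (1 / 2)).exists_isMaxOn
    ⟨z₀, Metric.mem_closedBall_self (by norm_num)⟩ hcont
  have hmax' : ∀ z ∈ Metric.closedBall z₀ (1 / 2),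
      (1 / 2 - ‖z - z₀‖) * d z ≤ (1 / 2 - ‖p - z₀‖) * d p := fun z hz ↦ hmax hz
  have hz₀ := hmax' z₀ (Metric.mem_closedBall_self (by norm_num))
  rw [sub_self, norm_zero, sub_zero] at hz₀
  rcases (hd0 z₀).eq_or_lt with h0 | h0
  · rw [← ofReal_norm]
    have : ‖planarDeriv E U z₀ 1‖ = 0 := h0.symm
    simp [this]
  have hpn : ‖p - z₀‖ ≤ 1 / 2 := mem_closedBall_iff_norm.1 hp
  have hpos : 0 < (1 / 2 - ‖p - z₀‖) * d p := by linarith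
  have hdp : 0 < d p := pos_of_mul_pos_right hpos (by linarith)
  have hσ : 0 < (1 / 2 - ‖p - z₀‖) / 2 := by
    have := pos_of_mul_pos_left hpos (hd0 p)
    linarith
  set σ := (1 / 2 - ‖p - z₀‖) / 2 with hσdef
  set κ := 1 / (96 * K ^ 6) with hκ
  have hκ0 : 0 < κ := by positivity
  have hball : ∀ r ≤ σ, Metric.ball p r ⊆ Metric.closedBall z₀ (1 / 2) := by
    intro r hr z hz
    rw [mem_ball_iff_norm] at hz
    rw [mem_closedBall_iff_norm]
    have := norm_sub_le_norm_sub_add_norm_sub z p z₀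
    linarith
  have hloc : ∀ r, 0 < r → r ≤ σ → r * d p ≤ κ → ENNReal.ofReal (r ^ 2 * d p ^ 2) ≤
      ENNReal.ofReal (576 * K ^ 8) *
        ∫⁻ z in Metric.closedBall z₀ (1 / 2), ‖planarDeriv E U z 1‖ₑ ^ 2 := by
    intro r hr0 hr hrκ
    have hsub' := (hball r hr).trans hsub
    obtain ⟨k, φ, j, hφ⟩ := hK p (hsub hp)
    refine ((hU.mono Metric.isOpen_ball hsub').sq_mul_sq_le_of_norm_le hr0
      (fun z hz ↦ hK z (hsub' hz)) hφ ?_ hrκ).trans ?_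
    · intro z hz
      have h1 := hmax' z (hball r hr hz)
      rw [mem_ball_iff_norm] at hz
      have h2 := norm_sub_le_norm_sub_add_norm_sub z p z₀
      have h3 : σ * d z ≤ (1 / 2 - ‖z - z₀‖) * d z := by
        apply mul_le_mul_of_nonneg_right _ (hd0 z)
        linarith
      have h4 : (1 / 2 - ‖p - z₀‖) * d p = σ * (2 * d p) := by rw [hσdef]; ring
      rw [h4] at h1
      exact le_of_mul_le_mul_left (h3.trans h1) hσ
    · gcongr
      exact hball r hr
  have hσκ : σ * d p ≤ κ := by
    by_contra! hlt
    have h1 : κ / d p ≤ σ := by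
      rw [div_le_iff₀ hdp]; exact hlt.le
    have h2 : κ / d p * d p = κ := by field_simp
    have h3 := hloc (κ / d p) (by positivity) h1 h2.le
    rw [← mul_pow, h2] at h3
    have h4 : ENNReal.ofReal (576 * K ^ 8) *
        ∫⁻ z in Metric.closedBall z₀ (1 / 2), ‖planarDeriv E U z 1‖ₑ ^ 2 <
        ENNReal.ofReal (576 * K ^ 8) * ENNReal.ofReal (κ ^ 2 / (576 * K ^ 8)) := by
      apply ENNReal.mul_lt_mul_right _ ENNReal.ofReal_ne_top hE
      simp only [ne_eq, ENNReal.ofReal_eq_zero, not_le]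
      positivity
    rw [← ENNReal.ofReal_mul (by positivity)] at h4
    have h5 : 576 * K ^ 8 * (κ ^ 2 / (576 * K ^ 8)) = κ ^ 2 := by field_simp
    rw [h5] at h4
    exact absurd h3 (not_le.2 h4)
  have h1 := hloc σ hσ le_rfl hσκ
  calc ‖planarDeriv E U z₀ 1‖ₑ ^ 2 = ENNReal.ofReal (d z₀ ^ 2) := by
        rw [ENNReal.ofReal_pow (hd0 _), hd, ofReal_norm]
    _ ≤ ENNReal.ofReal (16 * (σ ^ 2 * d p ^ 2)) := by
        apply ENNReal.ofReal_le_ofReal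
        have h2 : d z₀ ≤ 4 * (σ * d p) := by
          have h4 : (1 / 2 - ‖p - z₀‖) * d p = 2 * (σ * d p) := by rw [hσdef]; ring
          linarith
        calc d z₀ ^ 2 ≤ (4 * (σ * d p)) ^ 2 := by gcongr
          _ = _ := by ring
    _ ≤ ENNReal.ofReal 16 * (ENNReal.ofReal (576 * K ^ 8) *
        ∫⁻ z in Metric.closedBall z₀ (1 / 2), ‖planarDeriv E U z 1‖ₑ ^ 2) := by
        rw [ENNReal.ofReal_mul (by norm_num)]
        gcongr
    _ = _ := by
        rw [← mul_assoc, ← ENNReal.ofReal_mul (by norm_num)]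
        congr 2
        ring

end Gradient

/-! ### Complex structures on a vector space -/

section LinearAlgebra

theorem exists_equiv_euclideanSpace_complex {E : Type*} [NormedAddCommGroup E] [NormedSpace ℝ E]
    [FiniteDimensional ℝ E] (J₀ : E →L[ℝ] E) (hJ : ∀ v, J₀ (J₀ v) = -v) :
    ∃ (k : ℕ) (A : E ≃L[ℝ] EuclideanSpace ℂ (Fin k)), ∀ v, A (J₀ v) = Complex.I • A v := by
  have hJ' : (J₀ : E →ₗ[ℝ] E) * (J₀ : E →ₗ[ℝ] E) = -1 := by
    ext v
    exact hJ v
  let _ : Module ℂ E := Module.compHom E (Complex.liftAux (J₀ : E →ₗ[ℝ] E) hJ').toRingHom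
  have hsmul : ∀ (c : ℂ) (v : E), c • v = c.re • v + c.im • J₀ v := by
    intro c v
    change (Complex.liftAux (J₀ : E →ₗ[ℝ] E) hJ') c v = _
    simp [Algebra.algebraMap_eq_smul_one]
  have : IsScalarTower ℝ ℂ E := by
    refine ⟨fun a c v ↦ ?_⟩
    rw [hsmul, hsmul]
    simp [mul_smul]
  have : FiniteDimensional ℂ E := Module.Finite.of_restrictScalars_finite ℝ ℂ E
  let B : E ≃ₗ[ℂ] EuclideanSpace ℂ (Fin (Module.finrank ℂ E)) :=
    (Module.finBasis ℂ E).equivFun.trans (WithLp.linearEquiv 2 ℂ _).symm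
  refine ⟨Module.finrank ℂ E, (B.restrictScalars ℝ).toContinuousLinearEquiv, fun v ↦ ?_⟩
  change B (J₀ v) = Complex.I • B v
  rw [← map_smul, hsmul]
  simp

end LinearAlgebra

/-! ### Existence of adapted charts -/

section AdaptedCharts

variable {E : Type*} [NormedAddCommGroup E] [NormedSpace ℝ E]
  {X : Type*} [EMetricSpace X] [ChartedSpace E X] [IsManifold 𝓘(ℝ, E) ∞ X]
  [RiemannianBundle (fun x : X ↦ TangentSpace 𝓘(ℝ, E) x)]
  [IsContMDiffRiemannianBundle 𝓘(ℝ, E) ∞ E (fun x : X ↦ TangentSpace 𝓘(ℝ, E) x)]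
  [IsRiemannianManifold 𝓘(ℝ, E) X]

/-- The coordinate expression of `J` at `y` in the preferred chart at `x₀`. -/
noncomputable def AlmostComplexStructure.inChart (J : AlmostComplexStructure E X) (x₀ y : X) :
    E →L[ℝ] E :=
  ContinuousLinearMap.inCoordinates E (fun y : X ↦ TangentSpace 𝓘(ℝ, E) y) E
    (fun y : X ↦ TangentSpace 𝓘(ℝ, E) y) x₀ y x₀ y (J.toEnd y)

variable (J : AlmostComplexStructure E X) (x₀ : X)

theorem AlmostComplexStructure.inChart_apply {y : X}
    (hy : y ∈ (trivializationAt E (TangentSpace 𝓘(ℝ, E)) x₀).baseSet)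
    (v : TangentSpace 𝓘(ℝ, E) y) :
    J.inChart x₀ y ((trivializationAt E (TangentSpace 𝓘(ℝ, E)) x₀).continuousLinearMapAt ℝ y v) =
      (trivializationAt E (TangentSpace 𝓘(ℝ, E)) x₀).continuousLinearMapAt ℝ y (J.toEnd y v) := by
  simp only [AlmostComplexStructure.inChart, ContinuousLinearMap.inCoordinates,
    ContinuousLinearMap.comp_apply]
  rw [Trivialization.symmL_continuousLinearMapAt _ hy]

theorem AlmostComplexStructure.inChart_inChart {y : X}
    (hy : y ∈ (trivializationAt E (TangentSpace 𝓘(ℝ, E)) x₀).baseSet) (v : E) :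
    J.inChart x₀ y (J.inChart x₀ y v) = -v := by
  rw [← Trivialization.continuousLinearMapAt_symmL (R := ℝ) _ hy v, J.inChart_apply x₀ hy,
    J.inChart_apply x₀ hy, J.sq_eq_neg, map_neg]

theorem AlmostComplexStructure.contMDiffAt_inChart :
    ContMDiffAt 𝓘(ℝ, E) 𝓘(ℝ, E →L[ℝ] E) ∞ (J.inChart x₀) x₀ :=
  ((contMDiffAt_hom_bundle _).1 (J.smooth x₀)).2

theorem AlmostComplexStructure.contDiffAt_inChart_symm :
    ContDiffAt ℝ ∞ (J.inChart x₀ ∘ (extChartAt 𝓘(ℝ, E) x₀).symm)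
      (extChartAt 𝓘(ℝ, E) x₀ x₀) := by
  have h1 : ContMDiffAt 𝓘(ℝ, E) 𝓘(ℝ, E) ∞ (extChartAt 𝓘(ℝ, E) x₀).symm
      (extChartAt 𝓘(ℝ, E) x₀ x₀) :=
    (contMDiffOn_extChartAt_symm x₀).contMDiffAt (extChartAt_target_mem_nhds x₀)
  have h2 : ContMDiffAt 𝓘(ℝ, E) 𝓘(ℝ, E →L[ℝ] E) ∞ (J.inChart x₀)
      ((extChartAt 𝓘(ℝ, E) x₀).symm (extChartAt 𝓘(ℝ, E) x₀ x₀)) := by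
    rw [extChartAt_to_inv]; exact J.contMDiffAt_inChart x₀
  exact (h2.comp _ h1).contDiffAt

variable {F : Type*} [NormedAddCommGroup F] [InnerProductSpace ℂ F]

/-- The preferred chart at `x₀`, followed by a linear isomorphism to a complex vector space which
carries `J` at `x₀` to multiplication by `i`, is adapted on a small ball, by continuity. -/
theorem exists_isAdaptedChart (A : E ≃L[ℝ] F)
    (hA : ∀ v, A (J.inChart x₀ x₀ v) = Complex.I • A v) :
    ∃ (K : ℝ) (φ : X → F) (j : X → F →L[ℝ] F), IsAdaptedChart J K x₀ φ j := by
  have : IsContinuousRiemannianBundle E (fun x : X ↦ TangentSpace 𝓘(ℝ, E) x) :=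
    isContinuousRiemannianBundle_tangentSpace
  set e := trivializationAt E (TangentSpace 𝓘(ℝ, E) : X → Type _) x₀ with he
  set φ : X → F := fun y ↦ A (extChartAt 𝓘(ℝ, E) x₀ y) with hφ
  set j : X → F →L[ℝ] F := fun y ↦ (A : E →L[ℝ] F).comp ((J.inChart x₀ y).comp (A.symm : F →L[ℝ] E))
    with hj
  have hbase : e.baseSet = (chartAt E x₀).source := rfl
  have hxs : (chartAt E x₀).source ∈ nhds x₀ := chart_source_mem_nhds E x₀
  have hφs : ∀ y ∈ (chartAt E x₀).source, ContMDiffAt 𝓘(ℝ, E) 𝓘(ℝ, F) ∞ φ y := fun y hy ↦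
    A.contDiff.contMDiff.contMDiffAt.comp y (contMDiffAt_extChartAt' hy)
  have hφd : ∀ y ∈ (chartAt E x₀).source, ∀ v : TangentSpace 𝓘(ℝ, E) y,
      vectorDeriv φ y v = A (e.continuousLinearMapAt ℝ y v) := by
    intro y hy v
    have h1 : MDifferentiableAt 𝓘(ℝ, E) 𝓘(ℝ, E) (extChartAt 𝓘(ℝ, E) x₀) y :=
      mdifferentiableAt_extChartAt hy
    have h2 : MDifferentiableAt 𝓘(ℝ, E) 𝓘(ℝ, F) A (extChartAt 𝓘(ℝ, E) x₀ y) :=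
      A.differentiableAt.mdifferentiableAt
    have h0 := TangentBundle.continuousLinearMapAt_trivializationAt (𝕜 := ℝ) (I := 𝓘(ℝ, E)) hy
    have h3 : mfderiv 𝓘(ℝ, E) 𝓘(ℝ, F) φ y = _ := mfderiv_comp y h2 h1
    rw [vectorDeriv, h3, mfderiv_eq_fderiv, A.fderiv]
    exact congrArg A (DFunLike.congr_fun h0 v).symm
  obtain ⟨C₁, hC₁, h₁⟩ := eventually_norm_trivializationAt_lt E
    (fun x : X ↦ TangentSpace 𝓘(ℝ, E) x) x₀
  obtain ⟨C₂, hC₂, h₂⟩ := eventually_norm_symmL_trivializationAt_lt E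
    (fun x : X ↦ TangentSpace 𝓘(ℝ, E) x) x₀
  -- the complex structure as a function of the coordinates, which is locally Lipschitz
  set G : F → F →L[ℝ] F := fun z ↦ (A : E →L[ℝ] F).comp
    ((J.inChart x₀ ((extChartAt 𝓘(ℝ, E) x₀).symm (A.symm z))).comp (A.symm : F →L[ℝ] E)) with hG
  have hGj : ∀ y ∈ (chartAt E x₀).source, G (φ y) = j y := by
    intro y hy
    simp only [hG, hφ, hj, ContinuousLinearEquiv.symm_apply_apply]
    rw [(extChartAt 𝓘(ℝ, E) x₀).left_inv (by rwa [extChartAt_source])]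
  have hGc : ContDiffAt ℝ 1 G (φ x₀) := by
    have h1 : ContDiffAt ℝ ∞ (fun z ↦ J.inChart x₀ ((extChartAt 𝓘(ℝ, E) x₀).symm (A.symm z)))
        (φ x₀) := by
      apply ContDiffAt.comp (g := J.inChart x₀ ∘ (extChartAt 𝓘(ℝ, E) x₀).symm)
      · simp only [hφ, ContinuousLinearEquiv.symm_apply_apply]
        exact J.contDiffAt_inChart_symm x₀
      · exact A.symm.contDiff.contDiffAt
    exact (contDiffAt_const.clm_comp (h1.clm_comp contDiffAt_const)).of_le (by simp)
  obtain ⟨L, t, ht, hL⟩ := hGc.exists_lipschitzOnWith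
  have hφc : ContinuousAt φ x₀ := (hφs x₀ (mem_chart_source E x₀)).continuousAt
  have hjI : ∀ᶠ y in nhds x₀, ‖j y - Complex.I • ContinuousLinearMap.id ℝ F‖ ≤ 1 / 20 := by
    have h0 : j x₀ = Complex.I • ContinuousLinearMap.id ℝ F := by
      ext v
      simp [hj, hA]
    have h1 : ContinuousAt j x₀ :=
      continuousAt_const.clm_comp
        ((J.contMDiffAt_inChart x₀).continuousAt.clm_comp continuousAt_const)
    have h2 := h1.eventually (Metric.ball_mem_nhds (j x₀) (by norm_num : (0 : ℝ) < 1 / 20))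
    filter_upwards [h2] with y hy
    rw [← h0]
    exact (mem_ball_iff_norm.1 hy).le
  obtain ⟨ε, hε, hεs⟩ := EMetric.mem_nhds_iff.1 (Filter.inter_mem (Filter.inter_mem hxs
    (hφc.preimage_mem_nhds ht)) (Filter.inter_mem hjI (Filter.inter_mem h₁ h₂)))
  obtain ⟨δ, hδ, hδε⟩ : ∃ δ : ℝ, 0 < δ ∧ ENNReal.ofReal δ ≤ ε := by
    obtain ⟨δ, hδ, h⟩ := ENNReal.lt_iff_exists_nnreal_btwn.1 hε
    exact ⟨δ, by simpa using hδ, by simpa using h.le⟩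
  set K : ℝ := 1 + δ⁻¹ + ‖(A : E →L[ℝ] F)‖ * C₁ + C₂ * ‖(A.symm : F →L[ℝ] E)‖ + L with hKdef
  have hδ' : 0 < δ⁻¹ := inv_pos.2 hδ
  have hA0 := norm_nonneg (A : E →L[ℝ] F)
  have hA1 := norm_nonneg (A.symm : F →L[ℝ] E)
  have hL0 : (0 : ℝ) ≤ L := L.2
  have hp1 : 0 ≤ ‖(A : E →L[ℝ] F)‖ * C₁ := by positivity
  have hp2 : 0 ≤ C₂ * ‖(A.symm : F →L[ℝ] E)‖ := by positivity
  have hmem : ∀ y ∈ Metric.eball x₀ (ENNReal.ofReal K⁻¹), (y ∈ (chartAt E x₀).source ∧ φ y ∈ t) ∧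
      ‖j y - Complex.I • ContinuousLinearMap.id ℝ F‖ ≤ 1 / 20 ∧
      ‖e.continuousLinearMapAt ℝ y‖ < C₁ ∧ ‖e.symmL ℝ y‖ < C₂ := by
    intro y hy
    apply hεs
    refine Metric.eball_subset_eball ?_ hy
    refine le_trans ?_ hδε
    apply ENNReal.ofReal_le_ofReal
    rw [inv_le_comm₀ (by linarith) hδ]
    linarith
  refine ⟨K, φ, j, ?_, ?_, ?_, ?_, ?_, ?_, ?_, ?_⟩
  · linarith
  · exact fun y hy ↦ hφs y (hmem y hy).1.1
  · intro y hy v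
    have h := hmem y hy
    rw [hφd y h.1.1]
    calc _ ≤ ‖(A : E →L[ℝ] F)‖ * ‖e.continuousLinearMapAt ℝ y v‖ :=
          (A : E →L[ℝ] F).le_opNorm _
      _ ≤ ‖(A : E →L[ℝ] F)‖ * (C₁ * ‖v‖) := by
        gcongr
        exact (ContinuousLinearMap.le_opNorm _ _).trans (by gcongr; exact h.2.2.1.le)
      _ = ‖(A : E →L[ℝ] F)‖ * C₁ * ‖v‖ := by ring
      _ ≤ _ := by gcongr; linarith
  · intro y hy v
    have h := hmem y hy
    rw [hφd y h.1.1]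
    have hv : v = e.symmL ℝ y (A.symm (A (e.continuousLinearMapAt ℝ y v))) := by
      rw [ContinuousLinearEquiv.symm_apply_apply,
        Trivialization.symmL_continuousLinearMapAt _ h.1.1]
    calc ‖v‖ = ‖e.symmL ℝ y (A.symm (A (e.continuousLinearMapAt ℝ y v)))‖ := by rw [← hv]
      _ ≤ C₂ * (‖(A.symm : F →L[ℝ] E)‖ * ‖A (e.continuousLinearMapAt ℝ y v)‖) := by
        refine (ContinuousLinearMap.le_opNorm _ _).trans ?_
        gcongr
        · exact h.2.2.2.le
        · exact (A.symm : F →L[ℝ] E).le_opNorm _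
      _ = C₂ * ‖(A.symm : F →L[ℝ] E)‖ * ‖A (e.continuousLinearMapAt ℝ y v)‖ := by ring
      _ ≤ _ := by gcongr; linarith
  · intro y hy v
    have h := hmem y hy
    rw [hφd y h.1.1, hφd y h.1.1, ← J.inChart_apply x₀ h.1.1]
    simp only [hj, ContinuousLinearMap.comp_apply, ContinuousLinearEquiv.coe_coe,
      ContinuousLinearEquiv.symm_apply_apply]
    rfl
  · intro y hy v
    have h := hmem y hy
    simp only [hj, ContinuousLinearMap.comp_apply, ContinuousLinearEquiv.coe_coe,
      ContinuousLinearEquiv.symm_apply_apply]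
    rw [J.inChart_inChart x₀ h.1.1, map_neg, ContinuousLinearEquiv.apply_symm_apply]
  · intro y hy v
    have h := (hmem y hy).2.1
    have h1 := (j y - Complex.I • ContinuousLinearMap.id ℝ F).le_opNorm v
    have h2 : (j y - Complex.I • ContinuousLinearMap.id ℝ F) v = j y v - Complex.I • v := rfl
    rw [h2] at h1
    have h3 := mul_le_mul_of_nonneg_right h (norm_nonneg v)
    linarith
  · intro y hy y' hy' v
    have h := hmem y hy
    have h' := hmem y' hy'
    have h1 := hL.norm_sub_le h.1.2 h'.1.2
    rw [hGj y h.1.1, hGj y' h'.1.1] at h1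
    calc ‖j y v - j y' v‖ = ‖(j y - j y') v‖ := rfl
      _ ≤ ‖j y - j y'‖ * ‖v‖ := ContinuousLinearMap.le_opNorm _ _
      _ ≤ L * ‖φ y - φ y'‖ * ‖v‖ := by gcongr
      _ ≤ _ := by gcongr; linarith

theorem exists_hasAdaptedChart [FiniteDimensional ℝ E] : ∃ K, HasAdaptedChart J K x₀ := by
  obtain ⟨k, A, hA⟩ := exists_equiv_euclideanSpace_complex (J.inChart x₀ x₀)
    (J.inChart_inChart x₀ (FiberBundle.mem_baseSet_trivializationAt' x₀))
  obtain ⟨K, φ, j, h⟩ := exists_isAdaptedChart J x₀ A hA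
  exact ⟨K, k, φ, j, h⟩

theorem eventually_hasAdaptedChart [FiniteDimensional ℝ E] :
    ∃ K, ∀ᶠ x in nhds x₀, HasAdaptedChart J K x := by
  obtain ⟨K, hK⟩ := exists_hasAdaptedChart J x₀
  have := hK.one_le
  refine ⟨2 * K, ?_⟩
  filter_upwards [Metric.eball_mem_nhds x₀
    (by simp; linarith : 0 < ENNReal.ofReal (2 * K)⁻¹)] with y hy
  exact hK.of_mem_eball hy

theorem exists_forall_hasAdaptedChart [FiniteDimensional ℝ E] [CompactSpace X] :
    ∃ K, ∀ x, HasAdaptedChart J K x := by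
  choose K hK using fun x₀ ↦ eventually_hasAdaptedChart J x₀
  obtain ⟨s, -, hs⟩ := isCompact_univ.elim_nhds_subcover (fun x₀ ↦ {x | HasAdaptedChart J (K x₀) x})
    (fun x _ ↦ hK x)
  obtain ⟨M, hM⟩ := (s.finite_toSet.image K).bddAbove
  refine ⟨M, fun x ↦ ?_⟩
  obtain ⟨y, hy, hxy⟩ := mem_iUnion₂.1 (hs (mem_univ x))
  exact HasAdaptedChart.mono hxy (hM ⟨y, hy, rfl⟩)

end AdaptedCharts

/-! ### Gradient bound and energy decay on a strip -/

section Strip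

variable {E : Type*} [NormedAddCommGroup E] [NormedSpace ℝ E]
  {X : Type*} [EMetricSpace X] [ChartedSpace E X] [IsManifold 𝓘(ℝ, E) ∞ X]
  [RiemannianBundle (fun x : X ↦ TangentSpace 𝓘(ℝ, E) x)]
  [IsContMDiffRiemannianBundle 𝓘(ℝ, E) ∞ E (fun x : X ↦ TangentSpace 𝓘(ℝ, E) x)]
  [IsRiemannianManifold 𝓘(ℝ, E) X]
  {J : AlmostComplexStructure E X} {U : ℂ → X} {K R : ℝ}

theorem closedBall_subset_strip {z₀ : ℂ} (h : |z₀.re| + 1 / 2 < R) :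
    Metric.closedBall z₀ (1 / 2) ⊆ {z : ℂ | |z.re| < R} := by
  intro z hz
  rw [mem_closedBall_iff_norm] at hz
  have h1 := (Complex.abs_re_le_norm (z - z₀)).trans hz
  rw [Complex.sub_re] at h1
  have h2 := abs_sub_abs_le_abs_sub z.re z₀.re
  simp only [mem_ofPred_eq]
  linarith

theorem norm_planarDeriv_add_period (hU : IsJHolomorphicOn J {z : ℂ | |z.re| < R} U)
    (hper : ∀ z, U (z + 2 * Real.pi * Complex.I) = U z) {z : ℂ} (hz : |z.re| < R) (v : ℂ) :
    ‖planarDeriv E U (z + 2 * Real.pi * Complex.I) v‖ = ‖planarDeriv E U z v‖ := by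
  have hfun : (U ∘ fun ζ ↦ ζ + 2 * Real.pi * Complex.I) = U := funext hper
  have h1 : planarDeriv E (U ∘ fun ζ ↦ ζ + 2 * Real.pi * Complex.I) z v =
      planarDeriv E U (z + 2 * Real.pi * Complex.I) v := by
    have h2 : MDifferentiableAt 𝓘(ℝ, ℂ) 𝓘(ℝ, E) U (z + 2 * Real.pi * Complex.I) :=
      (hU.contMDiffAt (by simpa using hz)).mdifferentiableAt (by simp)
    have h3 : DifferentiableAt ℝ (fun ζ : ℂ ↦ ζ + 2 * Real.pi * Complex.I) z := by fun_prop
    rw [planarDeriv, mfderiv_comp z h2 h3.mdifferentiableAt, mfderiv_eq_fderiv, fderiv_add_const,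
      fderiv_fun_id]
    rfl
  have h4 : ∀ V : ℂ → X, V = U → ‖planarDeriv E V z v‖ = ‖planarDeriv E U z v‖ := by
    rintro V rfl
    rfl
  rw [← h4 _ hfun, h1]

/-- The energy `∫ ‖∂U/∂t‖ ^ 2` of a map `U` from the plane, over the part of the fundamental domain
`-π < im z ≤ π` of the translation by `2πi` where the real part lies in `s`. There is no factor of
`1 / 2`, and `∂U/∂θ` is left out: it is controlled by `∂U/∂t` if `U` is `J`-holomorphic. -/
noncomputable def stripEnergy (E : Type*) [NormedAddCommGroup E] [NormedSpace ℝ E]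
    {X : Type*} [TopologicalSpace X] [ChartedSpace E X] [IsManifold 𝓘(ℝ, E) ∞ X]
    [RiemannianBundle (fun x : X ↦ TangentSpace 𝓘(ℝ, E) x)] (U : ℂ → X) (s : Set ℝ) : ENNReal :=
  ∫⁻ z in s ×ℂ Ioc (-Real.pi) Real.pi, ‖planarDeriv E U z 1‖ₑ ^ 2

theorem stripEnergy_mono {s t : Set ℝ} (h : s ⊆ t) : stripEnergy E U s ≤ stripEnergy E U t :=
  lintegral_mono_set fun _ hz ↦ ⟨h hz.1, hz.2⟩

theorem lintegral_strip_shift {g : ℂ → ENNReal} {s t : Set ℂ} {c : ℂ} (ht : MeasurableSet t)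
    (hg : ∀ z ∈ t, g (z + c) = g z) (hst : ∀ z, z + c ∈ s ↔ z ∈ t) :
    ∫⁻ z in s, g z = ∫⁻ z in t, g z := by
  rw [← (measurePreserving_add_right (volume : Measure ℂ) c).setLIntegral_comp_preimage_emb
    (MeasurableEquiv.addRight c).measurableEmbedding]
  have : (fun z ↦ z + c) ⁻¹' s = t := by ext z; exact hst z
  rw [this]
  exact setLIntegral_congr_fun ht hg

theorem measurableSet_reProdIm {s t : Set ℝ} (hs : MeasurableSet s) (ht : MeasurableSet t) :
    MeasurableSet (s ×ℂ t) :=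
  (Complex.measurable_re hs).inter (Complex.measurable_im ht)

/-- A disc of radius `1 / 2` about a point of the fundamental domain is covered by three translates
of the fundamental domain. -/
theorem lintegral_closedBall_le_stripEnergy (hU : IsJHolomorphicOn J {z : ℂ | |z.re| < R} U)
    (hper : ∀ z, U (z + 2 * Real.pi * Complex.I) = U z) {z₀ : ℂ} (hz : |z₀.re| + 1 / 2 < R)
    (him : |z₀.im| ≤ Real.pi) :
    ∫⁻ z in Metric.closedBall z₀ (1 / 2), ‖planarDeriv E U z 1‖ₑ ^ 2 ≤
      3 * stripEnergy E U (Icc (-(|z₀.re| + 1 / 2)) (|z₀.re| + 1 / 2)) := by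
  set b := |z₀.re| + 1 / 2 with hb
  have hπ := Real.pi_gt_three
  set g : ℂ → ENNReal := fun z ↦ ‖planarDeriv E U z 1‖ₑ ^ 2 with hg
  have hgp : ∀ z : ℂ, |z.re| < R → g (z + 2 * Real.pi * Complex.I) = g z := by
    intro z hz
    simp only [hg]
    rw [← ofReal_norm, norm_planarDeriv_add_period hU hper hz, ofReal_norm]
  have hcover : Metric.closedBall z₀ (1 / 2) ⊆
      (Icc (-b) b ×ℂ Ioc (-Real.pi) Real.pi) ∪ ((Icc (-b) b ×ℂ Ioc Real.pi (3 * Real.pi)) ∪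
        (Icc (-b) b ×ℂ Ioc (-(3 * Real.pi)) (-Real.pi))) := by
    intro z hz
    rw [mem_closedBall_iff_norm] at hz
    have h1 := (Complex.abs_re_le_norm (z - z₀)).trans hz
    have h2 := (Complex.abs_im_le_norm (z - z₀)).trans hz
    rw [Complex.sub_re] at h1
    rw [Complex.sub_im] at h2
    have h3 := abs_sub_abs_le_abs_sub z.re z₀.re
    have h4 : z.re ∈ Icc (-b) b := abs_le.1 (by linarith)
    have h5 := abs_le.1 him
    have h6 := abs_le.1 h2
    rcases lt_or_ge Real.pi z.im with h7 | h7
    · exact Or.inr (Or.inl ⟨h4, h7, by linarith⟩)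
    · rcases lt_or_ge (-Real.pi) z.im with h8 | h8
      · exact Or.inl ⟨h4, h8, h7⟩
      · exact Or.inr (Or.inr ⟨h4, by change -(3 * Real.pi) < z.im; linarith, h8⟩)
  have hmem : ∀ z : ℂ, z.re ∈ Icc (-b) b → |z.re| < R := fun z h ↦ (abs_le.2 h).trans_lt hz
  have him2 : ∀ z : ℂ, (z + 2 * Real.pi * Complex.I).im = z.im + 2 * Real.pi := by simp
  have hre2 : ∀ z : ℂ, (z + 2 * Real.pi * Complex.I).re = z.re := by simp
  have hup : ∫⁻ z in Icc (-b) b ×ℂ Ioc Real.pi (3 * Real.pi), g z =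
      ∫⁻ z in Icc (-b) b ×ℂ Ioc (-Real.pi) Real.pi, g z := by
    apply lintegral_strip_shift (c := 2 * Real.pi * Complex.I)
      (measurableSet_reProdIm measurableSet_Icc measurableSet_Ioc)
    · exact fun z hz ↦ hgp z (hmem z hz.1)
    · intro z
      simp only [Complex.mem_reProdIm, him2, hre2, mem_Ioc]
      refine and_congr_right fun _ ↦ and_congr ?_ ?_ <;> constructor <;> intro h <;> linarith
  have hdown : ∫⁻ z in Icc (-b) b ×ℂ Ioc (-(3 * Real.pi)) (-Real.pi), g z =
      ∫⁻ z in Icc (-b) b ×ℂ Ioc (-Real.pi) Real.pi, g z := by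
    symm
    apply lintegral_strip_shift (c := 2 * Real.pi * Complex.I)
      (measurableSet_reProdIm measurableSet_Icc measurableSet_Ioc)
    · exact fun z hz ↦ hgp z (hmem z hz.1)
    · intro z
      simp only [Complex.mem_reProdIm, him2, hre2, mem_Ioc]
      refine and_congr_right fun _ ↦ and_congr ?_ ?_ <;> constructor <;> intro h <;> linarith
  calc _ ≤ _ := lintegral_mono_set hcover
    _ ≤ (∫⁻ z in Icc (-b) b ×ℂ Ioc (-Real.pi) Real.pi, g z) +
        ((∫⁻ z in Icc (-b) b ×ℂ Ioc Real.pi (3 * Real.pi), g z) +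
        ∫⁻ z in Icc (-b) b ×ℂ Ioc (-(3 * Real.pi)) (-Real.pi), g z) :=
      (lintegral_union_le _ _ _).trans (by gcongr; exact lintegral_union_le _ _ _)
    _ = _ := by rw [hup, hdown, stripEnergy]; ring

theorem norm_planarDeriv_le_of_stripEnergy (hU : IsJHolomorphicOn J {z : ℂ | |z.re| < R} U)
    (hper : ∀ z, U (z + 2 * Real.pi * Complex.I) = U z)
    (hK : ∀ z : ℂ, |z.re| < R → HasAdaptedChart J K (U z)) {z₀ : ℂ} (hz : |z₀.re| + 1 / 2 < R)
    (him : |z₀.im| ≤ Real.pi) {ε : ℝ}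
    (hε : stripEnergy E U (Icc (-(|z₀.re| + 1 / 2)) (|z₀.re| + 1 / 2)) ≤ ENNReal.ofReal (ε ^ 2))
    (hε0 : 0 ≤ ε) (hsmall : 3 * ε ^ 2 < (1 / (96 * K ^ 6)) ^ 2 / (576 * K ^ 8)) (v : ℂ) :
    ‖planarDeriv E U z₀ v‖ ≤ 504 * K ^ 6 * ε * ‖v‖ := by
  have hz₀ : |z₀.re| < R := by linarith
  have hK1 := (hK z₀ hz₀).one_le
  have h1 := lintegral_closedBall_le_stripEnergy hU hper hz him
  have h2 : ∫⁻ z in Metric.closedBall z₀ (1 / 2), ‖planarDeriv E U z 1‖ₑ ^ 2 ≤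
      ENNReal.ofReal (3 * ε ^ 2) := by
    rw [ENNReal.ofReal_mul (by norm_num)]
    refine h1.trans ?_
    have : ENNReal.ofReal 3 = 3 := by simp
    rw [this]
    gcongr
  have h3 := hU.enorm_sq_le_of_lintegral_lt (closedBall_subset_strip hz) hK
    (h2.trans_lt ((ENNReal.ofReal_lt_ofReal_iff (by positivity)).2 hsmall))
  have h4 : ‖planarDeriv E U z₀ 1‖ ^ 2 ≤ (168 * K ^ 4 * ε) ^ 2 := by
    have h5 : ENNReal.ofReal (‖planarDeriv E U z₀ 1‖ ^ 2) ≤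
        ENNReal.ofReal (9216 * K ^ 8 * (3 * ε ^ 2)) := by
      rw [ENNReal.ofReal_pow (norm_nonneg _), ofReal_norm, ENNReal.ofReal_mul (by positivity)]
      exact h3.trans (by gcongr)
    rw [ENNReal.ofReal_le_ofReal_iff (by positivity)] at h5
    refine h5.trans ?_
    have : 0 ≤ K ^ 8 * ε ^ 2 := by positivity
    nlinarith
  have h5 : ‖planarDeriv E U z₀ 1‖ ≤ 168 * K ^ 4 * ε :=
    le_of_sq_le_sq h4 (by positivity)
  calc _ ≤ 3 * K ^ 2 * ‖planarDeriv E U z₀ 1‖ * ‖v‖ := hU.norm_planarDeriv_le hz₀ (hK z₀ hz₀) v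
    _ ≤ 3 * K ^ 2 * (168 * K ^ 4 * ε) * ‖v‖ := by gcongr
    _ = _ := by ring

/-- `lintegral_strip_decay`, in an adapted chart whose domain contains the image of the strip. -/
theorem stripEnergy_decay (hU : IsJHolomorphicOn J {z : ℂ | |z.re| < R} U)
    (hper : ∀ z, U (z + 2 * Real.pi * Complex.I) = U z) {x : X} (hK : HasAdaptedChart J K x)
    (him : ∀ z : ℂ, |z.re| < R → U z ∈ Metric.eball x (ENNReal.ofReal K⁻¹)) {b : ℝ} (hb : 0 ≤ b)
    (hbR : b < R) :
    stripEnergy E U (Icc (-b) b) ≤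
      ENNReal.ofReal (3 * K ^ 4 * Real.exp (-(R - b))) * stripEnergy E U (Ioo (-R) R) := by
  obtain ⟨k, φ, j, hφ⟩ := hK
  have hK1 := hφ.one_le
  set w := φ ∘ U with hw
  have hwc : ∀ z : ℂ, |z.re| < R → ContDiffAt ℝ ∞ w z := fun z hz ↦
    contDiffAt_comp (hφ.smooth _ (him z hz)) (hU.contMDiffAt hz)
  have hwd : ∀ z : ℂ, |z.re| < R → ∀ v, fderiv ℝ w z v =
      vectorDeriv φ (U z) (planarDeriv E U z v) := fun z hz v ↦
    fderiv_comp_eq (hφ.smooth _ (him z hz)) (hU.contMDiffAt hz) v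
  -- the decay estimate needs a closed strip inside the domain, at the cost of `exp (1 / 2)`
  set a := max b (R - 1 / 2) with ha
  have haR : a < R := max_lt hbR (by linarith)
  have hba : b ≤ a := le_max_left _ _
  have hle : ∀ c < R, ∀ z ∈ Icc (-c) c ×ℂ Ioc (-Real.pi) Real.pi, |z.re| < R := fun c hc z hz ↦
    (abs_le.2 hz.1).trans_lt hc
  have hmeas : ∀ c, MeasurableSet (Icc (-c) c ×ℂ Ioc (-Real.pi) Real.pi) := fun c ↦
    measurableSet_reProdIm measurableSet_Icc measurableSet_Ioc
  have hdecay := lintegral_strip_decay (w := w)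
    (fun z hz ↦ (hwc z hz).contDiffWithinAt) (fun z ↦ by simp only [hw, Function.comp_apply, hper])
    (fun z hz ↦ by
      rw [hwd z hz, hwd z hz, ← mul_one Complex.I, hU.map_I_mul z hz, hφ.map_toEnd _ (him z hz),
        mul_one]
      exact hφ.norm_sub_I_le _ (him z hz) _) hb hba haR
  have h1 : stripEnergy E U (Icc (-b) b) ≤ ENNReal.ofReal (K ^ 2) *
      ∫⁻ z in Icc (-b) b ×ℂ Ioc (-Real.pi) Real.pi, ‖fderiv ℝ w z 1‖ₑ ^ 2 := by
    rw [← lintegral_const_mul' _ _ ENNReal.ofReal_ne_top]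
    apply setLIntegral_mono' (hmeas b)
    intro z hz
    have hz' := hle b hbR z hz
    rw [← ofReal_norm, ← ofReal_norm, ← ENNReal.ofReal_pow (norm_nonneg _),
      ← ENNReal.ofReal_pow (norm_nonneg _), ← ENNReal.ofReal_mul (by positivity), ← mul_pow]
    apply ENNReal.ofReal_le_ofReal
    gcongr
    rw [hwd z hz']
    exact hφ.norm_le _ (him z hz') _
  have h2 : ∫⁻ z in Icc (-a) a ×ℂ Ioc (-Real.pi) Real.pi, ‖fderiv ℝ w z 1‖ₑ ^ 2 ≤
      ENNReal.ofReal (K ^ 2) * stripEnergy E U (Ioo (-R) R) := by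
    calc _ ≤ ENNReal.ofReal (K ^ 2) * stripEnergy E U (Icc (-a) a) := by
          rw [stripEnergy, ← lintegral_const_mul' _ _ ENNReal.ofReal_ne_top]
          apply setLIntegral_mono' (hmeas a)
          intro z hz
          have hz' := hle a haR z hz
          rw [← ofReal_norm, ← ofReal_norm, ← ENNReal.ofReal_pow (norm_nonneg _),
            ← ENNReal.ofReal_pow (norm_nonneg _), ← ENNReal.ofReal_mul (by positivity), ← mul_pow]
          apply ENNReal.ofReal_le_ofReal
          gcongr
          rw [hwd z hz']
          exact hφ.norm_vectorDeriv_le _ (him z hz') _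
      _ ≤ _ := by
          gcongr
          exact stripEnergy_mono (Icc_subset_Ioo (by linarith) haR)
  have h3 : Real.exp (-(a - b)) ≤ 3 * Real.exp (-(R - b)) := by
    have h4 : -(a - b) ≤ 1 + -(R - b) := by
      have := le_max_right b (R - 1 / 2)
      rw [← ha] at this
      linarith
    calc Real.exp (-(a - b)) ≤ Real.exp (1 + -(R - b)) := Real.exp_le_exp.2 h4
      _ = Real.exp 1 * Real.exp (-(R - b)) := Real.exp_add _ _
      _ ≤ _ := by
        gcongr
        exact Real.exp_one_lt_three.le
  calc _ ≤ ENNReal.ofReal (K ^ 2) * (ENNReal.ofReal (3 * Real.exp (-(R - b))) *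
        (ENNReal.ofReal (K ^ 2) * stripEnergy E U (Ioo (-R) R))) := by
        refine h1.trans ?_
        gcongr
        refine hdecay.trans ?_
        gcongr
    _ = _ := by
        rw [← mul_assoc, ← mul_assoc, ← ENNReal.ofReal_mul (by positivity),
          ← ENNReal.ofReal_mul (by positivity)]
        congr 2
        ring

end Strip

/-! ### Distance estimates on a strip -/

section Diameter

variable {E : Type*} [NormedAddCommGroup E] [NormedSpace ℝ E]
  {X : Type*} [EMetricSpace X] [ChartedSpace E X] [IsManifold 𝓘(ℝ, E) ∞ X]
  [RiemannianBundle (fun x : X ↦ TangentSpace 𝓘(ℝ, E) x)]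
  [IsContMDiffRiemannianBundle 𝓘(ℝ, E) ∞ E (fun x : X ↦ TangentSpace 𝓘(ℝ, E) x)]
  [IsRiemannianManifold 𝓘(ℝ, E) X]
  {J : AlmostComplexStructure E X} {U : ℂ → X} {K R σ : ℝ}

/-- The smallness condition `32000 * K ^ 12 * σ ≤ 1` on the square root `σ` of the energy implies
the condition of `norm_planarDeriv_le_of_stripEnergy` with room to spare. -/
theorem sq_lt_of_mul_le_one (hK : 1 ≤ K) (hσ0 : 0 ≤ σ) (hσ : 32000 * K ^ 12 * σ ≤ 1) :
    48 * K ^ 4 * σ ^ 2 < (1 / (96 * K ^ 6)) ^ 2 / (576 * K ^ 8) := by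
  rw [div_pow, div_div, lt_div_iff₀ (by positivity)]
  have h : (32000 * K ^ 12 * σ) ^ 2 ≤ 1 := pow_le_one₀ (by positivity) hσ
  have h2 : 0 ≤ K ^ 24 * σ ^ 2 := by positivity
  nlinarith

theorem exists_im_mem_Ioc (hper : ∀ z, U (z + 2 * Real.pi * Complex.I) = U z) (z : ℂ) :
    ∃ w : ℂ, w.re = z.re ∧ w.im ∈ Ioc (-Real.pi) Real.pi ∧ U w = U z := by
  have hp : Function.Periodic U (2 * Real.pi * Complex.I) := hper
  set n := toIocDiv Real.two_pi_pos (-Real.pi) z.im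
  refine ⟨z - n • (2 * Real.pi * Complex.I), by simp, ?_, hp.sub_zsmul_eq n⟩
  have h := sub_toIocDiv_zsmul_mem_Ioc Real.two_pi_pos (-Real.pi) z.im
  have h1 : (z - n • (2 * Real.pi * Complex.I)).im = z.im - n • (2 * Real.pi) := by simp
  rw [h1]
  convert h using 1
  congr 1
  ring

theorem edist_le_of_stripEnergy (hU : IsJHolomorphicOn J {z : ℂ | |z.re| < R} U)
    (hper : ∀ z, U (z + 2 * Real.pi * Complex.I) = U z)
    (hK : ∀ z : ℂ, |z.re| < R → HasAdaptedChart J K (U z))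
    (hE : stripEnergy E U (Ioo (-R) R) ≤ ENNReal.ofReal (σ ^ 2)) (hσ0 : 0 ≤ σ)
    (hσ : 32000 * K ^ 12 * σ ≤ 1) {z z' : ℂ} (hz : |z.re| + 1 / 2 < R) (hz' : |z'.re| + 1 / 2 < R)
    (him : |z.im| ≤ Real.pi) (him' : |z'.im| ≤ Real.pi) :
    edist (U z) (U z') ≤ ENNReal.ofReal (504 * K ^ 6 * σ * ‖z' - z‖) := by
  have hK1 := (hK z (by linarith)).one_le
  have hs := sq_lt_of_mul_le_one hK1 hσ0 hσ
  have hseg : ∀ ζ ∈ segment ℝ z z', |ζ.re| + 1 / 2 < R ∧ |ζ.im| ≤ Real.pi := by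
    have hc : Convex ℝ (Ioo (-(R - 1 / 2)) (R - 1 / 2) ×ℂ Icc (-Real.pi) Real.pi) :=
      ((convex_Ioo _ _).linear_preimage Complex.reLm).inter
        ((convex_Icc _ _).linear_preimage Complex.imLm)
    intro ζ hζ
    have h : ∀ w : ℂ, |w.re| + 1 / 2 < R → |w.im| ≤ Real.pi →
        w ∈ Ioo (-(R - 1 / 2)) (R - 1 / 2) ×ℂ Icc (-Real.pi) Real.pi := fun w h1 h2 ↦
      ⟨abs_lt.1 (by linarith), abs_le.1 h2⟩
    have h3 := hc.segment_subset (h z hz him) (h z' hz' him') hζ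
    have h4 : |ζ.re| < R - 1 / 2 := abs_lt.2 h3.1
    exact ⟨by linarith, abs_le.2 h3.2⟩
  apply edist_le_of_norm_planarDeriv_le hU.isOpen hU.smooth
  · intro ζ hζ
    have := (hseg ζ hζ).1
    simp only [mem_ofPred_eq]
    linarith
  · intro ζ hζ v
    obtain ⟨h1, h2⟩ := hseg ζ hζ
    refine norm_planarDeriv_le_of_stripEnergy hU hper hK h1 h2 ?_ hσ0 (lt_of_le_of_lt ?_ hs) v
    · exact (stripEnergy_mono (Icc_subset_Ioo (by linarith) h1)).trans hE
    · have := one_le_pow₀ hK1 (n := 4)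
      have h3 : 0 ≤ σ ^ 2 := by positivity
      nlinarith

/-- The gradient bound combined with the energy decay. -/
theorem norm_planarDeriv_le_exp (hU : IsJHolomorphicOn J {z : ℂ | |z.re| < R} U)
    (hper : ∀ z, U (z + 2 * Real.pi * Complex.I) = U z)
    (hK : ∀ z : ℂ, |z.re| < R → HasAdaptedChart J K (U z))
    (hball : ∀ z : ℂ, |z.re| < R → U z ∈ Metric.eball (U 0) (ENNReal.ofReal K⁻¹))
    (hE : stripEnergy E U (Ioo (-R) R) ≤ ENNReal.ofReal (σ ^ 2)) (hσ0 : 0 ≤ σ)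
    (hσ : 32000 * K ^ 12 * σ ≤ 1) {z : ℂ} (hz : |z.re| + 1 ≤ R) (him : |z.im| ≤ Real.pi) (v : ℂ) :
    ‖planarDeriv E U z v‖ ≤ 2016 * K ^ 8 * σ * Real.exp (-(R - |z.re|) / 2) * ‖v‖ := by
  have habs := abs_nonneg z.re
  have hK0 : HasAdaptedChart J K (U 0) := hK 0 (by simp; linarith)
  have hK1 := hK0.one_le
  have hs := sq_lt_of_mul_le_one hK1 hσ0 hσ
  have hd := stripEnergy_decay hU hper hK0 hball (b := |z.re| + 1 / 2) (by positivity)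
    (by linarith)
  have hexp : Real.exp (-(R - |z.re|) / 2) ^ 2 = Real.exp (-(R - |z.re|)) := by
    rw [← Real.exp_nat_mul]
    congr 1
    push_cast
    ring
  set ε := 4 * K ^ 2 * Real.exp (-(R - |z.re|) / 2) * σ with hε
  have hε2 : ε ^ 2 = 16 * K ^ 4 * Real.exp (-(R - |z.re|)) * σ ^ 2 := by
    rw [← hexp, hε]; ring
  have h1 := norm_planarDeriv_le_of_stripEnergy hU hper hK (z₀ := z) (by linarith) him (ε := ε)
    ?_ (by positivity) ?_ v
  · refine h1.trans (le_of_eq ?_)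
    rw [hε]; ring
  · refine hd.trans ?_
    calc _ ≤ ENNReal.ofReal (3 * K ^ 4 * Real.exp (-(R - (|z.re| + 1 / 2)))) *
          ENNReal.ofReal (σ ^ 2) := by gcongr
      _ ≤ _ := by
        rw [← ENNReal.ofReal_mul (by positivity), hε2]
        apply ENNReal.ofReal_le_ofReal
        apply mul_le_mul_of_nonneg_right _ (sq_nonneg σ)
        have h2 : Real.exp (-(R - (|z.re| + 1 / 2))) ≤ 3 * Real.exp (-(R - |z.re|)) := by
          calc _ ≤ Real.exp (1 + -(R - |z.re|)) := Real.exp_le_exp.2 (by linarith)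
            _ = Real.exp 1 * Real.exp (-(R - |z.re|)) := Real.exp_add _ _
            _ ≤ _ := by
              gcongr
              exact Real.exp_one_lt_three.le
        have h3 : 0 ≤ K ^ 4 * Real.exp (-(R - |z.re|)) := by positivity
        calc _ ≤ 3 * K ^ 4 * (3 * Real.exp (-(R - |z.re|))) := by gcongr
          _ ≤ _ := by linarith
  · refine lt_of_le_of_lt ?_ hs
    rw [hε2]
    have h2 : Real.exp (-(R - |z.re|)) ≤ 1 := Real.exp_le_one_iff.2 (by linarith)
    calc _ = 48 * K ^ 4 * σ ^ 2 * Real.exp (-(R - |z.re|)) := by ring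
      _ ≤ 48 * K ^ 4 * σ ^ 2 * 1 := by gcongr
      _ = _ := by ring

theorem lintegral_exp_mul_le {a : ℝ} (ha : 0 ≤ a) {D c : ℝ} (hD : 0 ≤ D) :
    ∫⁻ τ in Icc (0 : ℝ) 1, ENNReal.ofReal (D * Real.exp (c + τ * a / 2) * a) ≤
      ENNReal.ofReal (2 * D * Real.exp (c + a / 2)) := by
  have hcont : Continuous fun τ : ℝ ↦ D * Real.exp (c + τ * a / 2) * a := by fun_prop
  rw [← ofReal_integral_eq_lintegral_ofReal (hcont.integrableOn_Icc)
    (Filter.Eventually.of_forall fun τ ↦ by positivity), integral_Icc_eq_integral_Ioc,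
    ← intervalIntegral.integral_of_le zero_le_one]
  apply ENNReal.ofReal_le_ofReal
  have hderiv : ∀ τ ∈ uIcc (0 : ℝ) 1, HasDerivAt (fun τ : ℝ ↦ 2 * D * Real.exp (c + τ * a / 2))
      (D * Real.exp (c + τ * a / 2) * a) τ := by
    intro τ _
    have h1 : HasDerivAt (fun τ : ℝ ↦ c + τ * a / 2) (a / 2) τ := by
      simpa using (((hasDerivAt_id τ).mul_const a).div_const 2).const_add c
    exact (h1.exp.const_mul (2 * D)).congr_deriv (by ring)
  rw [intervalIntegral.integral_eq_sub_of_hasDerivAt hderiv (hcont.intervalIntegrable _ _)]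
  have : 0 ≤ 2 * D * Real.exp (c + 0 * a / 2) := by positivity
  rw [one_mul]
  linarith

/-- Exponential decay of the distance to the centre of the strip, by integrating the gradient bound
along the path from `0` to `re z` and from there to `z`. -/
theorem edist_zero_le_exp (hU : IsJHolomorphicOn J {z : ℂ | |z.re| < R} U)
    (hper : ∀ z, U (z + 2 * Real.pi * Complex.I) = U z)
    (hK : ∀ z : ℂ, |z.re| < R → HasAdaptedChart J K (U z))
    (hball : ∀ z : ℂ, |z.re| < R → U z ∈ Metric.eball (U 0) (ENNReal.ofReal K⁻¹))
    (hE : stripEnergy E U (Ioo (-R) R) ≤ ENNReal.ofReal (σ ^ 2)) (hσ0 : 0 ≤ σ)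
    (hσ : 32000 * K ^ 12 * σ ≤ 1) {z : ℂ} (hz : |z.re| + 1 ≤ R) :
    edist (U z) (U 0) ≤ ENNReal.ofReal (12096 * K ^ 8 * σ * Real.exp (-(R - |z.re|) / 2)) := by
  wlog him : z.im ∈ Ioc (-Real.pi) Real.pi generalizing z
  · obtain ⟨w, hw, hwim, hUw⟩ := exists_im_mem_Ioc hper z
    rw [← hUw, ← hw]
    exact this (by rwa [hw]) hwim
  have habs := abs_nonneg z.re
  have hK1 := (hK z (by linarith)).one_le
  set D := 2016 * K ^ 8 * σ with hD
  have hD0 : 0 ≤ D := by positivity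
  set c := Real.exp (-(R - |z.re|) / 2) with hc
  have him' : |z.im| ≤ Real.pi := abs_le.2 ⟨him.1.le, him.2⟩
  have hderiv : ∀ ζ : ℂ, |ζ.re| ≤ |z.re| → |ζ.im| ≤ Real.pi → ∀ v,
      ‖planarDeriv E U ζ v‖ ≤ D * Real.exp (-(R - |ζ.re|) / 2) * ‖v‖ := fun ζ h1 h2 v ↦
    norm_planarDeriv_le_exp hU hper hK hball hE hσ0 hσ (by linarith) h2 v
  have hvert : edist (U z) (U z.re) ≤ ENNReal.ofReal (D * c * Real.pi) := by
    have hre : ∀ ζ ∈ segment ℝ z (z.re : ℂ), ζ.re = z.re ∧ |ζ.im| ≤ Real.pi := by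
      intro ζ hζ
      rw [segment_eq_image'] at hζ
      obtain ⟨τ, hτ, rfl⟩ := hζ
      refine ⟨by simp, ?_⟩
      have : (z + τ • ((z.re : ℂ) - z)).im = (1 - τ) * z.im := by simp; ring
      rw [this, abs_mul, abs_of_nonneg (by linarith [hτ.2])]
      have := abs_nonneg z.im
      nlinarith [hτ.1, hτ.2]
    refine (edist_le_of_norm_planarDeriv_le hU.isOpen hU.smooth (C := D * c) ?_ ?_).trans ?_
    · intro ζ hζ
      simp only [mem_ofPred_eq, (hre ζ hζ).1]
      linarith
    · intro ζ hζ v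
      have := hderiv ζ (by rw [(hre ζ hζ).1]) (hre ζ hζ).2 v
      rwa [(hre ζ hζ).1] at this
    · apply ENNReal.ofReal_le_ofReal
      have h1 : (z.re : ℂ) - z = ((-z.im : ℝ) : ℂ) * Complex.I := by
        apply Complex.ext <;> simp
      have h2 : ‖(z.re : ℂ) - z‖ = |z.im| := by
        rw [h1, norm_mul, Complex.norm_I, mul_one, Complex.norm_real, norm_neg, Real.norm_eq_abs]
      rw [h2]
      gcongr
  have hhor : edist (U 0) (U z.re) ≤ ENNReal.ofReal (2 * D * c) := by
    have hre : ∀ τ ∈ Icc (0 : ℝ) 1, |(0 + τ • ((z.re : ℂ) - 0)).re| = τ * |z.re| ∧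
        (0 + τ • ((z.re : ℂ) - 0)).im = 0 := by
      intro τ hτ
      refine ⟨?_, by simp⟩
      simp [abs_mul, abs_of_nonneg hτ.1]
    have hτle : ∀ τ ∈ Icc (0 : ℝ) 1, τ * |z.re| ≤ |z.re| := fun τ hτ ↦
      mul_le_of_le_one_left habs hτ.2
    refine (edist_le_lintegral_segment hU.isOpen hU.smooth ?_).trans ?_
    · intro ζ hζ
      rw [segment_eq_image'] at hζ
      obtain ⟨τ, hτ, rfl⟩ := hζ
      change |(0 + τ • ((z.re : ℂ) - 0)).re| < R
      rw [(hre τ hτ).1]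
      linarith [hτle τ hτ]
    · calc _ ≤ ∫⁻ τ in Icc (0 : ℝ) 1,
            ENNReal.ofReal (D * Real.exp (-R / 2 + τ * |z.re| / 2) * |z.re|) := by
            apply setLIntegral_mono' measurableSet_Icc
            intro τ hτ
            rw [← ofReal_norm]
            apply ENNReal.ofReal_le_ofReal
            refine (hderiv _ ?_ ?_ _).trans (le_of_eq ?_)
            · rw [(hre τ hτ).1]; exact hτle τ hτ
            · rw [(hre τ hτ).2, abs_zero]; exact Real.pi_pos.le
            · rw [(hre τ hτ).1, sub_zero, Complex.norm_real, Real.norm_eq_abs]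
              congr 3
              ring
        _ ≤ ENNReal.ofReal (2 * D * Real.exp (-R / 2 + |z.re| / 2)) :=
            lintegral_exp_mul_le habs hD0
        _ = _ := by
            rw [hc]
            congr 3
            ring
  calc edist (U z) (U 0) ≤ edist (U z) (U z.re) + edist (U 0) (U z.re) :=
        edist_triangle_right _ _ _
    _ ≤ ENNReal.ofReal (D * c * Real.pi) + ENNReal.ofReal (2 * D * c) := add_le_add hvert hhor
    _ = ENNReal.ofReal (D * c * Real.pi + 2 * D * c) := by
        rw [ENNReal.ofReal_add (by positivity) (by positivity)]
    _ ≤ _ := by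
        apply ENNReal.ofReal_le_ofReal
        have h1 := Real.pi_le_four
        have h2 : 0 ≤ D * c := by positivity
        calc _ ≤ 6 * (D * c) := by nlinarith
          _ = _ := by rw [hD]; ring

theorem exists_abs_eq_sub {t s : ℝ} (hs : 0 ≤ s) (hst : s ≤ |t|) :
    ∃ t' : ℝ, |t'| = |t| - s ∧ |t' - t| = s := by
  rcases le_total 0 t with h | h
  · rw [abs_of_nonneg h] at *
    exact ⟨t - s, abs_of_nonneg (by linarith), by simp [abs_of_nonneg hs]⟩
  · rw [abs_of_nonpos h] at *
    refine ⟨t + s, ?_, by simp [abs_of_nonneg hs]⟩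
    rw [abs_of_nonpos (by linarith)]
    ring

/-- A map of small energy stays in the domain of one adapted chart, no matter how long the strip is.
This is proved by continuation: if the image of the strip of half-width `n / 2` stays within half
the radius of the chart, then the image of the next strip lies in the domain of the chart, since the
gradient is small. There `edist_zero_le_exp` gives back the better bound, up to the outer part of
width `1`, where the gradient bound suffices. -/
theorem edist_zero_le_of_stripEnergy (hU : IsJHolomorphicOn J {z : ℂ | |z.re| < R} U)
    (hper : ∀ z, U (z + 2 * Real.pi * Complex.I) = U z)
    (hK : ∀ z : ℂ, |z.re| < R → HasAdaptedChart J K (U z))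
    (hE : stripEnergy E U (Ioo (-R) R) ≤ ENNReal.ofReal (σ ^ 2)) (hσ0 : 0 ≤ σ)
    (hσ : 32000 * K ^ 12 * σ ≤ 1) {z : ℂ} (hz : |z.re| + 1 / 2 < R) :
    edist (U z) (U 0) ≤ ENNReal.ofReal (K⁻¹ / 2) := by
  have hK1 := (hK z (by linarith)).one_le
  have hσK : 16000 * K ^ 8 * σ ≤ K⁻¹ / 2 := by
    rw [div_eq_inv_mul, ← mul_inv, ← one_div, le_div_iff₀ (by positivity)]
    calc 16000 * K ^ 8 * σ * (2 * K) = 32000 * K ^ 9 * σ := by ring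
      _ ≤ 32000 * K ^ 12 * σ := by
        gcongr
        norm_num
      _ ≤ 1 := hσ
  have hK68 : K ^ 6 * σ ≤ K ^ 8 * σ := by
    gcongr
    norm_num
  -- moving horizontally towards the centre by `s` costs at most `504 * K ^ 6 * σ * s`
  have hhor : ∀ w : ℂ, |w.re| + 1 / 2 < R → |w.im| ≤ Real.pi → ∀ s, 0 ≤ s → s ≤ |w.re| →
      ∃ w' : ℂ, |w'.re| = |w.re| - s ∧
        edist (U w) (U w') ≤ ENNReal.ofReal (504 * K ^ 6 * σ * s) := by
    intro w hw him s hs hsw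
    obtain ⟨t', ht', hts⟩ := exists_abs_eq_sub hs hsw
    refine ⟨⟨t', w.im⟩, ht', ?_⟩
    have h1 : ‖(⟨t', w.im⟩ : ℂ) - w‖ = s := by
      have : (⟨t', w.im⟩ : ℂ) - w = ((t' - w.re : ℝ) : ℂ) := by
        apply Complex.ext <;> simp
      rw [this, Complex.norm_real, Real.norm_eq_abs, hts]
    rw [← h1]
    refine edist_le_of_stripEnergy hU hper hK hE hσ0 hσ hw ?_ him him
    change |t'| + 1 / 2 < R
    linarith
  have hshort : ∀ w : ℂ, |w.re| + 1 / 2 < R → |w.im| ≤ Real.pi → |w.re| ≤ 1 →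
      edist (U w) (U 0) ≤ ENNReal.ofReal (K⁻¹ / 2) := by
    intro w hw him hw1
    refine (edist_le_of_stripEnergy hU hper hK hE hσ0 hσ hw (z' := 0) ?_ him ?_).trans ?_
    · simp only [Complex.zero_re, abs_zero]
      linarith [abs_nonneg w.re]
    · simpa using Real.pi_pos.le
    · apply ENNReal.ofReal_le_ofReal
      have h1 : ‖0 - w‖ ≤ 5 := by
        rw [zero_sub, norm_neg]
        linarith [Complex.norm_le_abs_re_add_abs_im w, Real.pi_le_four]
      calc _ ≤ 504 * K ^ 6 * σ * 5 := by gcongr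
        _ ≤ 16000 * (K ^ 8 * σ) := by
          have : 0 ≤ K ^ 8 * σ := by positivity
          linarith
        _ ≤ _ := by linarith
  have key : ∀ n : ℕ, ∀ z : ℂ, |z.re| + 1 / 2 < R → |z.re| ≤ n / 2 →
      edist (U z) (U 0) ≤ ENNReal.ofReal (K⁻¹ / 2) := by
    intro n
    induction n with
    | zero =>
      intro z hz hzn
      obtain ⟨w, hw, hwim, hUw⟩ := exists_im_mem_Ioc hper z
      rw [← hUw]
      rw [← hw] at hz hzn
      refine hshort w hz (abs_le.2 ⟨hwim.1.le, hwim.2⟩) (hzn.trans (by norm_num))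
    | succ n ih =>
      intro z hz hzn
      obtain ⟨w, hw, hwim, hUw⟩ := exists_im_mem_Ioc hper z
      have him : |w.im| ≤ Real.pi := abs_le.2 ⟨hwim.1.le, hwim.2⟩
      rw [← hUw]
      rw [← hw] at hz hzn
      clear hUw hw
      rcases lt_or_ge |w.re| 1 with h1 | h1
      · exact hshort w hz him h1.le
      · have hsub : {ζ : ℂ | |ζ.re| < |w.re|} ⊆ {ζ : ℂ | |ζ.re| < R} := by
          intro ζ hζ
          simp only [mem_ofPred_eq] at *
          linarith
        have hball : ∀ ζ : ℂ, |ζ.re| < |w.re| → U ζ ∈ Metric.eball (U 0) (ENNReal.ofReal K⁻¹) := by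
          intro ζ hζ
          obtain ⟨ξ, hξ, hξim, hUξ⟩ := exists_im_mem_Ioc hper ζ
          rw [← hUξ]
          rw [← hξ] at hζ
          have habs := abs_nonneg ξ.re
          obtain ⟨ξ', hξ', hd⟩ := hhor ξ (by linarith) (abs_le.2 ⟨hξim.1.le, hξim.2⟩)
            (min (1 / 2) |ξ.re|) (by positivity) (min_le_right _ _)
          have hξn : |ξ'.re| ≤ n / 2 := by
            push_cast at hzn
            rw [hξ']
            rcases min_choice (1 / 2) |ξ.re| with h | h <;> rw [h]
            · linarith
            · rw [sub_self]; positivity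
          have h2 := ih ξ' (by
            have : 0 ≤ min (1 / 2) |ξ.re| := by positivity
            linarith) hξn
          rw [Metric.mem_eball]
          calc _ ≤ edist (U ξ) (U ξ') + edist (U ξ') (U 0) := edist_triangle _ _ _
            _ ≤ ENNReal.ofReal (504 * K ^ 6 * σ * (1 / 2)) + ENNReal.ofReal (K⁻¹ / 2) := by
              gcongr
              refine hd.trans ?_
              gcongr
              exact min_le_left _ _
            _ = ENNReal.ofReal (504 * K ^ 6 * σ * (1 / 2) + K⁻¹ / 2) := by
              rw [ENNReal.ofReal_add (by positivity) (by positivity)]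
            _ < _ := by
              have h3 : 0 < K⁻¹ := by positivity
              rw [ENNReal.ofReal_lt_ofReal_iff h3]
              have : 0 ≤ K ^ 8 * σ := by positivity
              linarith
        obtain ⟨w', hw', hd⟩ := hhor w hz him 1 zero_le_one h1
        have h2 := edist_zero_le_exp (hU.mono (isOpen_strip _) hsub) hper
          (fun ζ hζ ↦ hK ζ (hsub hζ)) hball
          ((stripEnergy_mono (Ioo_subset_Ioo (by linarith) (by linarith))).trans hE) hσ0 hσ
          (z := w') (by linarith)
        calc _ ≤ edist (U w) (U w') + edist (U w') (U 0) := edist_triangle _ _ _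
          _ ≤ ENNReal.ofReal (504 * K ^ 6 * σ * 1) + ENNReal.ofReal (12096 * K ^ 8 * σ * 1) := by
            refine add_le_add hd (h2.trans ?_)
            gcongr
            rw [Real.exp_le_one_iff]
            linarith
          _ = ENNReal.ofReal (504 * K ^ 6 * σ * 1 + 12096 * K ^ 8 * σ * 1) := by
            rw [ENNReal.ofReal_add (by positivity) (by positivity)]
          _ ≤ _ := by
            apply ENNReal.ofReal_le_ofReal
            have : 0 ≤ K ^ 8 * σ := by positivity
            linarith
  obtain ⟨n, hn⟩ := exists_nat_ge (2 * |z.re|)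
  exact key n z hz (by linarith)

end Diameter

/-! ### Maps on the cylinder and their lifts to the strip -/

section Cylinder

variable {E : Type*} [NormedAddCommGroup E] [NormedSpace ℝ E]
  {X : Type*} [EMetricSpace X] [ChartedSpace E X] [IsManifold 𝓘(ℝ, E) ∞ X]
  [RiemannianBundle (fun x : X ↦ TangentSpace 𝓘(ℝ, E) x)]
  [IsContMDiffRiemannianBundle 𝓘(ℝ, E) ∞ E (fun x : X ↦ TangentSpace 𝓘(ℝ, E) x)]
  [IsRiemannianManifold 𝓘(ℝ, E) X]
  {J : AlmostComplexStructure E X} {u : ℝ × Circle → X} {K R : ℝ}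

theorem cylinderCoord_mem_cylinder {a b : ℝ} {z : ℂ} :
    cylinderCoord z ∈ cylinder a b ↔ z.re ∈ Icc a b := by
  simp [cylinderCoord, cylinder]

theorem cylinderCoord_add_period (z : ℂ) :
    cylinderCoord (z + 2 * Real.pi * Complex.I) = cylinderCoord z := by
  have : (z + 2 * Real.pi * Complex.I).im = z.im + 2 * Real.pi := by simp
  ext1
  · simp [cylinderCoord]
  · simp only [cylinderCoord, this, Circle.exp_add, Circle.exp_two_pi, mul_one]

theorem contMDiff_cylinderCoord :
    ContMDiff 𝓘(ℝ, ℂ) (𝓘(ℝ, ℝ).prod (𝓡 1)) ∞ cylinderCoord :=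
  ContMDiff.prodMk Complex.reCLM.contDiff.contMDiff
    (contMDiff_circleExp.comp Complex.imCLM.contDiff.contMDiff)

theorem image_cylinder (u : ℝ × Circle → X) (a b : ℝ) :
    u '' cylinder a b = (fun z ↦ u (cylinderCoord z)) '' {z : ℂ | z.re ∈ Icc a b} := by
  ext x
  constructor
  · rintro ⟨⟨t, c⟩, h, rfl⟩
    refine ⟨⟨t, Complex.arg c⟩, h.1, ?_⟩
    simp [cylinderCoord, Circle.exp_arg]
  · rintro ⟨z, hz, rfl⟩
    exact ⟨_, cylinderCoord_mem_cylinder.2 hz, rfl⟩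

theorem preimage_cylinder_mem_nhds {z : ℂ} (hz : |z.re| < R) :
    cylinderCoord ⁻¹' cylinder (-R) R ∈ nhds z := by
  filter_upwards [(isOpen_strip R).mem_nhds hz] with w hw
  exact cylinderCoord_mem_cylinder.2 (abs_le.1 (le_of_lt hw))

theorem cylinderDeriv_eq_planarDeriv {z : ℂ} (hz : |z.re| < R) (v : ℂ) :
    cylinderDeriv E R u z v = planarDeriv E (fun w ↦ u (cylinderCoord w)) z v := by
  rw [cylinderDeriv, mfderivWithin_of_mem_nhds (preimage_cylinder_mem_nhds hz)]
  rfl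

theorem IsJHolomorphicCylinder.isJHolomorphicOn (hu : IsJHolomorphicCylinder J R u) :
    IsJHolomorphicOn J {z : ℂ | |z.re| < R} (fun z ↦ u (cylinderCoord z)) where
  isOpen := isOpen_strip R
  smooth := hu.smooth.comp contMDiff_cylinderCoord.contMDiffOn fun z hz ↦
    cylinderCoord_mem_cylinder.2 (abs_le.1 (le_of_lt hz))
  map_I_mul z hz v := by
    have := hu.map_I_mul z (cylinderCoord_mem_cylinder.2 (abs_le.1 (le_of_lt hz))) v
    rwa [cylinderDeriv_eq_planarDeriv hz, cylinderDeriv_eq_planarDeriv hz] at this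

theorem cylinderEnergy_eq (a b : ℝ) :
    cylinderEnergy E R u (cylinder a b) = 2⁻¹ * ∫⁻ z in Icc a b ×ℂ Ioc (-Real.pi) Real.pi,
      (‖cylinderDeriv E R u z 1‖ₑ ^ 2 + ‖cylinderDeriv E R u z Complex.I‖ₑ ^ 2) := by
  rw [cylinderEnergy]
  congr 3
  ext z
  rw [Complex.mem_reProdIm, mem_ofPred_eq, cylinderCoord_mem_cylinder]
  exact and_comm

theorem stripEnergy_le_cylinderEnergy :
    stripEnergy E (fun z ↦ u (cylinderCoord z)) (Ioo (-R) R) ≤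
      2 * cylinderEnergy E R u (cylinder (-R) R) := by
  rw [cylinderEnergy_eq, ← mul_assoc, ENNReal.mul_inv_cancel (by simp) (by simp), one_mul,
    stripEnergy]
  calc _ = ∫⁻ z in Ioo (-R) R ×ℂ Ioc (-Real.pi) Real.pi, ‖cylinderDeriv E R u z 1‖ₑ ^ 2 := by
        apply setLIntegral_congr_fun (measurableSet_reProdIm measurableSet_Ioo measurableSet_Ioc)
        intro z hz
        simp only
        rw [cylinderDeriv_eq_planarDeriv (abs_lt.2 hz.1)]
    _ ≤ ∫⁻ z in Ioo (-R) R ×ℂ Ioc (-Real.pi) Real.pi,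
        (‖cylinderDeriv E R u z 1‖ₑ ^ 2 + ‖cylinderDeriv E R u z Complex.I‖ₑ ^ 2) :=
        lintegral_mono fun z ↦ le_self_add
    _ ≤ _ := by
        gcongr
        exact Complex.reProdIm_subset_iff.2 (prod_mono Ioo_subset_Icc_self le_rfl)

theorem cylinderEnergy_le_stripEnergy (hu : IsJHolomorphicCylinder J R u)
    (hK : ∀ z : ℂ, |z.re| < R → HasAdaptedChart J K (u (cylinderCoord z))) {b : ℝ} (hb : 0 ≤ b)
    (hbR : b < R) :
    cylinderEnergy E R u (cylinder (-b) b) ≤ ENNReal.ofReal (5 / 2 * K ^ 4) *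
      stripEnergy E (fun z ↦ u (cylinderCoord z)) (Icc (-b) b) := by
  have hK1 : 1 ≤ K := (hK 0 (by simp; linarith)).one_le
  have h2 : (2 : ENNReal)⁻¹ = ENNReal.ofReal 2⁻¹ := by
    rw [ENNReal.ofReal_inv_of_pos (by norm_num)]; simp
  have h5 : ENNReal.ofReal (5 / 2 * K ^ 4) = 2⁻¹ * ENNReal.ofReal (5 * K ^ 4) := by
    rw [h2, ← ENNReal.ofReal_mul (by norm_num)]
    congr 1
    ring
  rw [cylinderEnergy_eq, h5, mul_assoc]
  gcongr
  rw [stripEnergy, ← lintegral_const_mul' _ _ ENNReal.ofReal_ne_top]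
  apply setLIntegral_mono' (measurableSet_reProdIm measurableSet_Icc measurableSet_Ioc)
  intro z hz
  have hz' : |z.re| < R := (abs_le.2 hz.1).trans_lt hbR
  rw [cylinderDeriv_eq_planarDeriv hz', cylinderDeriv_eq_planarDeriv hz', ← ofReal_norm,
    ← ofReal_norm, ← ENNReal.ofReal_pow (norm_nonneg _), ← ENNReal.ofReal_pow (norm_nonneg _),
    ← ENNReal.ofReal_add (by positivity) (by positivity), ← ENNReal.ofReal_mul (by positivity)]
  apply ENNReal.ofReal_le_ofReal
  have h1 := hu.isJHolomorphicOn.map_I_mul z hz' 1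
  rw [mul_one] at h1
  rw [h1]
  have h3 := (hK z hz').norm_toEnd_le (planarDeriv E (fun w ↦ u (cylinderCoord w)) z 1)
  set d := ‖planarDeriv E (fun w ↦ u (cylinderCoord w)) z 1‖
  have h4 : 1 ≤ K ^ 4 := one_le_pow₀ hK1
  calc _ ≤ d ^ 2 + (2 * K ^ 2 * d) ^ 2 := by gcongr
    _ ≤ 5 * K ^ 4 * d ^ 2 := by nlinarith [sq_nonneg d]

theorem ediam_image_cylinder_le {b : ℝ} {B : ENNReal}
    (h : ∀ z : ℂ, |z.re| ≤ b → edist (u (cylinderCoord z)) (u (cylinderCoord 0)) ≤ B) :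
    Metric.ediam (u '' cylinder (-b) b) ≤ B + B := by
  rw [image_cylinder]
  apply Metric.ediam_le
  rintro _ ⟨z, hz, rfl⟩ _ ⟨w, hw, rfl⟩
  exact (edist_triangle_right _ _ _).trans (add_le_add (h z (abs_le.2 hz)) (h w (abs_le.2 hw)))

/-- The energy estimate, if the image of the part of the cylinder over `(-R', R')` lies in the
domain of an adapted chart about the image of the centre. -/
theorem IsJHolomorphicCylinder.energy_le (hu : IsJHolomorphicCylinder J R u) {R' : ℝ}
    (hR' : R' ≤ R) (hR'1 : R ≤ R' + 1 / 2)
    (hK : ∀ z : ℂ, |z.re| < R → HasAdaptedChart J K (u (cylinderCoord z)))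
    (hball : ∀ z : ℂ, |z.re| < R' →
      u (cylinderCoord z) ∈ Metric.eball (u (cylinderCoord 0)) (ENNReal.ofReal K⁻¹))
    {T : ℝ} (hT : R - R' < T) :
    cylinderEnergy E R u (cylinder (-R + T) (R - T)) ≤
      ENNReal.ofReal (100000 * K ^ 8 * Real.exp (-T)) *
        cylinderEnergy E R u (cylinder (-R) R) := by
  have hset : cylinder (-R + T) (R - T) = cylinder (-(R - T)) (R - T) := by
    rw [neg_sub]; congr 1; ring
  rw [hset]
  rcases lt_or_ge (R - T) 0 with hneg | hb
  · have : cylinder (-(R - T)) (R - T) = ∅ := by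
      rw [cylinder, Icc_eq_empty (by linarith), empty_prod]
    rw [this]
    simp [cylinderEnergy]
  have hsub : {ζ : ℂ | |ζ.re| < R'} ⊆ {ζ : ℂ | |ζ.re| < R} := fun ζ hζ ↦ hζ.trans_le hR'
  have hK0 : HasAdaptedChart J K (u (cylinderCoord 0)) := hK 0 (by simp; linarith)
  have hd := stripEnergy_decay (hu.isJHolomorphicOn.mono (isOpen_strip R') hsub)
    (fun z ↦ by simp only [cylinderCoord_add_period]) hK0 hball hb (by linarith)
  calc _ ≤ ENNReal.ofReal (5 / 2 * K ^ 4) *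
        (ENNReal.ofReal (3 * K ^ 4 * Real.exp (-(R' - (R - T)))) *
          (2 * cylinderEnergy E R u (cylinder (-R) R))) := by
        refine (cylinderEnergy_le_stripEnergy hu hK hb (by linarith)).trans ?_
        gcongr
        refine hd.trans ?_
        gcongr
        exact (stripEnergy_mono (Ioo_subset_Ioo (by linarith) hR')).trans
          stripEnergy_le_cylinderEnergy
    _ = ENNReal.ofReal (15 * K ^ 8 * Real.exp (-(R' - (R - T)))) *
          cylinderEnergy E R u (cylinder (-R) R) := by
        rw [← mul_assoc, ← mul_assoc, ← ENNReal.ofReal_mul (by positivity),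
          (by simp : (2 : ENNReal) = ENNReal.ofReal 2), ← ENNReal.ofReal_mul (by positivity)]
        congr 2
        ring
    _ ≤ _ := by
        refine mul_le_mul' (ENNReal.ofReal_le_ofReal ?_) le_rfl
        have h1 : Real.exp (-(R' - (R - T))) ≤ 3 * Real.exp (-T) := by
          calc _ ≤ Real.exp (1 + -T) := Real.exp_le_exp.2 (by linarith)
            _ = Real.exp 1 * Real.exp (-T) := Real.exp_add _ _
            _ ≤ _ := by
              gcongr
              exact Real.exp_one_lt_three.le
        have h2 : 0 ≤ K ^ 8 * Real.exp (-T) := by positivity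
        calc _ ≤ 15 * K ^ 8 * (3 * Real.exp (-T)) := by gcongr
          _ ≤ _ := by linarith

/-- The diameter estimate, if the image of the part of the cylinder over `(-R', R')` lies in the
domain of an adapted chart about the image of the centre. -/
theorem IsJHolomorphicCylinder.ediam_le (hu : IsJHolomorphicCylinder J R u) {R' : ℝ}
    (hR' : R' ≤ R) (hR'1 : R ≤ R' + 1 / 2)
    (hK : ∀ z : ℂ, |z.re| < R → HasAdaptedChart J K (u (cylinderCoord z)))
    (hball : ∀ z : ℂ, |z.re| < R' →
      u (cylinderCoord z) ∈ Metric.eball (u (cylinderCoord 0)) (ENNReal.ofReal K⁻¹))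
    {s : ℝ} (hs0 : 0 ≤ s) (hs : cylinderEnergy E R u (cylinder (-R) R) = ENNReal.ofReal (s ^ 2))
    (hsK : 64000 * K ^ 12 * s ≤ 1) {T : ℝ} (hT : R - R' + 1 ≤ T) :
    Metric.ediam (u '' cylinder (-R + T) (R - T)) ≤
      ENNReal.ofReal (100000 * K ^ 8 * Real.exp (-T / 2)) *
        cylinderEnergy E R u (cylinder (-R) R) ^ (1 / 2 : ℝ) := by
  have hset : cylinder (-R + T) (R - T) = cylinder (-(R - T)) (R - T) := by
    rw [neg_sub]; congr 1; ring
  rw [hset]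
  rcases lt_or_ge (R - T) 0 with hneg | hb
  · have : cylinder (-(R - T)) (R - T) = ∅ := by
      rw [cylinder, Icc_eq_empty (by linarith), empty_prod]
    rw [this, image_empty, Metric.ediam_empty]
    exact zero_le
  have hsub : {ζ : ℂ | |ζ.re| < R'} ⊆ {ζ : ℂ | |ζ.re| < R} := fun ζ hζ ↦ hζ.trans_le hR'
  have hK0 : HasAdaptedChart J K (u (cylinderCoord 0)) := hK 0 (by simp; linarith)
  have hK1 := hK0.one_le
  have hE : stripEnergy E (fun z ↦ u (cylinderCoord z)) (Ioo (-R') R') ≤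
      ENNReal.ofReal ((2 * s) ^ 2) := by
    refine (stripEnergy_mono (Ioo_subset_Ioo (by linarith) hR')).trans
      (stripEnergy_le_cylinderEnergy.trans ?_)
    rw [hs, (by simp : (2 : ENNReal) = ENNReal.ofReal 2), ← ENNReal.ofReal_mul (by positivity)]
    apply ENNReal.ofReal_le_ofReal
    nlinarith [sq_nonneg s]
  have hsqrt : cylinderEnergy E R u (cylinder (-R) R) ^ (1 / 2 : ℝ) = ENNReal.ofReal s := by
    rw [hs, ENNReal.ofReal_pow hs0, ← ENNReal.rpow_natCast, ← ENNReal.rpow_mul]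
    simp
  have hexp : Real.exp (-(R' - (R - T)) / 2) ≤ 2 * Real.exp (-T / 2) := by
    have h1 : Real.exp (1 / 4) ≤ 2 := by
      have := Real.exp_bound_div_one_sub_of_interval (x := 1 / 4) (by norm_num) (by norm_num)
      linarith
    calc _ ≤ Real.exp (1 / 4 + -T / 2) := Real.exp_le_exp.2 (by linarith)
      _ = Real.exp (1 / 4) * Real.exp (-T / 2) := Real.exp_add _ _
      _ ≤ _ := by gcongr
  refine (ediam_image_cylinder_le
    (B := ENNReal.ofReal (48384 * K ^ 8 * s * Real.exp (-T / 2))) ?_).trans ?_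
  · intro z hz
    refine (edist_zero_le_exp (hu.isJHolomorphicOn.mono (isOpen_strip R') hsub)
      (fun z ↦ by simp only [cylinderCoord_add_period]) (fun ζ hζ ↦ hK ζ (hsub hζ)) hball hE
      (by positivity) (by linarith) (z := z) (by linarith)).trans ?_
    apply ENNReal.ofReal_le_ofReal
    calc _ ≤ 12096 * K ^ 8 * (2 * s) * Real.exp (-(R' - (R - T)) / 2) := by gcongr
      _ ≤ 12096 * K ^ 8 * (2 * s) * (2 * Real.exp (-T / 2)) := by gcongr
      _ = _ := by ring
  · rw [hsqrt, ← ENNReal.ofReal_mul (by positivity),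
      ← ENNReal.ofReal_add (by positivity) (by positivity)]
    apply ENNReal.ofReal_le_ofReal
    have : 0 ≤ K ^ 8 * s * Real.exp (-T / 2) := by positivity
    linarith

theorem exists_sqrt_of_lt {e : ENNReal} {c : ℝ} (hc : 0 < c)
    (h : e < ENNReal.ofReal ((1 / c) ^ 2)) :
    ∃ s : ℝ, 0 ≤ s ∧ e = ENNReal.ofReal (s ^ 2) ∧ c * s ≤ 1 := by
  have htop : e ≠ ⊤ := (h.trans ENNReal.ofReal_lt_top).ne
  refine ⟨√e.toReal, Real.sqrt_nonneg _, ?_, ?_⟩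
  · rw [Real.sq_sqrt ENNReal.toReal_nonneg, ENNReal.ofReal_toReal htop]
  · have h1 : e.toReal ≤ (1 / c) ^ 2 := by
      apply ENNReal.toReal_le_of_le_ofReal (by positivity) h.le
    have h2 : √e.toReal ≤ 1 / c := Real.sqrt_le_left (by positivity) |>.2 h1
    calc c * √e.toReal ≤ c * (1 / c) := by gcongr
      _ = 1 := by field_simp

/-- The constant of an adapted chart can be chosen continuously, by a partition of unity: the set of
constants which work at a given point is an interval, and some constant works on a neighbourhood. -/
theorem exists_continuous_hasAdaptedChart [FiniteDimensional ℝ E] (J : AlmostComplexStructure E X) :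
    ∃ K : X → ℝ, Continuous K ∧ ∀ x, HasAdaptedChart J (K x) x := by
  obtain ⟨f, hf⟩ := exists_continuous_forall_mem_convex_of_local_const
    (X := X) (E := ℝ) (t := fun x ↦ {K | HasAdaptedChart J K x})
    (fun x ↦ OrdConnected.convex (IsUpperSet.ordConnected fun _ _ hab h ↦ h.mono hab))
    (fun x ↦ eventually_hasAdaptedChart J x)
  exact ⟨f, f.continuous, hf⟩

end Cylinder

end

theorem proposition4p14
    {E : Type*} [NormedAddCommGroup E] [NormedSpace ℝ E] [FiniteDimensional ℝ E]
    {X : Type*} [EMetricSpace X] [ChartedSpace E X] [IsManifold 𝓘(ℝ, E) ∞ X]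
    [RiemannianBundle (fun x : X ↦ TangentSpace 𝓘(ℝ, E) x)]
    [IsContMDiffRiemannianBundle 𝓘(ℝ, E) ∞ E (fun x : X ↦ TangentSpace 𝓘(ℝ, E) x)]
    [IsRiemannianManifold 𝓘(ℝ, E) X]
    (J : AlmostComplexStructure E X) :
    (∃ δ ℏ C : X → ℝ,
      Continuous δ ∧ Continuous ℏ ∧ Continuous C ∧
      (∀ x, 0 < δ x) ∧ (∀ x, 0 < ℏ x) ∧ (∀ x, 0 < C x) ∧
      ∀ (R : ℝ) (u : ℝ × Circle → X), 0 < R → IsJHolomorphicCylinder J R u →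
        u '' cylinder (-R) R ⊆ Metric.eball (u (0, 1)) (ENNReal.ofReal (δ (u (0, 1)))) →
        (∀ T : ℝ, 0 ≤ T →
          cylinderEnergy E R u (cylinder (-R + T) (R - T)) ≤
            ENNReal.ofReal (C (u (0, 1)) * Real.exp (-T)) *
              cylinderEnergy E R u (cylinder (-R) R)) ∧
        (cylinderEnergy E R u (cylinder (-R) R) < ENNReal.ofReal (ℏ (u (0, 1))) →
          ∀ T : ℝ, 1 ≤ T →
            Metric.ediam (u '' cylinder (-R + T) (R - T)) ≤
              ENNReal.ofReal (C (u (0, 1)) * Real.exp (-T / 2)) *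
                cylinderEnergy E R u (cylinder (-R) R) ^ (1 / 2 : ℝ))) ∧
    (CompactSpace X → ∃ ℏ C : ℝ, 0 < ℏ ∧ 0 < C ∧
      ∀ (R : ℝ) (u : ℝ × Circle → X), 0 < R → IsJHolomorphicCylinder J R u →
        cylinderEnergy E R u (cylinder (-R) R) < ENNReal.ofReal ℏ →
        (∀ T : ℝ, 1 ≤ T →
          cylinderEnergy E R u (cylinder (-R + T) (R - T)) ≤
            ENNReal.ofReal (C * Real.exp (-T)) * cylinderEnergy E R u (cylinder (-R) R)) ∧
        (∀ T : ℝ, 2 ≤ T →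
          Metric.ediam (u '' cylinder (-R + T) (R - T)) ≤
            ENNReal.ofReal (C * Real.exp (-T / 2)) *
              cylinderEnergy E R u (cylinder (-R) R) ^ (1 / 2 : ℝ))) := by
  have hcoord : cylinderCoord 0 = (0, 1) := by simp [cylinderCoord]
  constructor
  · obtain ⟨K, hKc, hK⟩ := exists_continuous_hasAdaptedChart J
    have hK1 : ∀ x, 1 ≤ K x := fun x ↦ (hK x).one_le
    have hK0 : ∀ x, 0 < K x := fun x ↦ zero_lt_one.trans_le (hK1 x)
    refine ⟨fun x ↦ (2 * K x)⁻¹, fun x ↦ (1 / (64000 * (2 * K x) ^ 12)) ^ 2,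
      fun x ↦ 100000 * (2 * K x) ^ 8, ?_, ?_, by fun_prop, ?_, ?_, ?_, ?_⟩
    · exact (continuous_const.mul hKc).inv₀ fun x ↦ (mul_pos two_pos (hK0 x)).ne'
    · refine (continuous_const.div (by fun_prop) fun x ↦ ?_).pow 2
      have := hK0 x
      positivity
    · intro x
      have := hK0 x
      positivity
    · intro x
      have := hK0 x
      positivity
    · intro x
      have := hK0 x
      positivity
    -- the constant `K x` at the centre gives the constant `2 * K x` on the ball of radius
    -- `(2 * K x)⁻¹`, which contains the image of `u`
    · intro R u hR hu himage
      simp only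
      rw [← hcoord] at himage ⊢
      set x := u (cylinderCoord 0)
      have hball : ∀ z : ℂ, |z.re| < R →
          u (cylinderCoord z) ∈ Metric.eball x (ENNReal.ofReal (2 * K x)⁻¹) := fun z hz ↦
        himage ⟨_, cylinderCoord_mem_cylinder.2 (abs_le.1 hz.le), rfl⟩
      have hchart : ∀ z : ℂ, |z.re| < R → HasAdaptedChart J (2 * K x) (u (cylinderCoord z)) :=
        fun z hz ↦ (hK x).of_mem_eball (hball z hz)
      refine ⟨fun T hT ↦ ?_, fun hE T hT ↦ ?_⟩
      · rcases hT.eq_or_lt with rfl | hT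
        -- for `T = 0` the constant is at least `1`
        · have h1 : 1 ≤ (2 * K x) ^ 8 := one_le_pow₀ (by linarith [hK1 x])
          rw [add_zero, sub_zero, neg_zero, Real.exp_zero, mul_one]
          apply le_mul_of_one_le_left zero_le
          rw [ENNReal.one_le_ofReal]
          linarith
        · exact hu.energy_le le_rfl (by linarith) hchart hball (by simpa using hT)
      · have := hK0 x
        obtain ⟨s, hs0, hs, hsK⟩ := exists_sqrt_of_lt (by positivity) hE
        exact hu.ediam_le le_rfl (by linarith) hchart hball hs0 hs hsK (by simpa using hT)
  · intro hcompact
    obtain ⟨K', hK'⟩ := exists_forall_hasAdaptedChart J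
    -- on the empty manifold `K'` need not be positive
    set K := max K' 1 with hKdef
    have hK0 : 0 < K := lt_max_of_lt_right one_pos
    have hK : ∀ x, HasAdaptedChart J K x := fun x ↦ (hK' x).mono (le_max_left _ _)
    refine ⟨(1 / (64000 * K ^ 12)) ^ 2, 100000 * K ^ 8, by positivity, by positivity, ?_⟩
    intro R u hR hu hE
    obtain ⟨s, hs0, hs, hsK⟩ := exists_sqrt_of_lt (by positivity) hE
    have hchart : ∀ z : ℂ, |z.re| < R → HasAdaptedChart J K (u (cylinderCoord z)) :=
      fun z _ ↦ hK _
    have hES : stripEnergy E (fun z ↦ u (cylinderCoord z)) (Set.Ioo (-R) R) ≤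
        ENNReal.ofReal ((2 * s) ^ 2) := by
      refine stripEnergy_le_cylinderEnergy.trans ?_
      rw [hs, (by simp : (2 : ENNReal) = ENNReal.ofReal 2), ← ENNReal.ofReal_mul (by positivity)]
      apply ENNReal.ofReal_le_ofReal
      nlinarith [sq_nonneg s]
    -- half a unit at each end is lost, which accounts for the larger `T` in the compact case
    have hball : ∀ z : ℂ, |z.re| < R - 1 / 2 →
        u (cylinderCoord z) ∈ Metric.eball (u (cylinderCoord 0)) (ENNReal.ofReal K⁻¹) := by
      intro z hz
      have h1 := edist_zero_le_of_stripEnergy hu.isJHolomorphicOn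
        (fun z ↦ by simp only [cylinderCoord_add_period]) hchart hES (by positivity)
        (by linarith) (z := z) (by linarith)
      refine h1.trans_lt ?_
      have : 0 < K⁻¹ := by positivity
      rw [ENNReal.ofReal_lt_ofReal_iff this]
      linarith
    refine ⟨fun T hT ↦ ?_, fun T hT ↦ ?_⟩
    · exact hu.energy_le (by linarith) (by linarith) hchart hball (by linarith)
    · exact hu.ediam_le (by linarith) (by linarith) hchart hball hs0 hs hsK (by linarith)
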